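/- **Corollary 3.4 (Decay of cross-asset correlations).** Let $D^X,D^Y\in(0,1/2]$, $\sigma^X,\sigma^Y>0$, $\rho\in[-1,1]$ and $\lambda_1,\lambda_2,\lambda_3\ge 0$ with $\lambda^X:=\lambda_1+\lambda_2>0$ and $\lambda^Y:=\lambda_1+\lambda_3>0$. Let $W^X,\tilde W$ be independent standard Brownian motions on $[0,\infty)$ and $W^Y:=\rho W^X+\sqrt{1-\rho^2}\,\tilde W$. Let $\mathcal T^1,\mathcal T^2,\mathcal T^3$ be independent Poisson point processes on $\mathbb R$ with rates $\lambda_1,\lambda_2,\lambda_3$ (a process of rate $0$ being empty), and put $\mathcal T^X=\mathcal T^1\cup\mathcal T^2$, $\mathcal T^Y=\mathcal T^1\cup\mathcal T^3$; assume that $(W^X,W^Y)$ is independent of $(\mathcal T^X,\mathcal T^Y)$. Enumerate the points of $\mathcal T^X$ increasingly as $(\tau^X_n)_{n\in\mathbb Z}$ with $\tau^X_0<0<\tau^X_1$, let $i^X(t)=\#(\mathcal T^X\cap(0,t])$, and let $$I^X_t=(\sigma^X)^2\Big[(t-\tau^X_{i^X(t)})^{2D^X}+\sum_{k=1}^{i^X(t)}(\tau^X_k-\tau^X_{k-1})^{2D^X}-(-\tau^X_0)^{2D^X}\Big],\qquad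 X_t=W^X_{I^X_t}\qquad(t\ge 0).$$ Define $Y_t=W^Y_{I^Y_t}$ in the same way from $\mathcal T^Y,D^Y,\sigma^Y,W^Y$. Write $\rho(U,V)=\mathrm{Cov}(U,V)/\sqrt{\mathrm{Var}(U)\mathrm{Var}(V)}$. Let $E_1\sim\exp(\lambda_1)$, $S^2\sim\exp(\lambda_2/\lambda^X)$, $S^3\sim\exp(\lambda_3/\lambda^Y)$ be independent (an exponential variable of rate $0$ is $+\infty$ a.s.), and $$S^X=\min\{\lambda^X E_1,\,S^2\},\qquad S^Y=\min\{\lambda^Y E_1,\,S^3\}.$$ Let $S\sim\exp(1)$ and $N\sim\mathcal N(0,1)$ be independent. Then $S^X$ and $S^Y$ are exponential of rate $1$. Let either $t>0$, or $t=0$ and $\rho=0$. For every $h>0$ the variables $|X_h-X_0|$, $|X_{t+h}-X_t|$, $|Y_{t+h}-Y_t|$ are square integrable with positive variance; the variables in the limits below, namely $(S^X)^{D^X-1/2}$, $(\lambda^Yt+S^Y)^{D^Y-1/2}$, $S^{D^X-1/2}$, $(\lambda^Xt+S)^{D^X-1/2}$, $|N|S^{D^X-1/2}$ and $|N|S^{D^Y-1/2}$,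 are square integrable, the last two with positive variance; and $$\lim_{h\downarrow0}\rho\big(|X_h-X_0|,|Y_{t+h}-Y_t|\big)=\frac2\pi\,\frac{\mathrm{Cov}\big((S^X)^{D^X-1/2},(\lambda^Y t+S^Y)^{D^Y-1/2}\big)}{\sqrt{\mathrm{Var}(|N|S^{D^X-1/2})\,\mathrm{Var}(|N|S^{D^Y-1/2})}}\,e^{-\lambda^Y t}.$$ Moreover, for $t>0$ the univariate model satisfies $$\lim_{h\downarrow0}\rho\big(|X_h-X_0|,|X_{t+h}-X_t|\big)=\frac2\pi\,\frac{\mathrm{Cov}\big(S^{D^X-1/2},(\lambda^X t+S)^{D^X-1/2}\big)}{\mathrm{Var}(|N|S^{D^X-1/2})}\,e^{-\lambda^X t}.$$ -/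

import Mathlib

open MeasureTheory ProbabilityTheory Set Filter Topology
open scoped NNReal ENNReal

/-- The family of counts `#(T ∩ B)`, indexed by the Borel sets `B`, of a random set of points `T`.
The sigma-algebra generated by `T` is the one generated by these counts. -/
noncomputable def pointCounts {Ω : Type*} (T : Ω → Set ℝ) :
    Ω → {B : Set ℝ // MeasurableSet B} → ℕ∞ :=
  fun ω B => (T ω ∩ B.1).encard

/-- `T` is a (homogeneous) Poisson point process of rate `r ≥ 0` on the whole real line, seen as a
random set of points. For `r = 0` it is almost surely empty. -/
structure IsPoissonPointProcess {Ω : Type*} [MeasurableSpace Ω] (T : Ω → Set ℝ) (r : ℝ)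
    (μ : Measure Ω) : Prop where
  measurable_count : ∀ B : Set ℝ, MeasurableSet B → Measurable fun ω => (T ω ∩ B).encard
  poisson_count : ∀ B : Set ℝ, MeasurableSet B → volume B ≠ ∞ → ∀ k : ℕ,
    μ {ω | (T ω ∩ B).encard = k} =
      ENNReal.ofReal (Real.exp (-(r * (volume B).toReal)) * (r * (volume B).toReal) ^ k
        / (k.factorial : ℝ))
  indep_count : ∀ (n : ℕ) (B : Fin n → Set ℝ), (∀ i, MeasurableSet (B i)) →
    Pairwise (fun i j => Disjoint (B i) (B j)) →
    iIndepFun (fun (i : Fin n) (ω : Ω) => (T ω ∩ B i).encard) μ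

/-- `τ` is the increasing enumeration of the points of `T` by `ℤ` with `τ 0 < 0 < τ 1`. -/
structure IsLabelling (τ : ℤ → ℝ) (T : Set ℝ) : Prop where
  strictMono : StrictMono τ
  range_eq : Set.range τ = T
  neg : τ 0 < 0
  pos : 0 < τ 1

/-- The number `i(t)` of points in `(0, t]`. -/
noncomputable def jumpCount (τ : ℤ → ℝ) (t : ℝ) : ℕ := (Set.range τ ∩ Set.Ioc 0 t).ncard

/-- The time change
`I t = σ² [(t - τ_{i(t)})^{2D} + ∑_{k=1}^{i(t)} (τ_k - τ_{k-1})^{2D} - (-τ_0)^{2D}]`. -/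
noncomputable def timeChange (D σ : ℝ) (τ : ℤ → ℝ) (t : ℝ) : ℝ :=
  σ ^ 2 * ((t - τ (jumpCount τ t)) ^ (2 * D)
    + ∑ k ∈ Finset.Icc 1 (jumpCount τ t), (τ (k : ℤ) - τ ((k : ℤ) - 1)) ^ (2 * D)
    - (-τ 0) ^ (2 * D))

/-- The log-price `X t = W (I t)`, where `τ n ω` is the `n`-th point of the shock process. -/
noncomputable def logPrice {Ω : Type*} (W : ℝ≥0 → Ω → ℝ) (D σ : ℝ) (τ : ℤ → Ω → ℝ)
    (t : ℝ) (ω : Ω) : ℝ :=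
  W (timeChange D σ (fun n => τ n ω) t).toNNReal ω

/-- The absolute increment `|X (t + h) - X t|`. -/
def absReturn {Ω : Type*} (X : ℝ → Ω → ℝ) (t h : ℝ) (ω : Ω) : ℝ := |X (t + h) ω - X t ω|

/-- The combination `ρ W + √(1 - ρ²) W'` of two processes. -/
noncomputable def correlatedProcess {Ω : Type*} (ρ : ℝ) (W W' : ℝ≥0 → Ω → ℝ) (t : ℝ≥0)
    (ω : Ω) : ℝ :=
  ρ * W t ω + √(1 - ρ ^ 2) * W' t ω

/-- The correlation coefficient `Cov(U, V) / √(Var U · Var V)`. -/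
noncomputable def corrCoeff {Ω : Type*} [MeasurableSpace Ω] (U V : Ω → ℝ) (μ : Measure Ω) : ℝ :=
  cov[U, V; μ] / √(Var[U; μ] * Var[V; μ])

/-- `E` is exponential of rate `r ≥ 0`, i.e. `P(E > x) = exp (-r x)` for all `x ≥ 0`. The values
are in `[0, ∞]` because an exponential variable of rate `0` is almost surely infinite. -/
structure IsExponential {Ω : Type*} [MeasurableSpace Ω] (E : Ω → ℝ≥0∞) (r : ℝ)
    (μ : Measure Ω) : Prop where
  measurable : Measurable E
  tail : ∀ x : ℝ, 0 ≤ x → μ {ω | ENNReal.ofReal x < E ω} = ENNReal.ofReal (Real.exp (-(r * x)))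

/-! Given the shocks, an increment of either price is a centred Gaussian whose variance is the
increment of its clock. Freezing the clocks (Fubini for an independent pair,
`IsDriver.lintegral_freeze_pair`) turns the moments of the absolute returns into moments of square
roots of clock increments: the first moment gains the factor √(2/π), and the second is the mean
clock increment. The product moment gains 2/π whenever the two stretches of Brownian time give
independent increments. This can fail only if the X-clock at `h` has overtaken the Y-clock at `t`
and ρ ≠ 0; there Cauchy–Schwarz bounds the error (`IsDriver.integral_mul_abs_bound`).

Divide by `h`. Let `g` be the age at `t`, the time since the last shock. Without a shock in (t,
t+h], the clock gains σ²((g+h)^(2D) - g^(2D)), so the square root of the increment over `h` tends to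
σ√(2D) g^(D-1/2) and is dominated by it, by concavity. With `n` shocks the gain is at most
σ²(n+1)h^(2D), and the mean of `n` is at most rh, so this part vanishes after division by `h`. Hence
convergence in L² (`tendsto_sqrt_increment`). Overtaking almost surely stops as h → 0, so its error
is o(h), and the correlation tends to a ratio built from the limiting volatilities
(`tendsto_corrCoeff_absReturn`).

It remains to compute with ages. An age exceeds `y` exactly when an interval of length `y` is void,
so joint laws of ages follow from joint void probabilities. At time `t` the Y-age behaves like an
independent exponential variable if that variable is at most `t`, and otherwise like `t` plus the
Y-age at 0. Only the second alternative, of probability exp(-λ^Y t), correlates with the X-age at 0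
(`covariance_age_pair`). The ages at 0 have the law of (S^X/λ^X, S^Y/λ^Y), since both pairs have the
tail exp(-(λ₁ max(x,y) + λ₂x + λ₃y)). The scale factors cancel in the ratio. The univariate claim is
the case of a shock process paired with itself. -/

/-! ### Gaussian moments and exponential tails. -/

theorem integral_abs_gaussianReal_std : ∫ x, |x| ∂(gaussianReal 0 1) = √(2 / Real.pi) := by
  rw [integral_gaussianReal_eq_integral_smul one_ne_zero]
  have h : ∀ x : ℝ, gaussianPDFReal 0 1 x • |x|
      = (fun y => (√(2 * Real.pi))⁻¹ * (y ^ (1 : ℝ) * Real.exp (-(1 / 2) * y ^ (2 : ℝ)))) |x| := by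
    intro x
    simp only [gaussianPDFReal, smul_eq_mul, Real.rpow_one, Real.rpow_two, sq_abs]
    simp only [NNReal.coe_one, mul_one, sub_zero]
    rw [show -x ^ 2 / 2 = -(1 / 2) * x ^ 2 by ring]
    ring
  simp_rw [h]
  rw [integral_comp_abs (f := fun y => (√(2 * Real.pi))⁻¹ *
    (y ^ (1 : ℝ) * Real.exp (-(1 / 2) * y ^ (2 : ℝ)))), integral_const_mul,
    integral_rpow_mul_exp_neg_mul_rpow (by norm_num) (by norm_num) (by norm_num)]
  norm_num [Real.Gamma_one]
  have := Real.sq_sqrt (show (0 : ℝ) ≤ 2 by norm_num)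
  have h2 : √2 ≠ 0 := by positivity
  have h3 : √Real.pi ≠ 0 := by positivity
  field_simp
  nlinarith

theorem integral_abs_gaussianReal (v : ℝ≥0) :
    ∫ x, |x| ∂(gaussianReal 0 v) = √(2 / Real.pi) * √(v : ℝ) := by
  have h : (gaussianReal 0 1).map (√(v : ℝ) * ·) = gaussianReal 0 v := by
    rw [gaussianReal_map_const_mul]
    congr 1
    · simp
    · ext; simp
  rw [← h, integral_map (by fun_prop) (by fun_prop)]
  simp_rw [abs_mul, abs_of_nonneg (Real.sqrt_nonneg (v : ℝ))]
  rw [integral_const_mul, integral_abs_gaussianReal_std, mul_comm]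

theorem integral_sq_gaussianReal (v : ℝ≥0) : ∫ x, x ^ 2 ∂(gaussianReal 0 v) = v := by
  have := variance_of_integral_eq_zero (X := id) (μ := gaussianReal 0 v) (by fun_prop) (by simp)
  rw [variance_id_gaussianReal] at this
  simpa using this.symm

theorem expMeasure_Ioi {r x : ℝ} (hr : 0 < r) (hx : 0 ≤ x) :
    expMeasure r (Ioi x) = ENNReal.ofReal (Real.exp (-(r * x))) := by
  have := isProbabilityMeasure_expMeasure hr
  have h := cdf_expMeasure_eq hr x
  rw [if_pos hx, cdf_eq_real] at h
  rw [← compl_Iic, ← ofReal_measureReal, probReal_compl_eq_one_sub measurableSet_Iic, h]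
  simp

theorem measurable_rpow_const_real (p : ℝ) : Measurable fun x : ℝ => x ^ p := by fun_prop

/-- The square is x^(2D-1), and D > 0 is exactly what makes it integrable at the origin; the rest is
a gamma integral. -/
theorem memLp_two_rpow_expMeasure {r D : ℝ} (hr : 0 < r) (hD : 0 < D) :
    MemLp (fun x : ℝ => x ^ (D - 1 / 2)) 2 (expMeasure r) := by
  rw [memLp_two_iff_integrable_sq (by fun_prop)]
  have hm : expMeasure r = volume.withDensity (gammaPDF 1 r) := rfl
  rw [hm, integrable_withDensity_iff (by unfold gammaPDF; fun_prop)
    (ae_of_all _ fun x => by simp [gammaPDF])]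
  have h0 : IntegrableOn (fun x : ℝ => r * (x ^ (2 * D - 1) * Real.exp (-r * x ^ (1 : ℝ)))) (Ioi 0) :=
    (integrableOn_rpow_mul_exp_neg_mul_rpow (by linarith) one_pos hr).const_mul r
  rw [← integrable_indicator_iff measurableSet_Ioi] at h0
  refine h0.congr ?_
  have hne : ∀ᵐ x : ℝ ∂volume, x ≠ 0 := by
    rw [ae_iff]; simp
  filter_upwards [hne] with x hx
  rcases lt_or_gt_of_ne hx with h | h
  · rw [indicator_of_notMem (by simp [h.le])]
    simp [gammaPDF, gammaPDFReal, not_le.2 h]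
  · rw [indicator_of_mem (by simpa using h)]
    have : (x ^ (D - 1 / 2)) ^ 2 = x ^ (2 * D - 1) := by
      rw [← Real.rpow_natCast, ← Real.rpow_mul h.le]; congr 1; push_cast; ring
    rw [this, gammaPDF, gammaPDFReal, if_pos h.le, ENNReal.toReal_ofReal]
    · simp; ring
    · simp only [sub_self, Real.rpow_zero, Real.Gamma_one, Real.rpow_one]; positivity

/-- Probability measures on the plane with equal tails on the closed first quadrant agree as soon
as the tail at the origin is full. -/
theorem measure_prod_ext_of_tails {κ κ' : Measure (ℝ × ℝ)} [IsProbabilityMeasure κ]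
    [IsProbabilityMeasure κ'] (h0 : κ (Ioi 0 ×ˢ Ioi 0) = 1)
    (h : ∀ x y : ℝ, 0 ≤ x → 0 ≤ y → κ (Ioi x ×ˢ Ioi y) = κ' (Ioi x ×ˢ Ioi y)) : κ = κ' := by
  -- Full mass on the open quadrant lets any corner be moved to its positive part, so tails at
  -- nonnegative corners determine those on the whole π-system.
  have key : ∀ (η : Measure (ℝ × ℝ)) [IsProbabilityMeasure η], η (Ioi 0 ×ˢ Ioi 0) = 1 →
      ∀ x y : ℝ, η (Ioi x ×ˢ Ioi y) = η (Ioi (max x 0) ×ˢ Ioi (max y 0)) := by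
    intro η _ hη x y
    have hm : MeasurableSet (Ioi (0 : ℝ) ×ˢ Ioi (0 : ℝ)) := measurableSet_Ioi.prod measurableSet_Ioi
    have : η (Ioi 0 ×ˢ Ioi 0)ᶜ = 0 := by rw [prob_compl_eq_zero_iff hm]; exact hη
    refine (measure_congr ?_)
    filter_upwards [compl_mem_ae_iff.2 this] with p hp
    simp only [compl_compl, mem_prod, mem_Ioi] at hp
    apply propext
    change (p ∈ Ioi x ×ˢ Ioi y) ↔ (p ∈ Ioi (max x 0) ×ˢ Ioi (max y 0))
    simp at hp ⊢
    tauto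
  have h0' : κ' (Ioi 0 ×ˢ Ioi 0) = 1 := by rw [← h 0 0 le_rfl le_rfl, h0]
  have hsp : IsCountablySpanning (range (Ioi : ℝ → Set ℝ)) := by
    refine ⟨fun n : ℕ => Ioi (-(n : ℝ)), fun n => ⟨_, rfl⟩, ?_⟩
    ext x
    simp only [mem_iUnion, mem_Ioi, mem_univ, iff_true]
    obtain ⟨n, hn⟩ := exists_nat_gt (-x)
    exact ⟨n, by linarith⟩
  have hg : MeasurableSpace.generateFrom (range (Ioi : ℝ → Set ℝ)) = Real.measurableSpace := by
    rw [← borel_eq_generateFrom_Ioi ℝ]; exact (BorelSpace.measurable_eq).symm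
  refine ext_of_generate_finite _ (generateFrom_eq_prod hg hg hsp hsp).symm
    (isPiSystem_Ioi.prod isPiSystem_Ioi) ?_ (by simp)
  rintro _ ⟨_, ⟨x, rfl⟩, _, ⟨y, rfl⟩, rfl⟩
  change κ (Ioi x ×ˢ Ioi y) = κ' (Ioi x ×ˢ Ioi y)
  rw [key κ h0, key κ' h0', h _ _ (le_max_right _ _) (le_max_right _ _)]

/-- The diagonal embedding reduces this to the planar uniqueness result: the mass of a quadrant
becomes the tail at the larger coordinate. -/
theorem hasLaw_exp_of_tails {Ω : Type*} [MeasurableSpace Ω] {μ : Measure Ω}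
    [IsProbabilityMeasure μ] {G : Ω → ℝ} (hG : AEMeasurable G μ) {r : ℝ} (hr : 0 < r)
    (h : ∀ x : ℝ, 0 ≤ x → μ {ω | x < G ω} = ENNReal.ofReal (Real.exp (-(r * x)))) :
    HasLaw G (expMeasure r) μ := by
  have := isProbabilityMeasure_expMeasure hr
  have := Measure.isProbabilityMeasure_map hG (μ := μ)
  refine ⟨hG, ?_⟩
  have hd : Measurable fun x : ℝ => (x, x) := by fun_prop
  have e : ∀ (η : Measure ℝ) (x y : ℝ), (η.map fun x => (x, x)) (Ioi x ×ˢ Ioi y) = η (Ioi (max x y)) := by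
    intro η x y
    rw [Measure.map_apply hd (measurableSet_Ioi.prod measurableSet_Ioi)]
    congr 1; ext z; simp
  have hm : ∀ x, 0 ≤ x → (μ.map G) (Ioi x) = expMeasure r (Ioi x) := fun x hx => by
    rw [Measure.map_apply_of_aemeasurable hG measurableSet_Ioi, expMeasure_Ioi hr hx, ← h x hx]; rfl
  have := Measure.isProbabilityMeasure_map hd.aemeasurable (μ := μ.map G)
  have := Measure.isProbabilityMeasure_map hd.aemeasurable (μ := expMeasure r)
  have key : (μ.map G).map (fun x => (x, x)) = (expMeasure r).map (fun x => (x, x)) := by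
    refine measure_prod_ext_of_tails ?_ fun x y hx hy => ?_
    · rw [e, hm _ (by simp), expMeasure_Ioi hr (by simp)]; simp
    · rw [e, e, hm _ (le_max_of_le_left hx)]
  have := congrArg (fun η => η.map Prod.fst) key
  simpa [Measure.map_map measurable_fst hd, Function.comp_def] using this

theorem hasLaw_exp_pos {Ω : Type*} [MeasurableSpace Ω] {μ : Measure Ω} {G : Ω → ℝ} {r : ℝ}
    (hr : 0 < r) (hG : HasLaw G (expMeasure r) μ) : ∀ᵐ ω ∂μ, 0 < G ω := by
  have := isProbabilityMeasure_expMeasure hr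
  rw [hG.ae_iff (p := fun x => 0 < x) (measurableSet_Ioi (a := (0 : ℝ))).mem, ae_iff]
  have h := expMeasure_Ioi hr le_rfl
  rw [show {a : ℝ | ¬ 0 < a} = (Ioi 0)ᶜ by ext; simp, prob_compl_eq_zero_iff measurableSet_Ioi, h]
  simp

/-! ### Pathwise study of labels, ages and the clock. -/

section Labelling

variable {τ : ℤ → ℝ} {T : Set ℝ}

/-- The points in (0, u] are τ₁, …, τ_m, because τ₀ < 0 < τ₁ and only finitely many fall there. The
case `k = 0` holds because τ₀ < 0 ≤ u. -/
theorem le_jumpCount_iff (hτ : IsLabelling τ T) (hf : ∀ u, (T ∩ Ioc 0 u).Finite) {u : ℝ}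
    (hu : 0 ≤ u) (k : ℕ) : k ≤ jumpCount τ u ↔ τ k ≤ u := by
  have hset : ∃ m : ℕ, ∀ k : ℤ, (1 ≤ k ∧ τ k ≤ u) ↔ (1 ≤ k ∧ k ≤ m) := by
    have hfin : {k : ℤ | 1 ≤ k ∧ τ k ≤ u}.Finite := by
      refine Set.Finite.of_finite_image ((hf u).subset ?_) hτ.strictMono.injective.injOn (f := τ)
      rintro _ ⟨k, ⟨hk, hku⟩, rfl⟩
      exact ⟨hτ.range_eq ▸ mem_range_self k,
        hτ.pos.trans_le (hτ.strictMono.monotone hk), hku⟩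
    rcases Set.eq_empty_or_nonempty {k : ℤ | 1 ≤ k ∧ τ k ≤ u} with he | hne
    · refine ⟨0, fun k => ⟨fun h => ?_, fun h => ?_⟩⟩
      · have : k ∈ {k : ℤ | 1 ≤ k ∧ τ k ≤ u} := h
        simp [he] at this
      · obtain ⟨h1, h2⟩ := h
        norm_num at h2
        omega
    · obtain ⟨m, hm, hmax⟩ := hfin.exists_maximal hne
      have hm' : 1 ≤ m ∧ τ m ≤ u := hm
      refine ⟨m.toNat, fun k => ⟨fun h => ⟨h.1, ?_⟩, fun h => ⟨h.1, ?_⟩⟩⟩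
      · rw [Int.toNat_of_nonneg (by omega)]
        by_contra hlt
        exact hlt (hmax h (by omega))
      · rw [Int.toNat_of_nonneg (by omega)] at h
        exact (hτ.strictMono.monotone h.2).trans hm'.2
  obtain ⟨m, hm⟩ := hset
  have hcount : jumpCount τ u = m := by
    have : range τ ∩ Ioc 0 u = τ '' (Finset.Icc (1 : ℤ) m : Set ℤ) := by
      ext x
      constructor
      · rintro ⟨⟨k, rfl⟩, h0, h1⟩
        have hk : 1 ≤ k := by
          by_contra hlt
          have : τ k ≤ τ 0 := hτ.strictMono.monotone (by omega)
          linarith [hτ.neg]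
        exact ⟨k, by simpa using (hm k).1 ⟨hk, h1⟩, rfl⟩
      · rintro ⟨k, hk, rfl⟩
        have hk' := (hm k).2 (by simpa using hk)
        exact ⟨mem_range_self k, hτ.pos.trans_le (hτ.strictMono.monotone hk'.1), hk'.2⟩
    rw [jumpCount, this, ncard_image_of_injective _ hτ.strictMono.injective, ncard_coe_finset]
    simp
  rw [hcount]
  rcases Nat.eq_zero_or_pos k with rfl | hk
  · simpa using (hτ.neg.le.trans hu)
  · have := hm k
    constructor
    · intro h; exact (this.2 ⟨by omega, by omega⟩).2
    · intro h; have := (this.1 ⟨by omega, h⟩).2; omega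

/-- The time elapsed at `u` since the last point. -/
noncomputable def age (τ : ℤ → ℝ) (u : ℝ) : ℝ := u - τ (jumpCount τ u)

theorem label_jumpCount_le (hτ : IsLabelling τ T) (hf : ∀ u, (T ∩ Ioc 0 u).Finite) {u : ℝ}
    (hu : 0 ≤ u) : τ (jumpCount τ u) ≤ u := (le_jumpCount_iff hτ hf hu _).1 le_rfl

theorem lt_label_jumpCount_succ (hτ : IsLabelling τ T) (hf : ∀ u, (T ∩ Ioc 0 u).Finite) {u : ℝ}
    (hu : 0 ≤ u) : u < τ (jumpCount τ u + 1) := by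
  have := (le_jumpCount_iff hτ hf hu (jumpCount τ u + 1)).not.1 (by omega)
  push_cast at this
  exact not_le.1 this

/-- This converts ages into void events, from which all laws of ages are computed. -/
theorem lt_age_iff (hτ : IsLabelling τ T) (hf : ∀ u, (T ∩ Ioc 0 u).Finite) {u y : ℝ}
    (hu : 0 ≤ u) : y < age τ u ↔ T ∩ Icc (u - y) u = ∅ := by
  have h1 := label_jumpCount_le hτ hf hu
  have h2 := lt_label_jumpCount_succ hτ hf hu
  constructor
  · intro h
    rw [age] at h
    rw [Set.eq_empty_iff_forall_notMem]
    rintro x ⟨hx, hx1, hx2⟩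
    rw [← hτ.range_eq] at hx
    obtain ⟨n, rfl⟩ := hx
    rcases le_or_gt n (jumpCount τ u) with hn | hn
    · have := hτ.strictMono.monotone hn
      linarith
    · have := hτ.strictMono.monotone (show (jumpCount τ u : ℤ) + 1 ≤ n by omega)
      linarith
  · intro h
    rw [age]
    by_contra hlt
    have : τ (jumpCount τ u) ∈ T ∩ Icc (u - y) u :=
      ⟨hτ.range_eq ▸ mem_range_self _, by linarith, h1⟩
    simp [h] at this

theorem jumpCount_zero (τ : ℤ → ℝ) : jumpCount τ 0 = 0 := by simp [jumpCount]

theorem timeChange_zero (D σ : ℝ) (τ : ℤ → ℝ) : timeChange D σ τ 0 = 0 := by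
  simp [timeChange, jumpCount_zero]

theorem jumpCount_add (hτ : IsLabelling τ T) (hf : ∀ u, (T ∩ Ioc 0 u).Finite) {t h : ℝ}
    (ht : 0 ≤ t) (hh : 0 ≤ h) :
    ((jumpCount τ (t + h) : ℕ) : ℕ∞) = jumpCount τ t + (T ∩ Ioc t (t + h)).encard := by
  have hd : Disjoint (T ∩ Ioc 0 t) (T ∩ Ioc t (t + h)) := by
    rw [Set.disjoint_left]
    rintro x ⟨_, hx⟩ ⟨_, hx'⟩
    exact absurd hx.2 (not_le.2 hx'.1)
  have hu : T ∩ Ioc 0 (t + h) = (T ∩ Ioc 0 t) ∪ (T ∩ Ioc t (t + h)) := by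
    rw [← inter_union_distrib_left, Ioc_union_Ioc_eq_Ioc ht (by linarith)]
  rw [jumpCount, jumpCount, hτ.range_eq, (hf _).cast_ncard_eq, (hf _).cast_ncard_eq, hu,
    encard_union_eq hd]

theorem timeChange_sub_of_empty (D σ : ℝ) (hτ : IsLabelling τ T)
    (hf : ∀ u, (T ∩ Ioc 0 u).Finite) {t h : ℝ} (ht : 0 ≤ t) (hh : 0 ≤ h)
    (he : T ∩ Ioc t (t + h) = ∅) :
    timeChange D σ τ (t + h) - timeChange D σ τ t
      = σ ^ 2 * ((age τ t + h) ^ (2 * D) - age τ t ^ (2 * D)) := by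
  have hj := jumpCount_add hτ hf ht hh
  rw [he] at hj
  have hj' : jumpCount τ (t + h) = jumpCount τ t := by
    simp only [encard_empty, add_zero] at hj
    exact_mod_cast hj
  rw [timeChange, timeChange, hj', age]
  rw [show t - τ (jumpCount τ t) + h = t + h - τ (jumpCount τ t) by ring]
  ring

/-- The initial term and the gaps completed before `s` cancel; the gaps are reindexed from the last
label before `s`. -/
theorem timeChange_sub_eq {D σ : ℝ} (τ : ℤ → ℝ) {s t : ℝ} {n : ℕ}
    (hn : jumpCount τ t = jumpCount τ s + n) :
    timeChange D σ τ t - timeChange D σ τ s = σ ^ 2 * ((t - τ (jumpCount τ t)) ^ (2 * D)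
      + ∑ k ∈ Finset.range n, (τ (jumpCount τ s + k + 1) - τ (jumpCount τ s + k)) ^ (2 * D)
      - (s - τ (jumpCount τ s)) ^ (2 * D)) := by
  have hsum : ∀ m : ℕ, ∑ k ∈ Finset.Icc 1 m, (τ (k : ℤ) - τ ((k : ℤ) - 1)) ^ (2 * D)
      = ∑ k ∈ Finset.range m, (τ ((k : ℤ) + 1) - τ (k : ℤ)) ^ (2 * D) := by
    intro m
    rw [← Finset.Ico_succ_right_eq_Icc, Finset.sum_Ico_eq_sum_range]
    simp only [Order.succ_eq_add_one, Nat.add_sub_cancel]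
    refine Finset.sum_congr rfl fun k _ => ?_
    push_cast
    congr 2
    · rw [add_comm]
    · congr 1; ring
  rw [timeChange, timeChange, hsum, hsum, hn, Finset.sum_range_add]
  push_cast
  ring

/-- The shocks cut (t, t+h] into n+1 pieces. As 2D ≤ 1, the power x^(2D) is subadditive, so each
piece adds at most h^(2D), including the one that continues a gap begun before `t`. Positivity comes
from strict monotonicity of the power. -/
theorem timeChange_sub_bounds {D σ : ℝ} (hD : 0 < D) (hD' : D ≤ 1 / 2) (hσ : 0 < σ)
    (hτ : IsLabelling τ T) (hf : ∀ u, (T ∩ Ioc 0 u).Finite) {t h : ℝ} (ht : 0 ≤ t)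
    (hh : 0 < h) {n : ℕ} (hn : (T ∩ Ioc t (t + h)).encard = n) :
    0 < timeChange D σ τ (t + h) - timeChange D σ τ t ∧
    timeChange D σ τ (t + h) - timeChange D σ τ t ≤ σ ^ 2 * ((n + 1) * h ^ (2 * D)) := by
  have hj := jumpCount_add hτ hf ht hh.le
  rw [hn] at hj
  have hj' : jumpCount τ (t + h) = jumpCount τ t + n := by exact_mod_cast hj
  have a1 := label_jumpCount_le hτ hf ht
  have a2 := lt_label_jumpCount_succ hτ hf ht
  have b1 := label_jumpCount_le hτ hf (show 0 ≤ t + h by linarith)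
  have b2 := lt_label_jumpCount_succ hτ hf (show 0 ≤ t + h by linarith)
  have hD0 : 0 < 2 * D := by linarith
  have hD1 : 2 * D ≤ 1 := by linarith
  have hσ2 : 0 < σ ^ 2 := by positivity
  rw [timeChange_sub_eq τ hj']
  rcases n with _ | n
  · rw [add_zero] at hj'
    rw [hj']
    simp only [Finset.range_zero, Finset.sum_empty, add_zero, Nat.cast_zero, zero_add, one_mul]
    constructor
    · refine mul_pos hσ2 (sub_pos.2 (Real.rpow_lt_rpow (by linarith) (by linarith) hD0))
    · refine mul_le_mul_of_nonneg_left ?_ hσ2.le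
      have := Real.rpow_add_le_add_rpow (sub_nonneg.2 a1) hh.le hD0.le hD1
      rw [show t + h - τ (jumpCount τ t) = t - τ (jumpCount τ t) + h by ring]
      linarith
  -- This splits off the gap containing `t`, the only completed gap that is not inside [t, t+h].
  · rw [Finset.sum_range_succ']
    simp only [Nat.cast_zero, add_zero]
    set i : ℤ := ((jumpCount τ t : ℕ) : ℤ) with hi
    have hjz : ((jumpCount τ (t + h) : ℕ) : ℤ) = i + n + 1 := by rw [hj']; push_cast; ring
    rw [hjz] at b1 b2 ⊢
    have hgap : ∀ k : ℕ, 0 < τ (i + (k + 1 : ℕ) + 1) - τ (i + (k + 1 : ℕ)) := fun k =>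
      sub_pos.2 (hτ.strictMono (by omega))
    have htop : τ (i + 1) ≤ t + h := (hτ.strictMono.monotone (by omega)).trans b1
    constructor
    · refine mul_pos hσ2 ?_
      have h1 : 0 ≤ (t + h - τ (i + n + 1)) ^ (2 * D) := Real.rpow_nonneg (by linarith) _
      have h2 : 0 ≤ ∑ k ∈ Finset.range n,
          (τ (i + (k + 1 : ℕ) + 1) - τ (i + (k + 1 : ℕ))) ^ (2 * D) :=
        Finset.sum_nonneg fun k _ => Real.rpow_nonneg (hgap k).le _
      have h3 : (t - τ i) ^ (2 * D) < (τ (i + 1) - τ i) ^ (2 * D) :=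
        Real.rpow_lt_rpow (by linarith) (by linarith) hD0
      linarith
    · refine mul_le_mul_of_nonneg_left ?_ hσ2.le
      have h0 : 0 ≤ h ^ (2 * D) := by positivity
      have hi1 := hτ.strictMono.monotone (show i + 1 ≤ i + n + 1 by omega)
      have h1 : (t + h - τ (i + n + 1)) ^ (2 * D) ≤ h ^ (2 * D) :=
        Real.rpow_le_rpow (by linarith) (by linarith) hD0.le
      have h2 : ∑ k ∈ Finset.range n, (τ (i + (k + 1 : ℕ) + 1) - τ (i + (k + 1 : ℕ))) ^ (2 * D)
          ≤ ∑ _k ∈ Finset.range n, h ^ (2 * D) := by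
        refine Finset.sum_le_sum fun k hk => Real.rpow_le_rpow (hgap k).le ?_ hD0.le
        have hk' := Finset.mem_range.1 hk
        have e1 := hτ.strictMono.monotone (show i + 1 ≤ i + (k + 1 : ℕ) by omega)
        have e2 := hτ.strictMono.monotone (show i + (k + 1 : ℕ) + 1 ≤ i + n + 1 by omega)
        linarith
      rw [Finset.sum_const, Finset.card_range, nsmul_eq_mul] at h2
      have h3 : (τ (i + 1) - τ i) ^ (2 * D) ≤ (t - τ i) ^ (2 * D) + h ^ (2 * D) := by
        have e := Real.rpow_add_le_add_rpow (sub_nonneg.2 a1) (sub_nonneg.2 a2.le) hD0.le hD1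
        rw [show t - τ i + (τ (i + 1) - t) = τ (i + 1) - τ i by ring] at e
        have := Real.rpow_le_rpow (sub_nonneg.2 a2.le)
          (show τ (i + 1) - t ≤ h by linarith) hD0.le
        linarith
      push_cast at h2 ⊢
      linarith

theorem timeChange_mono {D σ : ℝ} (hD : 0 < D) (hD' : D ≤ 1 / 2) (hσ : 0 < σ)
    (hτ : IsLabelling τ T) (hf : ∀ u, (T ∩ Ioc 0 u).Finite) {s t : ℝ} (hs : 0 ≤ s)
    (hst : s ≤ t) : timeChange D σ τ s ≤ timeChange D σ τ t := by
  rcases hst.eq_or_lt with rfl | hlt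
  · rfl
  · have hfin : (T ∩ Ioc s (s + (t - s))).Finite := (hf t).subset
      (inter_subset_inter_right _ (by
        rw [add_sub_cancel]; exact Ioc_subset_Ioc_left hs))
    have := (timeChange_sub_bounds hD hD' hσ hτ hf hs (sub_pos.2 hlt)
      (hfin.cast_ncard_eq).symm).1
    rw [add_sub_cancel] at this
    linarith

theorem timeChange_nonneg {D σ : ℝ} (hD : 0 < D) (hD' : D ≤ 1 / 2) (hσ : 0 < σ)
    (hτ : IsLabelling τ T) (hf : ∀ u, (T ∩ Ioc 0 u).Finite) {t : ℝ} (ht : 0 ≤ t) :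
    0 ≤ timeChange D σ τ t := by
  rw [← timeChange_zero D σ τ]
  exact timeChange_mono hD hD' hσ hτ hf le_rfl ht

end Labelling

/-! ### Counts and void probabilities of random point sets. -/

section Counts

variable {Ω : Type*} [MeasurableSpace Ω] {μ : Measure Ω} {T : Ω → Set ℝ}

/-- Finitely many distinct points are separated by a fine enough grid. Counts are thus obtained from
hit-or-miss events by countable operations. -/
theorem le_encard_iff_cells (S : Set ℝ) (m : ℕ) :
    (m : ℕ∞) ≤ S.encard ↔ ∃ n : ℕ, ∃ F : Finset ℤ, F.card = m ∧
      ∀ k ∈ F, (S ∩ {x | ⌊(n : ℝ) * x⌋ = k}).Nonempty := by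
  constructor
  · intro h
    obtain ⟨A, hAS, hA⟩ := Set.exists_subset_encard_eq h
    have hAf : A.Finite := Set.finite_of_encard_eq_coe hA
    have hev : ∀ᶠ n : ℕ in atTop, ∀ p ∈ A ×ˢ A, p.1 < p.2 →
        ⌊(n : ℝ) * p.1⌋ ≠ ⌊(n : ℝ) * p.2⌋ := by
      rw [Filter.eventually_all_finite (hAf.prod hAf)]
      rintro ⟨x, y⟩ _
      by_cases hxy : x < y
      · obtain ⟨N, hN⟩ := exists_nat_gt (1 / (y - x))
        filter_upwards [eventually_ge_atTop N] with n hn _ heq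
        have h1 : 1 < (n : ℝ) * (y - x) := by
          rw [div_lt_iff₀ (sub_pos.2 hxy)] at hN
          refine hN.trans_le (mul_le_mul_of_nonneg_right (by exact_mod_cast hn) (by linarith))
        have h2 := Int.abs_sub_lt_one_of_floor_eq_floor heq
        rw [abs_lt] at h2
        linarith
      · exact Eventually.of_forall fun n hlt => absurd hlt hxy
    obtain ⟨n, hn⟩ := hev.exists
    have hinj : InjOn (fun x : ℝ => ⌊(n : ℝ) * x⌋) A := by
      intro x hx y hy hxy
      by_contra hne
      rcases lt_or_gt_of_ne hne with hlt | hlt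
      · exact hn (x, y) ⟨hx, hy⟩ hlt hxy
      · exact hn (y, x) ⟨hy, hx⟩ hlt hxy.symm
    refine ⟨n, (hAf.image fun x : ℝ => ⌊(n : ℝ) * x⌋).toFinset, ?_, ?_⟩
    · rw [← Set.ncard_eq_toFinset_card _ (hAf.image _), hinj.ncard_image, Set.ncard, hA]
      simp
    · intro k hk
      simp only [Finite.mem_toFinset, mem_image] at hk
      obtain ⟨x, hx, rfl⟩ := hk
      exact ⟨x, hAS hx, rfl⟩
  · rintro ⟨n, F, rfl, hF⟩
    have hsub : (F : Set ℤ) ⊆ (fun x : ℝ => ⌊(n : ℝ) * x⌋) '' S := by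
      intro k hk
      obtain ⟨x, hx, hxk⟩ := hF k hk
      exact ⟨x, hx, hxk⟩
    calc (F.card : ℕ∞) = (F : Set ℤ).encard := (Set.encard_coe_eq_coe_finsetCard F).symm
      _ ≤ _ := encard_le_encard hsub
      _ ≤ _ := encard_image_le _ _

/-- The counts of a random set are measurable as soon as its void events are. -/
theorem measurable_encard_of_void
    (h : ∀ B : Set ℝ, MeasurableSet B → MeasurableSet {ω | T ω ∩ B = ∅}) {B : Set ℝ}
    (hB : MeasurableSet B) : Measurable fun ω => (T ω ∩ B).encard := by
  have hge : ∀ m : ℕ, MeasurableSet {ω | (m : ℕ∞) ≤ (T ω ∩ B).encard} := by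
    intro m
    simp_rw [le_encard_iff_cells]
    have : {ω | ∃ n : ℕ, ∃ F : Finset ℤ, F.card = m ∧
        ∀ k ∈ F, (T ω ∩ B ∩ {x | ⌊(n : ℝ) * x⌋ = k}).Nonempty}
        = ⋃ n : ℕ, ⋃ F : Finset ℤ, ⋃ _ : F.card = m, ⋂ k ∈ F,
          {ω | T ω ∩ (B ∩ {x | ⌊(n : ℝ) * x⌋ = k}) = ∅}ᶜ := by
      ext ω
      simp [Set.nonempty_iff_ne_empty, inter_assoc]
    rw [this]
    refine MeasurableSet.iUnion fun n => MeasurableSet.iUnion fun F => MeasurableSet.iUnion fun _ =>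
      Finset.measurableSet_biInter _ fun k _ => (h _ (hB.inter ?_)).compl
    have hm : Measurable fun x : ℝ => ⌊(n : ℝ) * x⌋ :=
      Int.measurable_floor.comp (measurable_const_mul _)
    exact hm (measurableSet_singleton k)
  have hfin : ∀ m : ℕ, MeasurableSet {ω | (T ω ∩ B).encard = (m : ℕ∞)} := by
    intro m
    have : {ω | (T ω ∩ B).encard = (m : ℕ∞)} = {ω | (m : ℕ∞) ≤ (T ω ∩ B).encard} \
        {ω | ((m + 1 : ℕ) : ℕ∞) ≤ (T ω ∩ B).encard} := by
      ext ω
      simp only [mem_ofPred_eq, Set.mem_sdiff, not_le]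
      constructor
      · intro e; rw [e]; exact ⟨le_rfl, by exact_mod_cast Nat.lt_succ_self m⟩
      · rintro ⟨h1, h2⟩
        refine le_antisymm ?_ h1
        push_cast at h2
        exact Order.lt_add_one_iff_of_not_isMax (by simp) |>.1 h2
    rw [this]
    exact (hge m).diff (hge (m + 1))
  refine measurable_to_countable' fun x => ?_
  induction x using ENat.recTopCoe with
  | coe m => exact hfin m
  | top =>
    have : (fun ω => (T ω ∩ B).encard) ⁻¹' {⊤} = ⋂ m : ℕ, {ω | (m : ℕ∞) ≤ (T ω ∩ B).encard} := by
      ext ω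
      simp only [mem_preimage, mem_singleton_iff, mem_iInter, mem_ofPred_eq]
      exact ⟨fun e m => by rw [e]; exact le_top, fun e => ENat.eq_top_iff_forall_ge.2 e⟩
    rw [this]
    exact MeasurableSet.iInter hge

variable {r : ℝ}

theorem IsPoissonPointProcess.void (hT : IsPoissonPointProcess T r μ) {B : Set ℝ}
    (hB : MeasurableSet B) (hB' : volume B ≠ ∞) :
    μ {ω | T ω ∩ B = ∅} = ENNReal.ofReal (Real.exp (-(r * (volume B).toReal))) := by
  have := hT.poisson_count B hB hB' 0
  simpa using this

theorem IsPoissonPointProcess.measurableSet_void (hT : IsPoissonPointProcess T r μ) {B : Set ℝ}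
    (hB : MeasurableSet B) : MeasurableSet {ω | T ω ∩ B = ∅} := by
  have := hT.measurable_count B hB (measurableSet_singleton 0)
  simpa [preimage] using this

theorem IsPoissonPointProcess.lintegral_encard [IsProbabilityMeasure μ]
    (hT : IsPoissonPointProcess T r μ) (hr : 0 ≤ r) {B : Set ℝ}
    (hB : MeasurableSet B) (hB' : volume B ≠ ∞) :
    ∫⁻ ω, ((T ω ∩ B).encard : ℝ≥0∞) ∂μ = ENNReal.ofReal r * volume B := by
  set v := (volume B).toReal with hv
  have hv0 : 0 ≤ r * v := by positivity
  have hm := hT.measurable_count B hB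
  have hms : ∀ k : ℕ, MeasurableSet {ω | (T ω ∩ B).encard = k} := fun k =>
    hm (measurableSet_singleton (k : ℕ∞))
  have hs0 : HasSum (fun k : ℕ => Real.exp (-(r * v)) * (r * v) ^ k / k.factorial) 1 := 
    hasSum_one_poissonMeasure ⟨r * v, hv0⟩
  -- The mean of the Poisson law: shifting the index by one absorbs the factor `k` into the
  -- factorial.
  have hs1 : HasSum (fun k : ℕ => k * (Real.exp (-(r * v)) * (r * v) ^ k / k.factorial)) (r * v) := by
    rw [← hasSum_nat_add_iff' 1]
    have h2 := hs0.mul_left (r * v)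
    rw [mul_one] at h2
    simp only [Finset.range_one, Finset.sum_singleton, Nat.cast_zero, zero_mul, sub_zero]
    refine h2.congr_fun fun k => ?_
    have : (k.factorial : ℝ) ≠ 0 := by positivity
    rw [Nat.factorial_succ, pow_succ]
    push_cast
    field_simp
  -- The Poisson weights sum to 1, so no mass is left for the value `⊤`.
  have hae : ∀ᵐ ω ∂μ, (T ω ∩ B).encard ≠ ⊤ := by
    have h1 : μ (⋃ k : ℕ, {ω | (T ω ∩ B).encard = k}) = 1 := by
      rw [measure_iUnion _ hms]
      · simp_rw [hT.poisson_count B hB hB']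
        rw [← ENNReal.ofReal_tsum_of_nonneg (fun k => by positivity) hs0.summable, hs0.tsum_eq]
        simp
      · intro i j hij
        rw [Function.onFun, Set.disjoint_left]
        intro ω h1 h2
        simp only [mem_ofPred_eq] at h1 h2
        rw [h1] at h2
        exact hij (by exact_mod_cast h2)
    have h2 := (prob_compl_eq_zero_iff (MeasurableSet.iUnion hms)).2 h1
    filter_upwards [compl_mem_ae_iff.2 h2] with ω hω
    simp only [compl_compl, mem_iUnion, mem_ofPred_eq] at hω
    obtain ⟨k, hk⟩ := hω
    simp [hk]
  have heq : ∀ᵐ ω ∂μ, ((T ω ∩ B).encard : ℝ≥0∞)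
      = ∑' k : ℕ, {ω | (T ω ∩ B).encard = k}.indicator (fun _ => (k : ℝ≥0∞)) ω := by
    filter_upwards [hae] with ω hω
    obtain ⟨m, hm⟩ := ENat.ne_top_iff_exists.1 hω
    rw [tsum_eq_single m]
    · simp [← hm]
    · intro k hk
      rw [indicator_of_notMem]
      simp only [mem_ofPred_eq, ← hm]
      intro h
      exact hk (by exact_mod_cast h.symm)
  rw [lintegral_congr_ae heq, lintegral_tsum fun k =>
    (measurable_const.indicator (hms k)).aemeasurable]
  simp_rw [lintegral_indicator_const (hms _), hT.poisson_count B hB hB']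
  have : ∀ k : ℕ, (k : ℝ≥0∞) * ENNReal.ofReal (Real.exp (-(r * v)) * (r * v) ^ k / k.factorial)
      = ENNReal.ofReal (k * (Real.exp (-(r * v)) * (r * v) ^ k / k.factorial)) := fun k => by
    rw [ENNReal.ofReal_mul (by positivity), ENNReal.ofReal_natCast]
  simp_rw [← hv, this]
  rw [← ENNReal.ofReal_tsum_of_nonneg (fun k => by positivity) hs1.summable, hs1.tsum_eq,
    ENNReal.ofReal_mul hr, hv, ENNReal.ofReal_toReal hB']

/-- What is used of a random set of points of rate `r` and of its labelling. -/
structure IsShockProcess (T : Ω → Set ℝ) (τ : ℤ → Ω → ℝ) (r : ℝ) (μ : Measure Ω) : Prop where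
  measurable_count : ∀ B : Set ℝ, MeasurableSet B → Measurable fun ω => (T ω ∩ B).encard
  lintegral_count_le : ∀ B : Set ℝ, MeasurableSet B → volume B ≠ ∞ →
    ∫⁻ ω, ((T ω ∩ B).encard : ℝ≥0∞) ∂μ ≤ ENNReal.ofReal r * volume B
  void : ∀ B : Set ℝ, MeasurableSet B → volume B ≠ ∞ →
    μ {ω | T ω ∩ B = ∅} = ENNReal.ofReal (Real.exp (-(r * (volume B).toReal)))
  labelling : ∀ᵐ ω ∂μ, IsLabelling (fun n => τ n ω) (T ω)

/-- A labelling alone would allow the points to accumulate at a finite time; finite mean counts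
exclude this. -/
theorem IsShockProcess.ae_finite {τ : ℤ → Ω → ℝ} (hT : IsShockProcess T τ r μ) :
    ∀ᵐ ω ∂μ, ∀ u, (T ω ∩ Ioc 0 u).Finite := by
  have h : ∀ n : ℕ, ∀ᵐ ω ∂μ, (T ω ∩ Ioc (0 : ℝ) n).Finite := by
    intro n
    have hle := hT.lintegral_count_le (Ioc (0 : ℝ) n) measurableSet_Ioc (by simp)
    have hlt : ∫⁻ ω, ((T ω ∩ Ioc (0 : ℝ) n).encard : ℝ≥0∞) ∂μ ≠ ∞ :=
      (hle.trans_lt (ENNReal.mul_lt_top (by simp) (by simp))).ne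
    have hm : Measurable fun ω => ((T ω ∩ Ioc (0 : ℝ) n).encard : ℝ≥0∞) :=
      (measurable_of_countable _).comp (hT.measurable_count _ measurableSet_Ioc)
    filter_upwards [ae_lt_top hm hlt] with ω hω
    rw [← Set.encard_lt_top_iff]
    exact_mod_cast hω
  filter_upwards [ae_all_iff.2 h] with ω hω u
  obtain ⟨n, hn⟩ := exists_nat_ge u
  exact (hω n).subset (inter_subset_inter_right _ (Ioc_subset_Ioc_right hn))

theorem union_void_measurable {T₁ T₂ : Ω → Set ℝ} {r₁ r₂ : ℝ}
    (h₁ : IsPoissonPointProcess T₁ r₁ μ) (h₂ : IsPoissonPointProcess T₂ r₂ μ) {B : Set ℝ}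
    (hB : MeasurableSet B) : MeasurableSet {ω | (T₁ ω ∪ T₂ ω) ∩ B = ∅} := by
  have : {ω | (T₁ ω ∪ T₂ ω) ∩ B = ∅} = {ω | T₁ ω ∩ B = ∅} ∩ {ω | T₂ ω ∩ B = ∅} := by
    ext ω; simp [union_inter_distrib_right]
  rw [this]
  exact (h₁.measurableSet_void hB).inter (h₂.measurableSet_void hB)

/-- The event says that `T₁` misses `A ∪ B`, `T₂` misses `A` and `T₃` misses `B`, three independent
void events. -/
theorem union_void_pair {T₁ T₂ T₃ : Ω → Set ℝ} {l₁ l₂ l₃ : ℝ}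
    (h₁ : IsPoissonPointProcess T₁ l₁ μ) (h₂ : IsPoissonPointProcess T₂ l₂ μ)
    (h₃ : IsPoissonPointProcess T₃ l₃ μ)
    (hT : iIndepFun ![pointCounts T₁, pointCounts T₂, pointCounts T₃] μ) {A B : Set ℝ}
    (hA : MeasurableSet A) (hA' : volume A ≠ ∞) (hB : MeasurableSet B) (hB' : volume B ≠ ∞) :
    μ {ω | (T₁ ω ∪ T₂ ω) ∩ A = ∅ ∧ (T₁ ω ∪ T₃ ω) ∩ B = ∅} = ENNReal.ofReal (Real.exp
      (-(l₁ * (volume (A ∪ B)).toReal + l₂ * (volume A).toReal + l₃ * (volume B).toReal))) := by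
  have hAB := hA.union hB
  have hAB' : volume (A ∪ B) ≠ ∞ := (measure_union_lt_top hA'.lt_top hB'.lt_top).ne
  let s : (C : Set ℝ) → MeasurableSet C → Set ({B : Set ℝ // MeasurableSet B} → ℕ∞) :=
    fun C hC => {c | c ⟨C, hC⟩ = 0}
  have hs : ∀ C hC, MeasurableSet (s C hC) := fun C hC =>
    (measurable_pi_apply (⟨C, hC⟩ : {B : Set ℝ // MeasurableSet B})) (measurableSet_singleton 0)
  have key := hT.measure_inter_preimage_eq_mul Finset.univ
    (sets := ![s (A ∪ B) hAB, s A hA, s B hB]) (by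
      intro i _
      fin_cases i
      · exact hs _ _
      · exact hs _ _
      · exact hs _ _)
  have hpre : ∀ (T : Ω → Set ℝ) C hC, pointCounts T ⁻¹' (s C hC) = {ω | T ω ∩ C = ∅} := by
    intro T C hC
    ext ω
    simp [s, pointCounts]
  rw [Fin.prod_univ_three] at key
  simp only [Matrix.cons_val_zero, Matrix.cons_val_one, Matrix.cons_val_two, Matrix.head_cons,
    Matrix.tail_cons, hpre] at key
  rw [h₁.void hAB hAB', h₂.void hA hA', h₃.void hB hB',
    ← ENNReal.ofReal_mul (Real.exp_nonneg _), ← ENNReal.ofReal_mul (by positivity),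
    ← Real.exp_add, ← Real.exp_add] at key
  convert key using 2
  · ext ω
    simp only [mem_ofPred_eq, mem_iInter, Finset.mem_univ, true_imp_iff, Fin.forall_fin_succ,
      Matrix.cons_val_zero, Fin.succ_zero_eq_one, Matrix.cons_val_one]
    simp [hpre, s, union_inter_distrib_right, inter_union_distrib_left]
    tauto
  · congr 1; ring

/-- Common points would be counted twice by the sum of the counts, but an upper bound on the mean
count suffices. Hence no superposition theorem is needed. -/
theorem isShockProcess_union [IsProbabilityMeasure μ] {T₁ T₂ : Ω → Set ℝ} {l₁ l₂ : ℝ} (hl₁ : 0 ≤ l₁)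
    (hl₂ : 0 ≤ l₂) (h₁ : IsPoissonPointProcess T₁ l₁ μ) (h₂ : IsPoissonPointProcess T₂ l₂ μ)
    (hv : ∀ B : Set ℝ, MeasurableSet B → volume B ≠ ∞ →
      μ {ω | (T₁ ω ∪ T₂ ω) ∩ B = ∅} = ENNReal.ofReal (Real.exp (-((l₁ + l₂) * (volume B).toReal))))
    {τ : ℤ → Ω → ℝ} (hτ : ∀ᵐ ω ∂μ, IsLabelling (fun n => τ n ω) (T₁ ω ∪ T₂ ω)) :
    IsShockProcess (fun ω => T₁ ω ∪ T₂ ω) τ (l₁ + l₂) μ where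
  measurable_count B hB := measurable_encard_of_void (fun _ => union_void_measurable h₁ h₂) hB
  lintegral_count_le B hB hB' := by
    rw [ENNReal.ofReal_add hl₁ hl₂, add_mul, ← h₁.lintegral_encard hl₁ hB hB',
      ← h₂.lintegral_encard hl₂ hB hB', ← lintegral_add_left
        (show Measurable fun ω => ((T₁ ω ∩ B).encard : ℝ≥0∞) from
          (measurable_of_countable _).comp (h₁.measurable_count B hB))]
    refine lintegral_mono fun ω => ?_
    rw [union_inter_distrib_right]
    rw [← ENat.toENNReal_add]
    exact ENat.toENNReal_le.2 (encard_union_le _ _)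
  void := hv
  labelling := hτ

theorem measurable_pointCounts (h : ∀ B : Set ℝ, MeasurableSet B →
    Measurable fun ω => (T ω ∩ B).encard) : Measurable (pointCounts T) :=
  measurable_pi_iff.2 fun B => h B.1 B.2

end Counts

/-! ### Labels, ages and the clock as measurable functions of the counts. -/

section Clock

/-- The space of families of counts. -/
abbrev CountSpace : Type := {B : Set ℝ // MeasurableSet B} → ℕ∞

/-- The number of points in `(0, u]`, read off the counts. -/
noncomputable def countIoc (u : ℝ) (c : CountSpace) : ℕ := (c ⟨Ioc 0 u, measurableSet_Ioc⟩).toNat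

open Classical in
/-- The infimum of the nonnegative rationals with a given property. -/
noncomputable def ratInf (P : ℚ → Prop) : ℝ :=
  (⨅ q : ℚ, if 0 ≤ q ∧ P q then ENNReal.ofReal q else ∞).toReal

open Classical in
theorem ratInf_eq {P : ℚ → Prop} {x : ℝ} (hx : 0 ≤ x) (h : ∀ q : ℚ, 0 ≤ q → (P q ↔ x ≤ q)) :
    ratInf P = x := by
  have : (⨅ q : ℚ, if 0 ≤ q ∧ P q then ENNReal.ofReal q else ∞) = ENNReal.ofReal x := by
    refine le_antisymm (le_of_forall_gt fun y hy => ?_) (le_iInf fun q => ?_)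
    · obtain ⟨z, hz0, hxz, hzy⟩ := ENNReal.lt_iff_exists_real_btwn.1 hy
      have hxz' : x < z := (ENNReal.ofReal_lt_ofReal_iff_of_nonneg hx).1 hxz
      obtain ⟨q, hq1, hq2⟩ := exists_rat_btwn hxz'
      have hq0 : 0 ≤ q := by exact_mod_cast hx.trans hq1.le
      refine (iInf_le _ q).trans_lt ?_
      rw [if_pos ⟨hq0, (h q hq0).2 hq1.le⟩]
      exact (ENNReal.ofReal_le_ofReal hq2.le).trans_lt hzy
    · split_ifs with hq
      · exact ENNReal.ofReal_le_ofReal ((h q hq.1).1 hq.2)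
      · exact le_top
  rw [ratInf, ← ENNReal.toReal_ofReal hx, ← this]

theorem measurable_ratInf {α : Type*} [MeasurableSpace α] {P : α → ℚ → Prop}
    (h : ∀ q, MeasurableSet {a | P a q}) : Measurable fun a => ratInf (P a) := by
  refine (Measurable.iInf fun q => ?_).ennreal_toReal
  refine Measurable.ite ?_ measurable_const measurable_const
  by_cases hq : 0 ≤ q
  · simpa [hq] using h q
  · simp [hq]

/-- The `k`-th point, `k ≥ 0`, read off the counts. -/
noncomputable def labelOf : ℕ → CountSpace → ℝ
  | 0, c => -ratInf fun q => c ⟨Icc (0 - (q : ℝ)) 0, measurableSet_Icc⟩ ≠ 0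
  | k + 1, c => ratInf fun q => k + 1 ≤ countIoc q c

/-- The time elapsed at `u` since the last point, read off the counts. -/
noncomputable def ageOf (u : ℝ) (c : CountSpace) : ℝ := u - labelOf (countIoc u c) c

/-- The time change, read off the counts. -/
noncomputable def clockOf (D σ t : ℝ) (c : CountSpace) : ℝ :=
  σ ^ 2 * ((t - labelOf (countIoc t c) c) ^ (2 * D)
    + ∑ k ∈ Finset.Icc 1 (countIoc t c), (labelOf k c - labelOf (k - 1) c) ^ (2 * D)
    - (-labelOf 0 c) ^ (2 * D))

theorem measurable_countIoc (u : ℝ) : Measurable (countIoc u) :=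
  (measurable_of_countable _).comp (measurable_pi_apply _)

theorem measurable_labelOf (k : ℕ) : Measurable (labelOf k) := by
  cases k with
  | zero =>
    refine Measurable.neg (measurable_ratInf fun q => ?_)
    have hm : Measurable fun c : CountSpace => c ⟨Icc (0 - (q : ℝ)) 0, measurableSet_Icc⟩ :=
      measurable_pi_apply _
    exact hm (measurableSet_singleton (0 : ℕ∞)).compl
  | succ k =>
    exact measurable_ratInf fun q => measurable_countIoc q (measurableSet_Ici (a := k + 1))

theorem measurable_comp_nat {α β : Type*} [MeasurableSpace α] [MeasurableSpace β] {n : α → ℕ}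
    (hn : Measurable n) {f : ℕ → α → β} (hf : ∀ k, Measurable (f k)) :
    Measurable fun a => f (n a) a :=
  (measurable_from_prod_countable_right (f := fun p : ℕ × α => f p.1 p.2) hf).comp
    (hn.prodMk measurable_id)

theorem measurable_ageOf (u : ℝ) : Measurable (ageOf u) :=
  measurable_const.sub (measurable_comp_nat (measurable_countIoc u) measurable_labelOf)

theorem measurable_clockOf (D σ t : ℝ) : Measurable (clockOf D σ t) := by
  refine measurable_comp_nat (f := fun n c => σ ^ 2 * ((t - labelOf n c) ^ (2 * D)
    + ∑ k ∈ Finset.Icc 1 n, (labelOf k c - labelOf (k - 1) c) ^ (2 * D)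
    - (-labelOf 0 c) ^ (2 * D))) (measurable_countIoc t) fun n => ?_
  have := measurable_labelOf
  fun_prop

variable {Ω : Type*} {T : Ω → Set ℝ} {τ : ℤ → Ω → ℝ} {ω : Ω}

theorem countIoc_pointCounts (hτ : IsLabelling (fun n => τ n ω) (T ω)) (u : ℝ) :
    countIoc u (pointCounts T ω) = jumpCount (fun n => τ n ω) u := by
  rw [countIoc, jumpCount, hτ.range_eq]; rfl

/-- The label 0 is minus the age at time 0, so `lt_age_iff` recovers it from the intervals [-q, 0]
that are hit; the positive labels come from `le_jumpCount_iff`. -/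
theorem labelOf_pointCounts (hτ : IsLabelling (fun n => τ n ω) (T ω))
    (hf : ∀ u, (T ω ∩ Ioc 0 u).Finite) (k : ℕ) : labelOf k (pointCounts T ω) = τ k ω := by
  cases k with
  | zero =>
    rw [labelOf, neg_eq_iff_eq_neg]
    refine ratInf_eq (neg_nonneg.2 hτ.neg.le) fun q hq => ?_
    have := lt_age_iff hτ hf le_rfl (y := q)
    simp only [age, jumpCount_zero] at this
    simp only [Nat.cast_zero, zero_sub] at this ⊢
    rw [← not_lt, this, pointCounts]
    simp
  | succ k =>
    rw [labelOf]
    have h0 : (0 : ℝ) ≤ τ ((k + 1 : ℕ) : ℤ) ω :=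
      hτ.pos.le.trans (hτ.strictMono.monotone (show (1 : ℤ) ≤ ((k + 1 : ℕ) : ℤ) by omega))
    refine ratInf_eq h0 fun q hq => ?_
    rw [countIoc_pointCounts hτ]
    exact le_jumpCount_iff hτ hf (by exact_mod_cast hq) (k + 1)

theorem ageOf_pointCounts (hτ : IsLabelling (fun n => τ n ω) (T ω))
    (hf : ∀ u, (T ω ∩ Ioc 0 u).Finite) (u : ℝ) :
    ageOf u (pointCounts T ω) = age (fun n => τ n ω) u := by
  rw [ageOf, age, labelOf_pointCounts hτ hf, countIoc_pointCounts hτ]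

theorem clockOf_pointCounts (D σ : ℝ) (hτ : IsLabelling (fun n => τ n ω) (T ω))
    (hf : ∀ u, (T ω ∩ Ioc 0 u).Finite) (t : ℝ) :
    clockOf D σ t (pointCounts T ω) = timeChange D σ (fun n => τ n ω) t := by
  rw [clockOf, timeChange]
  simp only [labelOf_pointCounts hτ hf, countIoc_pointCounts hτ, Nat.cast_zero]
  congr 3
  refine Finset.sum_congr rfl fun k hk => ?_
  rw [Nat.cast_sub (Finset.mem_Icc.1 hk).1]
  simp

end Clock

/-! ### Conditioning on the clocks. -/

section Freezing

/-- A jointly measurable version of the evaluation of paths, correct on continuous paths. -/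
noncomputable def pathEval (p : (ℝ≥0 → ℝ) × ℝ≥0) : ℝ :=
  limsup (fun n : ℕ => p.1 ((⌊p.2 * (n : ℝ≥0)⌋₊ : ℝ≥0) / (n : ℝ≥0))) atTop

theorem measurable_pathEval : Measurable pathEval := by
  refine Measurable.limsup fun n => ?_
  exact measurable_comp_nat (n := fun p : (ℝ≥0 → ℝ) × ℝ≥0 => ⌊p.2 * (n : ℝ≥0)⌋₊)
    (f := fun k p => p.1 ((k : ℝ≥0) / (n : ℝ≥0)))
    (Nat.measurable_floor.comp (measurable_snd.mul_const _))
    (fun k => (measurable_pi_apply _).comp measurable_fst)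

/-- The times ⌊sn⌋/n tend to `s`, and they involve only countably many coordinates of the path,
which is why `pathEval` is jointly measurable. -/
theorem pathEval_eq {w : ℝ≥0 → ℝ} (hw : Continuous w) (s : ℝ≥0) : pathEval (w, s) = w s := by
  refine Filter.Tendsto.limsup_eq ?_
  refine (hw.tendsto s).comp ?_
  rw [← NNReal.tendsto_coe]
  have := (tendsto_nat_floor_mul_div_atTop (R := ℝ) (a := s) s.2).comp
    (tendsto_natCast_atTop_atTop (R := ℝ))
  refine this.congr fun n => ?_
  simp only [Function.comp, NNReal.coe_div, NNReal.coe_natCast]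
  congr 2

variable {Ω : Type*} [MeasurableSpace Ω] {μ : Measure Ω}

/-- Independence makes the joint law a product, so this is Tonelli with the second variable
outermost. -/
theorem lintegral_freeze [IsProbabilityMeasure μ] {α β : Type*} [MeasurableSpace α]
    [MeasurableSpace β] {A : Ω → α} {B : Ω → β} (hA : Measurable A) (hB : Measurable B)
    (h : IndepFun A B μ) {F : α × β → ℝ≥0∞} (hF : Measurable F) :
    ∫⁻ ω, F (A ω, B ω) ∂μ = ∫⁻ ω', ∫⁻ ω, F (A ω, B ω') ∂μ ∂μ := by
  have hm := (indepFun_iff_map_prod_eq_prod_map_map hA.aemeasurable hB.aemeasurable).1 h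
  have := Measure.isProbabilityMeasure_map hA.aemeasurable (μ := μ)
  have := Measure.isProbabilityMeasure_map hB.aemeasurable (μ := μ)
  rw [← lintegral_map hF (hA.prodMk hB), hm, lintegral_prod_symm' _ hF,
    lintegral_map hF.lintegral_prod_left' hB]
  refine lintegral_congr fun ω' => ?_
  rw [lintegral_map (f := fun a => F (a, B ω')) (hF.comp (by fun_prop)) hA]

/-- A process with continuous paths and the one-dimensional increments of a Brownian motion. -/
structure IsDriver (W : ℝ≥0 → Ω → ℝ) (μ : Measure Ω) : Prop where
  measurable : ∀ s, Measurable (W s)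
  cont : ∀ᵐ ω ∂μ, Continuous fun s => W s ω
  incr : ∀ r s : ℝ≥0, r ≤ s → HasLaw (fun ω => W s ω - W r ω) (gaussianReal 0 (s - r)) μ

theorem IsDriver.lintegral_abs {W : ℝ≥0 → Ω → ℝ} (hW : IsDriver W μ) {r s : ℝ≥0} (h : r ≤ s) :
    ∫⁻ ω, ENNReal.ofReal |W s ω - W r ω| ∂μ
      = ENNReal.ofReal (√(2 / Real.pi) * √((s : ℝ) - r)) := by
  rw [(hW.incr r s h).lintegral_comp (f := fun x => ENNReal.ofReal |x|) (by fun_prop),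
    ← ofReal_integral_eq_lintegral_ofReal, integral_abs_gaussianReal, NNReal.coe_sub h]
  · exact (memLp_id_gaussianReal 1).integrable (by simp) |>.abs
  · exact ae_of_all _ fun x => abs_nonneg x

theorem IsDriver.lintegral_sq {W : ℝ≥0 → Ω → ℝ} (hW : IsDriver W μ) {r s : ℝ≥0} (h : r ≤ s) :
    ∫⁻ ω, ENNReal.ofReal ((W s ω - W r ω) ^ 2) ∂μ = ENNReal.ofReal ((s : ℝ) - r) := by
  rw [(hW.incr r s h).lintegral_comp (f := fun x => ENNReal.ofReal (x ^ 2)) (by fun_prop),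
    ← ofReal_integral_eq_lintegral_ofReal, integral_sq_gaussianReal, NNReal.coe_sub h]
  · exact (memLp_id_gaussianReal 2).integrable_sq
  · exact ae_of_all _ fun x => sq_nonneg x

/-- Cauchy–Schwarz, needed where nothing is known about the dependence of the two increments. -/
theorem IsDriver.lintegral_mul_le {W₁ W₂ : ℝ≥0 → Ω → ℝ} (h₁ : IsDriver W₁ μ) (h₂ : IsDriver W₂ μ)
    {r₁ s₁ r₂ s₂ : ℝ≥0} (h : r₁ ≤ s₁) (h' : r₂ ≤ s₂) :
    ∫⁻ ω, ENNReal.ofReal (|W₁ s₁ ω - W₁ r₁ ω| * |W₂ s₂ ω - W₂ r₂ ω|) ∂μ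
      ≤ ENNReal.ofReal (√((s₁ : ℝ) - r₁) * √((s₂ : ℝ) - r₂)) := by
  have hm₁ := h₁.measurable
  have hm₂ := h₂.measurable
  have key := ENNReal.lintegral_mul_le_Lp_mul_Lq μ Real.HolderConjugate.two_two
    (f := fun ω => ENNReal.ofReal |W₁ s₁ ω - W₁ r₁ ω|)
    (g := fun ω => ENNReal.ofReal |W₂ s₂ ω - W₂ r₂ ω|) (by fun_prop) (by fun_prop)
  have e : ∀ x : ℝ, ENNReal.ofReal |x| ^ (2 : ℝ) = ENNReal.ofReal (x ^ 2) := fun x => by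
    rw [ENNReal.ofReal_rpow_of_nonneg (abs_nonneg x) (by norm_num)]
    simp
  simp only [e, Pi.mul_apply] at key
  rw [h₁.lintegral_sq h, h₂.lintegral_sq h',
    ENNReal.ofReal_rpow_of_nonneg (sub_nonneg.2 (by exact_mod_cast h)) (by norm_num),
    ENNReal.ofReal_rpow_of_nonneg (sub_nonneg.2 (by exact_mod_cast h')) (by norm_num),
    ← ENNReal.ofReal_mul (Real.rpow_nonneg (sub_nonneg.2 (by exact_mod_cast h)) _),
    ← Real.sqrt_eq_rpow, ← Real.sqrt_eq_rpow] at key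
  refine le_trans (le_of_eq (lintegral_congr fun ω => ?_)) key
  rw [ENNReal.ofReal_mul (abs_nonneg _)]

theorem IsDriver.lintegral_mul_of_indep {W₁ W₂ : ℝ≥0 → Ω → ℝ} (h₁ : IsDriver W₁ μ)
    (h₂ : IsDriver W₂ μ) {r₁ s₁ r₂ s₂ : ℝ≥0} (h : r₁ ≤ s₁) (h' : r₂ ≤ s₂)
    (hi : IndepFun (fun ω => W₁ s₁ ω - W₁ r₁ ω) (fun ω => W₂ s₂ ω - W₂ r₂ ω) μ) :
    ∫⁻ ω, ENNReal.ofReal (|W₁ s₁ ω - W₁ r₁ ω| * |W₂ s₂ ω - W₂ r₂ ω|) ∂μ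
      = ENNReal.ofReal (2 / Real.pi * (√((s₁ : ℝ) - r₁) * √((s₂ : ℝ) - r₂))) := by
  have hm₁ := h₁.measurable
  have hm₂ := h₂.measurable
  have hi' := hi.comp (φ := fun x => ENNReal.ofReal |x|) (ψ := fun x => ENNReal.ofReal |x|)
    (by fun_prop) (by fun_prop)
  have key := lintegral_mul_eq_lintegral_mul_lintegral_of_indepFun
    (show Measurable fun ω => ENNReal.ofReal |W₁ s₁ ω - W₁ r₁ ω| by fun_prop)
    (show Measurable fun ω => ENNReal.ofReal |W₂ s₂ ω - W₂ r₂ ω| by fun_prop) hi'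
  rw [h₁.lintegral_abs h, h₂.lintegral_abs h', ← ENNReal.ofReal_mul (by positivity)] at key
  simp_rw [ENNReal.ofReal_mul (abs_nonneg _)]
  refine key.trans ?_
  congr 1
  have := Real.mul_self_sqrt (show (0 : ℝ) ≤ 2 / Real.pi by positivity)
  linear_combination (√((s₁ : ℝ) - r₁) * √((s₂ : ℝ) - r₂)) * this

theorem IsDriver.aemeasurable_comp {W : ℝ≥0 → Ω → ℝ} (hW : IsDriver W μ) {S : Ω → ℝ≥0}
    (hS : AEMeasurable S μ) : AEMeasurable (fun ω => W (S ω) ω) μ := by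
  refine (measurable_pathEval.comp_aemeasurable
    ((measurable_pi_iff.2 hW.measurable).aemeasurable.prodMk hS)).congr ?_
  filter_upwards [hW.cont] with ω hω
  exact pathEval_eq hω _

section Pair

variable [IsProbabilityMeasure μ] {β : Type*} [MeasurableSpace β] {W₁ W₂ : ℝ≥0 → Ω → ℝ} {B : Ω → β}

theorem IsDriver.lintegral_freeze_pair (h₁ : IsDriver W₁ μ) (h₂ : IsDriver W₂ μ)
    (hB : Measurable B)
    (hi : IndepFun (fun ω => ((fun s => W₁ s ω), (fun s => W₂ s ω))) B μ)
    {R₁ S₁ R₂ S₂ : β → ℝ≥0} (hR₁ : Measurable R₁) (hS₁ : Measurable S₁) (hR₂ : Measurable R₂)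
    (hS₂ : Measurable S₂) {φ : ℝ × ℝ → ℝ≥0∞} (hφ : Measurable φ) :
    ∫⁻ ω, φ (W₁ (S₁ (B ω)) ω - W₁ (R₁ (B ω)) ω, W₂ (S₂ (B ω)) ω - W₂ (R₂ (B ω)) ω) ∂μ
      = ∫⁻ ω', ∫⁻ ω, φ (W₁ (S₁ (B ω')) ω - W₁ (R₁ (B ω')) ω,
          W₂ (S₂ (B ω')) ω - W₂ (R₂ (B ω')) ω) ∂μ ∂μ := by
  let F : ((ℝ≥0 → ℝ) × (ℝ≥0 → ℝ)) × β → ℝ≥0∞ := fun p =>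
    φ (pathEval (p.1.1, S₁ p.2) - pathEval (p.1.1, R₁ p.2),
      pathEval (p.1.2, S₂ p.2) - pathEval (p.1.2, R₂ p.2))
  have hF : Measurable F := by
    have hp := measurable_pathEval
    refine hφ.comp ?_
    refine Measurable.prodMk ?_ ?_ <;> refine Measurable.sub ?_ ?_ <;>
      exact measurable_pathEval.comp (by fun_prop)
  have hA : Measurable fun ω => ((fun s => W₁ s ω), (fun s => W₂ s ω)) :=
    (measurable_pi_iff.2 h₁.measurable).prodMk (measurable_pi_iff.2 h₂.measurable)
  have key := lintegral_freeze hA hB hi hF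
  -- The exceptional null set is the same for all `b`: off it the paths are continuous and
  -- `pathEval` is correct at every time.
  have hc : ∀ᵐ ω ∂μ, ∀ b, F (((fun s => W₁ s ω), (fun s => W₂ s ω)), b)
      = φ (W₁ (S₁ b) ω - W₁ (R₁ b) ω, W₂ (S₂ b) ω - W₂ (R₂ b) ω) := by
    filter_upwards [h₁.cont, h₂.cont] with ω hω₁ hω₂ b
    simp only [F, pathEval_eq hω₁, pathEval_eq hω₂]
  calc _ = ∫⁻ ω, F (((fun s => W₁ s ω), (fun s => W₂ s ω)), B ω) ∂μ :=
        lintegral_congr_ae (by filter_upwards [hc] with ω hω; exact (hω _).symm)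
    _ = _ := key
    _ = _ := lintegral_congr fun ω' => lintegral_congr_ae (by
        filter_upwards [hc] with ω hω; exact hω _)

/-- Cross moment of the absolute increments of two drivers over random intervals, up to the event
on which the increments may be dependent. -/
theorem IsDriver.integral_mul_abs_bound (h₁ : IsDriver W₁ μ) (h₂ : IsDriver W₂ μ)
    (hB : Measurable B)
    (hi : IndepFun (fun ω => ((fun s => W₁ s ω), (fun s => W₂ s ω))) B μ)
    {R₁ S₁ R₂ S₂ : β → ℝ≥0} (hR₁ : Measurable R₁) (hS₁ : Measurable S₁) (hR₂ : Measurable R₂)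
    (hS₂ : Measurable S₂) (hRS₁ : ∀ᵐ ω ∂μ, R₁ (B ω) ≤ S₁ (B ω))
    (hRS₂ : ∀ᵐ ω ∂μ, R₂ (B ω) ≤ S₂ (B ω)) {bad : Set Ω} (hbad : NullMeasurableSet bad μ)
    (hgood : ∀ᵐ ω' ∂μ, ω' ∉ bad →
      IndepFun (fun ω => W₁ (S₁ (B ω')) ω - W₁ (R₁ (B ω')) ω)
        (fun ω => W₂ (S₂ (B ω')) ω - W₂ (R₂ (B ω')) ω) μ)
    (hint : Integrable (fun ω => √((S₁ (B ω) : ℝ) - R₁ (B ω)) * √((S₂ (B ω) : ℝ) - R₂ (B ω))) μ) :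
    |∫ ω, |W₁ (S₁ (B ω)) ω - W₁ (R₁ (B ω)) ω| * |W₂ (S₂ (B ω)) ω - W₂ (R₂ (B ω)) ω| ∂μ
      - 2 / Real.pi * ∫ ω, √((S₁ (B ω) : ℝ) - R₁ (B ω)) * √((S₂ (B ω) : ℝ) - R₂ (B ω)) ∂μ|
    ≤ ∫ ω, bad.indicator (fun ω => √((S₁ (B ω) : ℝ) - R₁ (B ω)) * √((S₂ (B ω) : ℝ) - R₂ (B ω))) ω
        ∂μ := by
  set g : Ω → ℝ := fun ω => √((S₁ (B ω) : ℝ) - R₁ (B ω)) * √((S₂ (B ω) : ℝ) - R₂ (B ω)) with hg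
  have hg0 : ∀ ω, 0 ≤ g ω := fun ω => by positivity
  have hpi : 2 / Real.pi ≤ 1 := (div_le_one Real.pi_pos).2 (by linarith [Real.pi_gt_three])
  have hpi0 : 0 ≤ 2 / Real.pi := by positivity
  let Ψ : Ω → ℝ≥0∞ := fun ω' => ∫⁻ ω, ENNReal.ofReal (|W₁ (S₁ (B ω')) ω - W₁ (R₁ (B ω')) ω| *
    |W₂ (S₂ (B ω')) ω - W₂ (R₂ (B ω')) ω|) ∂μ
  have hfreeze := h₁.lintegral_freeze_pair h₂ hB hi hR₁ hS₁ hR₂ hS₂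
    (φ := fun p => ENNReal.ofReal (|p.1| * |p.2|)) (by fun_prop)
  have hΨle : ∀ᵐ ω ∂μ, Ψ ω ≤ ENNReal.ofReal (g ω) := by
    filter_upwards [hRS₁, hRS₂] with ω e₁ e₂
    exact h₁.lintegral_mul_le h₂ e₁ e₂
  -- On `bad` the lower bound is 0 and the upper one is Cauchy–Schwarz; off `bad`, independence
  -- makes both bounds equalities.
  have hΨge : ∀ᵐ ω ∂μ, ENNReal.ofReal (2 / Real.pi * (g ω - bad.indicator g ω)) ≤ Ψ ω ∧
      Ψ ω ≤ ENNReal.ofReal (2 / Real.pi * g ω + bad.indicator g ω) := by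
    filter_upwards [hRS₁, hRS₂, hgood, hΨle] with ω e₁ e₂ e₃ e₄
    by_cases hω : ω ∈ bad
    · rw [indicator_of_mem hω]
      refine ⟨by simp, e₄.trans (ENNReal.ofReal_le_ofReal ?_)⟩
      have := mul_nonneg hpi0 (hg0 ω)
      linarith
    · rw [indicator_of_notMem hω, sub_zero, add_zero]
      have := h₁.lintegral_mul_of_indep h₂ e₁ e₂ (e₃ hω)
      exact ⟨this.ge, this.le⟩
  have hbi : Integrable (bad.indicator g) μ := hint.indicator₀ hbad
  have hb0 : ∀ ω, 0 ≤ bad.indicator g ω := fun ω => indicator_nonneg (fun ω _ => hg0 ω) ω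
  have hbg : ∀ ω, bad.indicator g ω ≤ g ω := fun ω => indicator_le_self' (fun ω _ => hg0 ω) ω
  set M := ∫⁻ ω, Ψ ω ∂μ with hM
  have hup : M ≤ ENNReal.ofReal (2 / Real.pi * ∫ ω, g ω ∂μ + ∫ ω, bad.indicator g ω ∂μ) := by
    rw [← integral_const_mul, ← integral_add (hint.const_mul _) hbi,
      ofReal_integral_eq_lintegral_ofReal
        (show Integrable (fun ω => 2 / Real.pi * g ω + bad.indicator g ω) μ from
          (hint.const_mul _).add hbi)
        (ae_of_all _ fun ω => add_nonneg (mul_nonneg hpi0 (hg0 ω)) (hb0 ω))]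
    exact lintegral_mono_ae (hΨge.mono fun ω h => h.2)
  have hlo : ENNReal.ofReal (2 / Real.pi * (∫ ω, g ω ∂μ - ∫ ω, bad.indicator g ω ∂μ)) ≤ M := by
    rw [← integral_sub hint hbi, ← integral_const_mul,
      ofReal_integral_eq_lintegral_ofReal
        (show Integrable (fun ω => 2 / Real.pi * (g ω - bad.indicator g ω)) μ from
          (hint.sub hbi).const_mul _)
        (ae_of_all _ fun ω => mul_nonneg hpi0 (sub_nonneg.2 (hbg ω)))]
    exact lintegral_mono_ae (hΨge.mono fun ω h => h.1)
  have hMtop : M ≠ ∞ := (hup.trans_lt ENNReal.ofReal_lt_top).ne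
  have hI : ∫ ω, |W₁ (S₁ (B ω)) ω - W₁ (R₁ (B ω)) ω| * |W₂ (S₂ (B ω)) ω - W₂ (R₂ (B ω)) ω| ∂μ
      = M.toReal := by
    rw [integral_eq_lintegral_of_nonneg_ae (ae_of_all _ fun ω => by positivity)]
    · exact congrArg ENNReal.toReal hfreeze
    · have m := fun (W : ℝ≥0 → Ω → ℝ) (hW : IsDriver W μ) (S : β → ℝ≥0) (hS : Measurable S) =>
        hW.aemeasurable_comp (S := fun ω => S (B ω)) (hS.comp hB).aemeasurable
      exact ((continuous_abs.measurable.comp_aemeasurable ((m _ h₁ _ hS₁).sub (m _ h₁ _ hR₁))).mul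
        (continuous_abs.measurable.comp_aemeasurable
          ((m _ h₂ _ hS₂).sub (m _ h₂ _ hR₂)))).aestronglyMeasurable
  rw [hI, abs_le]
  have hgi0 : 0 ≤ ∫ ω, g ω ∂μ := integral_nonneg hg0
  have hbi0 : 0 ≤ ∫ ω, bad.indicator g ω ∂μ := integral_nonneg hb0
  have hup' := ENNReal.toReal_le_of_le_ofReal (by positivity) hup
  have hlo' := (ENNReal.ofReal_le_iff_le_toReal hMtop).1 hlo
  constructor
  · nlinarith
  · linarith

theorem IsDriver.lintegral_freeze_single {W : ℝ≥0 → Ω → ℝ} (hW : IsDriver W μ)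
    (hB : Measurable B) (hi : IndepFun (fun ω s => W s ω) B μ)
    {R S : β → ℝ≥0} (hR : Measurable R) (hS : Measurable S) {φ : ℝ → ℝ≥0∞} (hφ : Measurable φ) :
    ∫⁻ ω, φ (W (S (B ω)) ω - W (R (B ω)) ω) ∂μ
      = ∫⁻ ω', ∫⁻ ω, φ (W (S (B ω')) ω - W (R (B ω')) ω) ∂μ ∂μ :=
  hW.lintegral_freeze_pair hW hB
    (hi.comp (φ := fun w => (w, w)) (ψ := id) (by fun_prop) measurable_id) hR hS hR hS
    (φ := fun p => φ p.1) (hφ.comp measurable_fst)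

end Pair

end Freezing

/-! ### L² limits of renormalised clock increments. -/

section Asymptotics

/-- Concavity of the power (Bernoulli's inequality). It makes the limiting volatility a bound for
the approximations. -/
theorem rpow_add_sub_rpow_le {p g h : ℝ} (hp : 0 < p) (hp' : p ≤ 1) (hg : 0 < g) (hh : 0 < h) :
    (g + h) ^ p - g ^ p ≤ p * g ^ (p - 1) * h := by
  have h1 := rpow_one_add_le_one_add_mul_self (s := h / g) (by
    have : 0 < h / g := by positivity
    linarith) hp.le hp'
  have h2 : (g + h) ^ p = g ^ p * (1 + h / g) ^ p := by
    rw [← Real.mul_rpow hg.le (by positivity)]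
    congr 1; field_simp
  have h3 : g ^ (p - 1) = g ^ p / g := by rw [Real.rpow_sub hg, Real.rpow_one]
  have h4 : 0 < g ^ p := by positivity
  rw [h2, h3]
  calc g ^ p * (1 + h / g) ^ p - g ^ p ≤ g ^ p * (1 + p * (h / g)) - g ^ p := by gcongr
    _ = _ := by field_simp; ring

theorem tendsto_rpow_slope (p : ℝ) {g : ℝ} (hg : 0 < g) :
    Tendsto (fun h : ℝ => ((g + h) ^ p - g ^ p) / h) (𝓝[>] 0) (𝓝 (p * g ^ (p - 1))) := by
  have := (Real.hasDerivAt_rpow_const (x := g) (p := p) (Or.inl hg.ne')).tendsto_slope_zero_right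
  refine this.congr fun h => ?_
  rw [smul_eq_mul]; ring

variable {Ω : Type*} [MeasurableSpace Ω] {μ : Measure Ω}

theorem rpow_sub_half_sq {D g : ℝ} (hg : 0 < g) : (g ^ (D - 1 / 2)) ^ 2 = g ^ (2 * D - 1) := by
  rw [← Real.rpow_natCast, ← Real.rpow_mul hg.le]; congr 1; push_cast; ring

theorem tendsto_eLpNorm_two_zero {ι : Type*} {l : Filter ι} {f : ι → Ω → ℝ}
    (h : Tendsto (fun i => ∫⁻ ω, ENNReal.ofReal (f i ω ^ 2) ∂μ) l (𝓝 0)) :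
    Tendsto (fun i => eLpNorm (f i) 2 μ) l (𝓝 0) := by
  have e : ∀ i, eLpNorm (f i) 2 μ = (∫⁻ ω, ENNReal.ofReal (f i ω ^ 2) ∂μ) ^ (1 / 2 : ℝ) := by
    intro i
    rw [eLpNorm_eq_lintegral_rpow_enorm_toReal (by simp) (by simp)]
    simp only [ENNReal.toReal_ofNat]
    congr 1
    refine lintegral_congr fun ω => ?_
    rw [Real.enorm_eq_ofReal_abs, ENNReal.ofReal_rpow_of_nonneg (abs_nonneg _) (by norm_num)]
    simp
  simp_rw [e]
  have := (ENNReal.continuous_rpow_const (y := 1 / 2) |>.tendsto 0).comp h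
  rw [ENNReal.zero_rpow_of_pos (by norm_num)] at this
  exact this

theorem memLp_two_of_lintegral {f : Ω → ℝ} (hf : AEMeasurable f μ)
    (h : ∫⁻ ω, ENNReal.ofReal (f ω ^ 2) ∂μ ≠ ∞) : MemLp f 2 μ := by
  rw [memLp_two_iff_integrable_sq hf.aestronglyMeasurable]
  refine ⟨(hf.pow_const 2).aestronglyMeasurable, ?_⟩
  rw [hasFiniteIntegral_iff_ofReal (ae_of_all _ fun ω => sq_nonneg _)]
  exact h.lt_top

/-- The renormalised square roots of the clock increments converge in `L²`. -/
theorem tendsto_sqrt_increment [IsProbabilityMeasure μ] {D σ r : ℝ} (hD : 0 < D) (hD' : D ≤ 1 / 2)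
    (hσ : 0 < σ) {V : ℝ → Ω → ℝ} {n : ℝ → Ω → ℝ≥0∞} {G : Ω → ℝ}
    (hnm : ∀ h, Measurable (n h))
    (hGm : AEMeasurable G μ) (hG : ∀ᵐ ω ∂μ, 0 < G ω)
    (hG2 : MemLp (fun ω => G ω ^ (D - 1 / 2)) 2 μ)
    (hV0 : ∀ᵐ ω ∂μ, ∀ h, 0 < h → 0 ≤ V h ω)
    (hVn : ∀ᵐ ω ∂μ, ∀ h, 0 < h → n h ω = 0 →
      V h ω = σ ^ 2 * ((G ω + h) ^ (2 * D) - G ω ^ (2 * D)))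
    (hVle : ∀ᵐ ω ∂μ, ∀ h, 0 < h →
      ENNReal.ofReal (V h ω) ≤ ENNReal.ofReal (σ ^ 2 * h ^ (2 * D)) * (n h ω + 1))
    (hn1 : ∀ᵐ ω ∂μ, ∀ h, n h ω ≠ 0 → 1 ≤ n h ω)
    (hn : ∀ h, 0 < h → ∫⁻ ω, n h ω ∂μ ≤ ENNReal.ofReal (r * h))
    (hev : ∀ᵐ ω ∂μ, ∀ᶠ h in 𝓝[>] (0 : ℝ), n h ω = 0) :
    (∀ h, 0 < h → ∫⁻ ω, ENNReal.ofReal (V h ω) ∂μ ≠ ∞) ∧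
    Tendsto (fun h => eLpNorm (fun ω => √(V h ω / h) - σ * √(2 * D) * G ω ^ (D - 1 / 2)) 2 μ)
      (𝓝[>] 0) (𝓝 0) := by
  constructor
  · intro h hh
    refine ((lintegral_mono_ae (hVle.mono fun ω hω => hω h hh)).trans_lt ?_).ne
    rw [lintegral_const_mul _ ((hnm h).add_const 1), lintegral_add_right _ measurable_const]
    refine ENNReal.mul_lt_top (by simp) ?_
    simpa using (hn h hh).trans_lt ENNReal.ofReal_lt_top
  refine tendsto_eLpNorm_two_zero ?_
  set a : Ω → ℝ := fun ω => σ * √(2 * D) * G ω ^ (D - 1 / 2) with ha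
  have ha2 : MemLp a 2 μ := hG2.const_mul _
  have ham : AEMeasurable a μ := ha2.aestronglyMeasurable.aemeasurable
  let f : ℝ → Ω → ℝ := fun h ω => √(σ ^ 2 * ((G ω + h) ^ (2 * D) - G ω ^ (2 * D)) / h)
  -- The integrable part of the squared error: the true error on shock-free paths, and twice the
  -- squared limit on the others. Dominated convergence handles it.
  let d : ℝ → Ω → ℝ≥0∞ := fun h ω =>
    if n h ω = 0 then ENNReal.ofReal ((f h ω - a ω) ^ 2) else ENNReal.ofReal (2 * a ω ^ 2)
  have hasq : ∀ᵐ ω ∂μ, a ω ^ 2 = σ ^ 2 * (2 * D * G ω ^ (2 * D - 1)) := by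
    filter_upwards [hG] with ω hω
    rw [ha, mul_pow, mul_pow, rpow_sub_half_sq hω, Real.sq_sqrt (by linarith)]
    ring
  have ha0 : ∀ᵐ ω ∂μ, 0 ≤ a ω := by
    filter_upwards [hG] with ω hω
    positivity
  have hfa : ∀ᵐ ω ∂μ, ∀ h, 0 < h → f h ω ≤ a ω := by
    filter_upwards [hG, hasq, ha0] with ω hω h2 h3 h hh
    refine Real.sqrt_le_iff.2 ⟨h3, ?_⟩
    rw [h2, div_le_iff₀ hh, mul_assoc (σ ^ 2)]
    exact mul_le_mul_of_nonneg_left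
      (rpow_add_sub_rpow_le (by linarith) (by linarith) hω hh) (sq_nonneg σ)
  have hdm : ∀ h, AEMeasurable (d h) μ := fun h => by
    have hs : MeasurableSet {ω | n h ω = 0} := hnm h (measurableSet_singleton 0)
    have : d h = {ω | n h ω = 0}.indicator (fun ω => ENNReal.ofReal ((f h ω - a ω) ^ 2))
        + {ω | n h ω = 0}ᶜ.indicator (fun ω => ENNReal.ofReal (2 * a ω ^ 2)) := by
      ext ω
      by_cases hz : n h ω = 0 <;> simp [d, hz]
    rw [this]
    refine AEMeasurable.add (AEMeasurable.indicator ?_ hs) (AEMeasurable.indicator ?_ hs.compl) <;>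
      fun_prop
  have hd : Tendsto (fun h => ∫⁻ ω, d h ω ∂μ) (𝓝[>] 0) (𝓝 0) := by
    have := tendsto_lintegral_filter_of_dominated_convergence' (μ := μ) (l := 𝓝[>] (0 : ℝ))
      (F := d) (f := fun _ => 0) (fun ω => ENNReal.ofReal (2 * a ω ^ 2))
      (Eventually.of_forall hdm) ?_ ?_ ?_
    · simpa using this
    · filter_upwards [self_mem_nhdsWithin] with h hh
      filter_upwards [hfa, ha0] with ω h1 h2
      simp only [d]
      split_ifs
      · refine ENNReal.ofReal_le_ofReal ?_
        have h3 : 0 ≤ f h ω := Real.sqrt_nonneg _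
        have h4 := h1 h hh
        nlinarith
      · exact le_rfl
    · have := (ha2.integrable_sq.const_mul 2)
      exact (hasFiniteIntegral_iff_ofReal (ae_of_all _ fun ω => by positivity)).1 this.2 |>.ne
    · filter_upwards [hG, hasq, ha0, hev] with ω h1 h2 h3 h4
      have hf : Tendsto (fun h => f h ω) (𝓝[>] 0) (𝓝 (a ω)) := by
        have := ((tendsto_rpow_slope (2 * D) h1).const_mul (σ ^ 2)).sqrt
        rw [← h2, Real.sqrt_sq h3] at this
        refine this.congr fun h => ?_
        simp only [f]
        rw [mul_div_assoc]
      have hf2 : Tendsto (fun h => ENNReal.ofReal ((f h ω - a ω) ^ 2)) (𝓝[>] 0) (𝓝 0) := by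
        have := ENNReal.tendsto_ofReal ((hf.sub_const (a ω)).pow 2)
        simpa using this
      refine hf2.congr' ?_
      filter_upwards [h4] with h h5
      simp only [d, if_pos h5]
  -- The remaining part comes from shocks: a gain of order h^(2D)/h times a mean number of shocks of
  -- order h.
  have hb : Tendsto (fun h : ℝ => ENNReal.ofReal (4 * σ ^ 2 * r * h ^ (2 * D))) (𝓝[>] 0) (𝓝 0) := by
    have h1 : Tendsto (fun h : ℝ => h ^ (2 * D)) (𝓝[>] 0) (𝓝 0) := by
      have := (Real.continuousAt_rpow_const 0 (2 * D) (Or.inr (by linarith))).tendsto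
      rw [Real.zero_rpow (by linarith)] at this
      exact this.mono_left nhdsWithin_le_nhds
    have := ENNReal.tendsto_ofReal (h1.const_mul (4 * σ ^ 2 * r))
    simpa using this
  refine tendsto_of_tendsto_of_tendsto_of_le_of_le' tendsto_const_nhds
    (by simpa using hd.add hb) (Eventually.of_forall fun _ => zero_le) ?_
  filter_upwards [self_mem_nhdsWithin] with h hh
  have hh' : (0 : ℝ) < h := hh
  have hpt : ∀ᵐ ω ∂μ, ENNReal.ofReal ((√(V h ω / h) - a ω) ^ 2)
      ≤ d h ω + ENNReal.ofReal (4 * σ ^ 2 * h ^ (2 * D) / h) * n h ω := by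
    filter_upwards [hV0, hVn, hVle, hn1] with ω h0 h1 h2 h3
    by_cases hz : n h ω = 0
    · simp only [d, if_pos hz, hz, mul_zero, add_zero]
      rw [h1 h hh hz]
    · simp only [d, if_neg hz]
      have e1 : (√(V h ω / h) - a ω) ^ 2 ≤ 2 * a ω ^ 2 + 2 * (V h ω / h) := by
        have := Real.sq_sqrt (div_nonneg (h0 h hh) hh'.le)
        nlinarith [sq_nonneg (√(V h ω / h) + a ω)]
      refine (ENNReal.ofReal_le_ofReal e1).trans ?_
      rw [ENNReal.ofReal_add (by positivity) (by have := h0 h hh; positivity)]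
      refine add_le_add le_rfl ?_
      -- On this event there is a shock, so the constant 1 is absorbed into the count. Otherwise a
      -- term h^(2D-1), which need not vanish, would survive.
      have e2 : n h ω + 1 ≤ 2 * n h ω := by rw [two_mul]; exact add_le_add le_rfl (h3 h hz)
      calc ENNReal.ofReal (2 * (V h ω / h)) = ENNReal.ofReal (2 / h) * ENNReal.ofReal (V h ω) := by
            rw [← ENNReal.ofReal_mul (by positivity)]; congr 1; ring
        _ ≤ ENNReal.ofReal (2 / h) * (ENNReal.ofReal (σ ^ 2 * h ^ (2 * D)) * (2 * n h ω)) := by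
            gcongr
            exact (h2 h hh).trans (by gcongr)
        _ = _ := by
            rw [show (2 : ℝ≥0∞) = ENNReal.ofReal 2 by simp, ← mul_assoc, ← mul_assoc,
              ← ENNReal.ofReal_mul (by positivity), ← ENNReal.ofReal_mul (by positivity)]
            congr 2; ring
  refine (lintegral_mono_ae hpt).trans ?_
  rw [lintegral_add_left' (hdm h), lintegral_const_mul _ (hnm h)]
  refine add_le_add le_rfl ?_
  calc _ ≤ ENNReal.ofReal (4 * σ ^ 2 * h ^ (2 * D) / h) * ENNReal.ofReal (r * h) := by
        gcongr; exact hn h hh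
    _ = _ := by
        rw [← ENNReal.ofReal_mul (by positivity)]
        congr 1
        field_simp

/-- Products of `L²`-convergent families have convergent integrals. -/
theorem tendsto_integral_mul_of_eLpNorm {f g : ℝ → Ω → ℝ} {f₀ g₀ : Ω → ℝ} {l : Filter ℝ}
    (hf : ∀ᶠ h in l, MemLp (f h) 2 μ) (hg : ∀ᶠ h in l, MemLp (g h) 2 μ) (hf₀ : MemLp f₀ 2 μ)
    (hg₀ : MemLp g₀ 2 μ) (hfl : Tendsto (fun h => eLpNorm (fun ω => f h ω - f₀ ω) 2 μ) l (𝓝 0))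
    (hgl : Tendsto (fun h => eLpNorm (fun ω => g h ω - g₀ ω) 2 μ) l (𝓝 0)) :
    Tendsto (fun h => ∫ ω, f h ω * g h ω ∂μ) l (𝓝 (∫ ω, f₀ ω * g₀ ω ∂μ)) := by
  classical
  -- Square integrability holds only eventually, so the families are set to zero elsewhere;
  -- continuity of the L² inner product then gives the limit.
  let f' : ℝ → Ω → ℝ := fun h => if MemLp (f h) 2 μ then f h else 0
  let g' : ℝ → Ω → ℝ := fun h => if MemLp (g h) 2 μ then g h else 0
  have hf' : ∀ h, MemLp (f' h) 2 μ := fun h => by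
    simp only [f']; split_ifs with H; exacts [H, MemLp.zero]
  have hg' : ∀ h, MemLp (g' h) 2 μ := fun h => by
    simp only [g']; split_ifs with H; exacts [H, MemLp.zero]
  have tf : Tendsto (fun h => (hf' h).toLp (f' h)) l (𝓝 (hf₀.toLp f₀)) := by
    rw [Lp.tendsto_Lp_iff_tendsto_eLpNorm'']
    refine hfl.congr' ?_
    filter_upwards [hf] with h hh
    simp only [f', if_pos hh]; rfl
  have tg : Tendsto (fun h => (hg' h).toLp (g' h)) l (𝓝 (hg₀.toLp g₀)) := by
    rw [Lp.tendsto_Lp_iff_tendsto_eLpNorm'']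
    refine hgl.congr' ?_
    filter_upwards [hg] with h hh
    simp only [g', if_pos hh]; rfl
  have key := tf.inner (𝕜 := ℝ) tg
  have e : ∀ (u v : Ω → ℝ) (hu : MemLp u 2 μ) (hv : MemLp v 2 μ),
      inner ℝ (hu.toLp u) (hv.toLp v) = ∫ ω, u ω * v ω ∂μ := by
    intro u v hu hv
    rw [L2.inner_def]
    refine integral_congr_ae ?_
    filter_upwards [hu.coeFn_toLp, hv.coeFn_toLp] with ω h1 h2
    rw [h1, h2]; simp [mul_comm]
  simp_rw [e] at key
  refine key.congr' ?_
  filter_upwards [hf, hg] with h h1 h2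
  simp only [f', g', if_pos h1, if_pos h2]

/-- Restriction to events that eventually fail kills an `L²`-convergent family. -/
theorem tendsto_eLpNorm_indicator {f : ℝ → Ω → ℝ} {f₀ : Ω → ℝ} {l : Filter ℝ}
    [l.IsCountablyGenerated] {bad : ℝ → Set Ω} (hbad : ∀ h, NullMeasurableSet (bad h) μ)
    (hf : ∀ᶠ h in l, MemLp (f h) 2 μ) (hf₀ : MemLp f₀ 2 μ)
    (hfl : Tendsto (fun h => eLpNorm (fun ω => f h ω - f₀ ω) 2 μ) l (𝓝 0))
    (hev : ∀ᵐ ω ∂μ, ∀ᶠ h in l, ω ∉ bad h) :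
    Tendsto (fun h => eLpNorm ((bad h).indicator (f h)) 2 μ) l (𝓝 0) := by
  -- Dominated convergence for the fixed limit `f₀`; the difference from `f h` is controlled by the
  -- L² distance.
  have h0 : Tendsto (fun h => eLpNorm ((bad h).indicator f₀) 2 μ) l (𝓝 0) := by
    refine tendsto_eLpNorm_two_zero ?_
    have := tendsto_lintegral_filter_of_dominated_convergence' (μ := μ) (l := l)
      (F := fun h ω => ENNReal.ofReal ((bad h).indicator f₀ ω ^ 2)) (f := fun _ => 0)
      (fun ω => ENNReal.ofReal (f₀ ω ^ 2)) (Eventually.of_forall fun h => ?_) ?_ ?_ ?_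
    · simpa using this
    · have := (hf₀.aestronglyMeasurable.indicator₀ (hbad h)).aemeasurable
      fun_prop
    · refine Eventually.of_forall fun h => ae_of_all _ fun ω => ENNReal.ofReal_le_ofReal ?_
      by_cases hω : ω ∈ bad h
      · rw [indicator_of_mem hω]
      · rw [indicator_of_notMem hω]; simpa using sq_nonneg (f₀ ω)
    · exact (hasFiniteIntegral_iff_ofReal
        (ae_of_all _ fun ω => sq_nonneg _)).1 hf₀.integrable_sq.2 |>.ne
    · filter_upwards [hev] with ω hω
      refine tendsto_const_nhds.congr' ?_
      filter_upwards [hω] with h hh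
      simp [indicator_of_notMem hh]
  refine tendsto_of_tendsto_of_tendsto_of_le_of_le' tendsto_const_nhds
    (by simpa using hfl.add h0) (Eventually.of_forall fun _ => zero_le) ?_
  filter_upwards [hf] with h hh
  have e : (bad h).indicator (f h)
      = (bad h).indicator (fun ω => f h ω - f₀ ω) + (bad h).indicator f₀ := by
    ext ω
    by_cases hω : ω ∈ bad h <;> simp [hω]
  rw [e]
  refine (eLpNorm_add_le ?_ ?_ (by norm_num)).trans ?_
  · exact ((hh.sub hf₀).aestronglyMeasurable).indicator₀ (hbad h)
  · exact hf₀.aestronglyMeasurable.indicator₀ (hbad h)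
  · exact add_le_add (eLpNorm_indicator_le _) le_rfl

end Asymptotics

/-! ### Joint laws and covariances of ages. -/

section Ages

variable {Ω : Type*} [MeasurableSpace Ω] {μ : Measure Ω}

/-- Covariance of a function of the first coordinate with a variable that is a function of the
second coordinate on an event depending on the second coordinate only. -/
theorem covariance_prod_switch {α β : Type*} [MeasurableSpace α] [MeasurableSpace β]
    (κ : Measure α) (η : Measure β) [IsProbabilityMeasure κ] [IsProbabilityMeasure η]
    {F v : α → ℝ} {U : β → ℝ} {s : Set β} (hs : MeasurableSet s)
    (hF : MemLp F 2 κ) (hv : MemLp v 2 κ) (hU : MemLp U 2 η) :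
    cov[fun p => F p.1, fun p => s.indicator U p.2 + sᶜ.indicator 1 p.2 * v p.1; κ.prod η]
      = η.real sᶜ * cov[F, v; κ] := by
  have hF' : MemLp (fun p : α × β => F p.1) 2 (κ.prod η) := hF.comp_fst η
  have hU' : MemLp (fun p : α × β => s.indicator U p.2) 2 (κ.prod η) := (hU.indicator hs).comp_snd κ
  have hv' : MemLp (fun p : α × β => sᶜ.indicator 1 p.2 * v p.1) 2 (κ.prod η) := by
    have := (hv.comp_fst η).indicator (s := Prod.snd ⁻¹' sᶜ) (measurable_snd hs.compl)
    refine this.ae_eq (ae_of_all _ fun p => ?_)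
    by_cases hp : p.2 ∈ s <;> simp [hp]
  have hadd := covariance_add_right hF' hU' hv'
  -- The part carried by `s` depends on the second coordinate alone and contributes no covariance.
  have h0 : cov[fun p : α × β => F p.1, fun p => s.indicator U p.2; κ.prod η] = 0 :=
    covariance_fst_snd_prod hF (hU.indicator hs)
  have e : (fun p : α × β => s.indicator U p.2 + sᶜ.indicator 1 p.2 * v p.1)
    = (fun p => s.indicator U p.2) + fun p => sᶜ.indicator 1 p.2 * v p.1 := rfl
  rw [e, hadd, h0, zero_add, covariance_eq_sub hF' hv', covariance_eq_sub hF hv]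
  have i1 : ∫ b, sᶜ.indicator (1 : β → ℝ) b ∂η = η.real sᶜ := integral_indicator_one hs.compl
  have e1 : ∫ p : α × β, F p.1 * (sᶜ.indicator 1 p.2 * v p.1) ∂(κ.prod η)
      = (∫ a, F a * v a ∂κ) * η.real sᶜ := by
    rw [← i1, ← integral_prod_mul (fun a => F a * v a) (sᶜ.indicator (1 : β → ℝ))]
    exact integral_congr_ae (ae_of_all _ fun p => by ring)
  have e2 : ∫ p : α × β, sᶜ.indicator 1 p.2 * v p.1 ∂(κ.prod η) = (∫ a, v a ∂κ) * η.real sᶜ := by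
    rw [← i1, ← integral_prod_mul v (sᶜ.indicator (1 : β → ℝ))]
    exact integral_congr_ae (ae_of_all _ fun p => by ring)
  have e3 : ∫ p : α × β, F p.1 ∂(κ.prod η) = ∫ a, F a ∂κ := by
    have := integral_prod_mul (μ := κ) (ν := η) F (fun _ => (1 : ℝ))
    simpa using this
  simp only [Pi.mul_apply]
  rw [e1, e2, e3]
  ring

variable {T : Ω → Set ℝ} {τ : ℤ → Ω → ℝ} {r : ℝ}

theorem IsShockProcess.aemeasurable_age (hT : IsShockProcess T τ r μ) (u : ℝ) :
    AEMeasurable (fun ω => age (fun n => τ n ω) u) μ := by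
  refine ((measurable_ageOf u).comp (measurable_pointCounts hT.measurable_count)).aemeasurable.congr ?_
  filter_upwards [hT.labelling, hT.ae_finite] with ω h1 h2
  exact ageOf_pointCounts h1 h2 u

theorem IsShockProcess.aemeasurable_timeChange (hT : IsShockProcess T τ r μ) (D σ u : ℝ) :
    AEMeasurable (fun ω => timeChange D σ (fun n => τ n ω) u) μ := by
  refine ((measurable_clockOf D σ u).comp
    (measurable_pointCounts hT.measurable_count)).aemeasurable.congr ?_
  filter_upwards [hT.labelling, hT.ae_finite] with ω h1 h2
  exact clockOf_pointCounts D σ h1 h2 u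

theorem IsShockProcess.hasLaw_age [IsProbabilityMeasure μ] (hT : IsShockProcess T τ r μ)
    (hr : 0 < r) {u : ℝ} (hu : 0 ≤ u) :
    HasLaw (fun ω => age (fun n => τ n ω) u) (expMeasure r) μ := by
  refine hasLaw_exp_of_tails (hT.aemeasurable_age u) hr fun x hx => ?_
  have hv := hT.void (Icc (u - x) u) measurableSet_Icc (by simp)
  rw [Real.volume_Icc, sub_sub_cancel, ENNReal.toReal_ofReal hx] at hv
  rw [← hv]
  refine measure_congr ?_
  filter_upwards [hT.labelling, hT.ae_finite] with ω h1 h2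
  exact propext (lt_age_iff h1 h2 hu)

/-- The intervals are disjoint if y < t; otherwise they merge into one interval ending at `t`. -/
theorem volume_Icc_union_toReal {x y t : ℝ} (hx : 0 ≤ x) (hy : 0 ≤ y) (ht : 0 ≤ t) :
    (volume (Icc (0 - x) 0 ∪ Icc (t - y) t)).toReal
      = if y < t then x + y else t + max x (y - t) := by
  split_ifs with h
  · rw [measure_union _ measurableSet_Icc, Real.volume_Icc, Real.volume_Icc,
      ENNReal.toReal_add (by simp) (by simp), ENNReal.toReal_ofReal (by linarith),
      ENNReal.toReal_ofReal (by linarith)]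
    · ring
    · rw [Set.disjoint_left]
      rintro z ⟨_, hz⟩ ⟨hz', _⟩
      linarith
  · have : Icc (0 - x) 0 ∪ Icc (t - y) t = Icc (-max x (y - t)) t := by
      ext z
      simp only [mem_union, mem_Icc, neg_le]
      constructor
      · rintro (⟨h1, h2⟩ | ⟨h1, h2⟩)
        · exact ⟨le_max_of_le_left (by linarith), by linarith⟩
        · exact ⟨le_max_of_le_right (by linarith), h2⟩
      · rintro ⟨h1, h2⟩
        rcases le_max_iff.1 h1 with h3 | h3
        · by_cases hz : z ≤ 0
          · exact Or.inl ⟨by linarith, hz⟩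
          · exact Or.inr ⟨by linarith, h2⟩
        · exact Or.inr ⟨by linarith, h2⟩
    rw [this, Real.volume_Icc, ENNReal.toReal_ofReal]
    · ring
    · have := le_max_left x (y - t)
      linarith

section Pair

variable {TX TY : Ω → Set ℝ} {τX τY : ℤ → Ω → ℝ} {rX rY a b c : ℝ}

/-- Joint void probabilities of a pair of random sets with common points of rate `a`. -/
def HasPairVoid (TX TY : Ω → Set ℝ) (a b c : ℝ) (μ : Measure Ω) : Prop :=
  ∀ A B : Set ℝ, MeasurableSet A → volume A ≠ ∞ → MeasurableSet B → volume B ≠ ∞ →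
    μ {ω | TX ω ∩ A = ∅ ∧ TY ω ∩ B = ∅} = ENNReal.ofReal (Real.exp
      (-(a * (volume (A ∪ B)).toReal + b * (volume A).toReal + c * (volume B).toReal)))

theorem measure_age_pair (hX : IsShockProcess TX τX rX μ) (hY : IsShockProcess TY τY rY μ)
    (hp : HasPairVoid TX TY a b c μ) {t x y : ℝ} (ht : 0 ≤ t) (hx : 0 ≤ x) (hy : 0 ≤ y) :
    μ.map (fun ω => (age (fun n => τX n ω) 0, age (fun n => τY n ω) t)) (Ioi x ×ˢ Ioi y)
      = ENNReal.ofReal (Real.exp (-(a * (if y < t then x + y else t + max x (y - t))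
          + b * x + c * y))) := by
  rw [Measure.map_apply_of_aemeasurable ((hX.aemeasurable_age 0).prodMk (hY.aemeasurable_age t))
    (measurableSet_Ioi.prod measurableSet_Ioi), ← volume_Icc_union_toReal hx hy ht]
  have hv := hp (Icc (0 - x) 0) (Icc (t - y) t) measurableSet_Icc (by simp) measurableSet_Icc
    (by simp)
  have e1 : (volume (Icc (0 - x) 0)).toReal = x := by simp [hx]
  have e2 : (volume (Icc (t - y) t)).toReal = y := by simp [hy]
  rw [e1, e2] at hv
  rw [← hv]
  refine measure_congr ?_
  filter_upwards [hX.labelling, hX.ae_finite, hY.labelling, hY.ae_finite] with ω h1 h2 h3 h4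
  exact propext (and_congr (lt_age_iff h1 h2 le_rfl) (lt_age_iff h3 h4 ht))

/-- The Y-age at `t` is renewed by a shock in (0, t] and is otherwise `t` plus the Y-age at 0.
Comparing tails gives this representation in law, and only the unrenewed part has a covariance with
the X-age at 0. -/
theorem covariance_age_pair [IsProbabilityMeasure μ] (hX : IsShockProcess TX τX rX μ)
    (hY : IsShockProcess TY τY rY μ)
    (hp : HasPairVoid TX TY a b c μ) (hrX : 0 < rX) (hrY : 0 < rY) (hac : rY = a + c)
    {t : ℝ} (ht : 0 ≤ t) {f g : ℝ → ℝ} (hf : Measurable f) (hg : Measurable g)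
    (hfm : MemLp f 2 (expMeasure rX)) (hgm : MemLp g 2 (expMeasure rY))
    (hgt : MemLp (fun ω => g (t + age (fun n => τY n ω) 0)) 2 μ) :
    cov[fun ω => f (age (fun n => τX n ω) 0), fun ω => g (age (fun n => τY n ω) t); μ]
      = Real.exp (-(rY * t)) * cov[fun ω => f (age (fun n => τX n ω) 0),
          fun ω => g (t + age (fun n => τY n ω) 0); μ] := by
  have hgX := hX.aemeasurable_age 0
  have hgY := hY.aemeasurable_age 0
  have hgYt := hY.aemeasurable_age t
  set κ := μ.map (fun ω => (age (fun n => τX n ω) 0, age (fun n => τY n ω) 0)) with hκ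
  have hκp : IsProbabilityMeasure κ := Measure.isProbabilityMeasure_map (hgX.prodMk hgY)
  have := isProbabilityMeasure_expMeasure hrY
  have hκt : ∀ x y : ℝ, 0 ≤ x → 0 ≤ y → κ (Ioi x ×ˢ Ioi y)
      = ENNReal.ofReal (Real.exp (-(a * max x y + b * x + c * y))) := by
    intro x y hx hy
    rw [hκ, measure_age_pair hX hY hp le_rfl hx hy, if_neg (not_lt.2 hy)]
    simp
  have mf : Measurable fun q : ℝ × ℝ => f q.1 := hf.comp measurable_fst
  have mg : Measurable fun q : ℝ × ℝ => g q.2 := hg.comp measurable_snd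
  have mgt : Measurable fun q : ℝ × ℝ => g (t + q.2) := hg.comp (measurable_snd.const_add t)
  -- The last coordinate is an independent exponential variable, in the role of the time back from
  -- `t` to the last shock; beyond `t` it is replaced by `t` plus the old age.
  let Φ : (ℝ × ℝ) × ℝ → ℝ × ℝ := fun p => (p.1.1, if p.2 ≤ t then p.2 else t + p.1.2)
  have hΦ : Measurable Φ := by
    refine (measurable_fst.comp measurable_fst).prodMk (Measurable.ite ?_ measurable_snd ?_)
    · exact measurable_snd measurableSet_Iic
    · fun_prop
  have hlaw : μ.map (fun ω => (age (fun n => τX n ω) 0, age (fun n => τY n ω) t))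
      = (κ.prod (expMeasure rY)).map Φ := by
    have h1 := Measure.isProbabilityMeasure_map (μ := μ) (hgX.prodMk hgYt)
    have h2 := Measure.isProbabilityMeasure_map (μ := κ.prod (expMeasure rY)) hΦ.aemeasurable
    refine measure_prod_ext_of_tails ?_ fun x y hx hy => ?_
    · rw [measure_age_pair hX hY hp ht le_rfl le_rfl]
      split_ifs with h
      · simp
      · have : t = 0 := le_antisymm (not_lt.1 h) ht
        simp [this]
    · rw [measure_age_pair hX hY hp ht hx hy,
        Measure.map_apply hΦ (measurableSet_Ioi.prod measurableSet_Ioi)]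
      split_ifs with h
      · have hpos : ∀ᵐ q ∂κ, 0 < q.2 := by
          refine (ae_map_iff (hgX.prodMk hgY) (measurable_snd (measurableSet_Ioi (a := (0 : ℝ))))).2 ?_
          exact hasLaw_exp_pos hrY (hY.hasLaw_age hrY le_rfl)
        have hpos' : ∀ᵐ p ∂(κ.prod (expMeasure rY)), 0 < p.1.2 :=
          Measure.quasiMeasurePreserving_fst.ae hpos
        have : Φ ⁻¹' (Ioi x ×ˢ Ioi y) =ᵐ[κ.prod (expMeasure rY)] ((Ioi x ×ˢ Ioi 0) ×ˢ Ioi y) := by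
          filter_upwards [hpos'] with p h0
          apply propext
          change p ∈ Φ ⁻¹' (Ioi x ×ˢ Ioi y) ↔ p ∈ ((Ioi x ×ˢ Ioi 0) ×ˢ Ioi y)
          simp only [mem_preimage, mem_prod, mem_Ioi, Φ]
          split_ifs with h3
          · tauto
          · have h4 : y < t + p.1.2 := by linarith
            have h5 : y < p.2 := by linarith [not_le.1 h3]
            tauto
        rw [measure_congr this, Measure.prod_prod, hκt x 0 hx le_rfl, expMeasure_Ioi hrY hy,
          ← ENNReal.ofReal_mul (Real.exp_nonneg _), ← Real.exp_add, max_eq_left hx, hac]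
        congr 2; ring
      · have : Φ ⁻¹' (Ioi x ×ˢ Ioi y) = ((Ioi x ×ˢ Ioi (y - t)) ×ˢ Ioi t) := by
          ext p
          simp only [mem_preimage, mem_prod, mem_Ioi, Φ]
          split_ifs with h3
          · have h5 : ¬ y < p.2 := by linarith
            have h6 : ¬ t < p.2 := by linarith
            tauto
          · rw [sub_lt_iff_lt_add']
            have h6 : t < p.2 := not_le.1 h3
            tauto
        rw [this, Measure.prod_prod, hκt x (y - t) hx (by linarith), expMeasure_Ioi hrY ht,
          ← ENNReal.ofReal_mul (Real.exp_nonneg _), ← Real.exp_add, hac]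
        congr 2; ring
  have hF : MemLp (fun q : ℝ × ℝ => f q.1) 2 κ := by
    rw [hκ, memLp_map_measure_iff mf.aestronglyMeasurable (hgX.prodMk hgY)]
    have hl := hX.hasLaw_age hrX le_rfl
    rw [← hl.map_eq, memLp_map_measure_iff hf.aestronglyMeasurable hgX] at hfm
    exact hfm
  have hv : MemLp (fun q : ℝ × ℝ => g (t + q.2)) 2 κ := by
    rw [hκ, memLp_map_measure_iff mgt.aestronglyMeasurable (hgX.prodMk hgY)]
    exact hgt
  -- The switching set is `Iic t`; the mass of its complement is the factor exp(-(rY t)) of the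
  -- conclusion.
  have hsw := covariance_prod_switch κ (expMeasure rY) (s := Iic t) measurableSet_Iic hF hv hgm
  rw [compl_Iic, Measure.real, expMeasure_Ioi hrY ht, ENNReal.toReal_ofReal (Real.exp_nonneg _),
    hκ, covariance_map_fun mf.aestronglyMeasurable mgt.aestronglyMeasurable
      (hgX.prodMk hgY), ← hκ] at hsw
  rw [← hsw]
  have hc := covariance_map_fun (μ := μ) (X := fun q : ℝ × ℝ => f q.1) (Y := fun q => g q.2)
    mf.aestronglyMeasurable mg.aestronglyMeasurable (hgX.prodMk hgYt)
  rw [← hc, hlaw, covariance_map_fun mf.aestronglyMeasurable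
    mg.aestronglyMeasurable hΦ.aemeasurable]
  congr 1
  ext p
  by_cases h3 : p.2 ≤ t
  · simp [Φ, h3]
  · simp [Φ, h3, not_le.1 h3]

end Pair

end Ages

/-! ### Moments of the absolute returns of one price. -/

section Price

variable {Ω : Type*} [MeasurableSpace Ω] {μ : Measure Ω}

/-- A driver time-changed by the clock of an independent shock process. -/
structure IsPriceModel (W : ℝ≥0 → Ω → ℝ) (T : Ω → Set ℝ) (τ : ℤ → Ω → ℝ) (D σ r : ℝ)
    (μ : Measure Ω) : Prop where
  driver : IsDriver W μ
  shock : IsShockProcess T τ r μ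
  indep : IndepFun (fun ω s => W s ω) (pointCounts T) μ
  rate_pos : 0 < r
  D_pos : 0 < D
  D_le : D ≤ 1 / 2
  σ_pos : 0 < σ

/-- The increment of the time change over `(t, t + h]`. -/
noncomputable def clockInc (D σ : ℝ) (τ : ℤ → Ω → ℝ) (t h : ℝ) (ω : Ω) : ℝ :=
  timeChange D σ (fun n => τ n ω) (t + h) - timeChange D σ (fun n => τ n ω) t

/-- The limit of the renormalised square root of the clock increment. -/
noncomputable def limitVol (D σ : ℝ) (τ : ℤ → Ω → ℝ) (t : ℝ) (ω : Ω) : ℝ :=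
  σ * √(2 * D) * age (fun n => τ n ω) t ^ (D - 1 / 2)

variable {W : ℝ≥0 → Ω → ℝ} {T : Ω → Set ℝ} {τ : ℤ → Ω → ℝ} {D σ r t h : ℝ}

namespace IsPriceModel

theorem clock_coe (M : IsPriceModel W T τ D σ r μ) :
    ∀ᵐ ω ∂μ, ∀ u, 0 ≤ u → ((clockOf D σ u (pointCounts T ω)).toNNReal : ℝ)
      = timeChange D σ (fun n => τ n ω) u := by
  filter_upwards [M.shock.labelling, M.shock.ae_finite] with ω h1 h2 u hu
  rw [clockOf_pointCounts D σ h1 h2,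
    Real.coe_toNNReal _ (timeChange_nonneg M.D_pos M.D_le M.σ_pos h1 h2 hu)]

theorem clock_eq (M : IsPriceModel W T τ D σ r μ) :
    ∀ᵐ ω ∂μ, ∀ u, clockOf D σ u (pointCounts T ω) = timeChange D σ (fun n => τ n ω) u := by
  filter_upwards [M.shock.labelling, M.shock.ae_finite] with ω h1 h2 u
  rw [clockOf_pointCounts D σ h1 h2]

theorem absReturn_eq (M : IsPriceModel W T τ D σ r μ) (t h : ℝ) :
    ∀ᵐ ω ∂μ, absReturn (logPrice W D σ τ) t h ω
      = |W (clockOf D σ (t + h) (pointCounts T ω)).toNNReal ω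
        - W (clockOf D σ t (pointCounts T ω)).toNNReal ω| := by
  filter_upwards [M.clock_eq] with ω h1
  rw [absReturn, logPrice, logPrice, h1, h1]

theorem clockInc_pos (M : IsPriceModel W T τ D σ r μ) (ht : 0 ≤ t) :
    ∀ᵐ ω ∂μ, ∀ h, 0 < h → 0 < clockInc D σ τ t h ω := by
  filter_upwards [M.shock.labelling, M.shock.ae_finite] with ω h1 h2 h hh
  have hfin : (T ω ∩ Ioc t (t + h)).Finite := (h2 (t + h)).subset
    (inter_subset_inter_right _ (Ioc_subset_Ioc_left ht))
  exact (timeChange_sub_bounds M.D_pos M.D_le M.σ_pos h1 h2 ht hh hfin.cast_ncard_eq.symm).1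

theorem aemeasurable_clockInc (M : IsPriceModel W T τ D σ r μ) (t h : ℝ) :
    AEMeasurable (clockInc D σ τ t h) μ :=
  (M.shock.aemeasurable_timeChange D σ _).sub (M.shock.aemeasurable_timeChange D σ _)

theorem memLp_age [IsProbabilityMeasure μ] (M : IsPriceModel W T τ D σ r μ) (ht : 0 ≤ t) :
    MemLp (fun ω => age (fun n => τ n ω) t ^ (D - 1 / 2)) 2 μ := by
  have hl := M.shock.hasLaw_age M.rate_pos ht
  have := memLp_two_rpow_expMeasure M.rate_pos M.D_pos
  rw [← hl.map_eq, memLp_map_measure_iff (by fun_prop) hl.aemeasurable] at this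
  exact this

theorem clockInc_asymptotics [IsProbabilityMeasure μ] (M : IsPriceModel W T τ D σ r μ)
    (ht : 0 ≤ t) :
    (∀ h, 0 < h → ∫⁻ ω, ENNReal.ofReal (clockInc D σ τ t h ω) ∂μ ≠ ∞) ∧
    Tendsto (fun h => eLpNorm (fun ω => √(clockInc D σ τ t h ω / h) - limitVol D σ τ t ω) 2 μ)
      (𝓝[>] 0) (𝓝 0) := by
  have hfin : ∀ᵐ ω ∂μ, ∀ h, (T ω ∩ Ioc t (t + h)).Finite := by
    filter_upwards [M.shock.ae_finite] with ω h2 h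
    exact (h2 (t + h)).subset (inter_subset_inter_right _ (Ioc_subset_Ioc_left ht))
  refine tendsto_sqrt_increment (r := r)
    (n := fun h ω => ((T ω ∩ Ioc t (t + h)).encard : ℝ≥0∞)) M.D_pos M.D_le M.σ_pos
    (fun h => (measurable_of_countable _).comp (M.shock.measurable_count _ measurableSet_Ioc))
    (M.shock.aemeasurable_age t)
    (hasLaw_exp_pos M.rate_pos (M.shock.hasLaw_age M.rate_pos ht)) (M.memLp_age ht)
    ((M.clockInc_pos ht).mono fun ω hω h hh => (hω h hh).le) ?_ ?_ ?_ ?_ ?_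
  · filter_upwards [M.shock.labelling, M.shock.ae_finite] with ω h1 h2 h hh hn
    exact timeChange_sub_of_empty D σ h1 h2 ht hh.le (by simpa using hn)
  · filter_upwards [M.shock.labelling, M.shock.ae_finite, hfin] with ω h1 h2 h3 h hh
    have hb := (timeChange_sub_bounds M.D_pos M.D_le M.σ_pos h1 h2 ht hh
      (h3 h).cast_ncard_eq.symm).2
    rw [← (h3 h).cast_ncard_eq, ENat.toENNReal_coe]
    refine (ENNReal.ofReal_le_ofReal hb).trans_eq ?_
    rw [show ((T ω ∩ Ioc t (t + h)).ncard : ℝ≥0∞) + 1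
      = ENNReal.ofReal ((T ω ∩ Ioc t (t + h)).ncard + 1) by
        rw [ENNReal.ofReal_add (by positivity) (by norm_num)]; simp,
      ← ENNReal.ofReal_mul (by positivity)]
    congr 1; ring
  · filter_upwards [hfin] with ω h3 h
    rw [← (h3 h).cast_ncard_eq, ENat.toENNReal_coe]
    intro hne
    exact_mod_cast Nat.one_le_iff_ne_zero.2 (by exact_mod_cast hne)
  · intro h hh
    refine (M.shock.lintegral_count_le _ measurableSet_Ioc (by simp)).trans_eq ?_
    rw [Real.volume_Ioc, add_sub_cancel_left, ENNReal.ofReal_mul M.rate_pos.le]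
  -- For `h` smaller than the waiting time until the next label after `t`, the interval holds no
  -- shock.
  · filter_upwards [M.shock.labelling, M.shock.ae_finite] with ω h1 h2
    have hlt := lt_label_jumpCount_succ h1 h2 ht
    filter_upwards [Ioo_mem_nhdsGT (sub_pos.2 hlt)] with h hh
    have : T ω ∩ Ioc t (t + h) = ∅ := by
      rw [Set.eq_empty_iff_forall_notMem]
      rintro x ⟨hx, hx1, hx2⟩
      rw [← h1.range_eq] at hx
      obtain ⟨n, rfl⟩ := hx
      have := hh.2
      have e1 := label_jumpCount_le h1 h2 ht
      have l1 : (jumpCount (fun n => τ n ω) t : ℤ) < n :=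
        h1.strictMono.lt_iff_lt.1 (e1.trans_lt hx1)
      have l2 : n < (jumpCount (fun n => τ n ω) t : ℤ) + 1 :=
        h1.strictMono.lt_iff_lt.1 (lt_of_le_of_lt hx2 (by linarith))
      omega
    simp [this]

theorem memLp_sqrt [IsProbabilityMeasure μ] (M : IsPriceModel W T τ D σ r μ) (ht : 0 ≤ t)
    (hh : 0 < h) : MemLp (fun ω => √(clockInc D σ τ t h ω)) 2 μ := by
  have hm := M.aemeasurable_clockInc t h
  refine memLp_two_of_lintegral (by fun_prop) ?_
  convert M.clockInc_asymptotics ht |>.1 h hh using 1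
  refine lintegral_congr_ae ?_
  filter_upwards [M.clockInc_pos ht] with ω h1
  rw [Real.sq_sqrt (h1 h hh).le]

theorem aemeasurable_absReturn (M : IsPriceModel W T τ D σ r μ) (t h : ℝ) :
    AEMeasurable (absReturn (logPrice W D σ τ) t h) μ := by
  refine AEMeasurable.congr (f := fun ω => |W (clockOf D σ (t + h) (pointCounts T ω)).toNNReal ω
        - W (clockOf D σ t (pointCounts T ω)).toNNReal ω|) ?_
    ((M.absReturn_eq t h).mono fun ω hω => hω.symm)
  have key : ∀ u, AEMeasurable (fun ω => W (clockOf D σ u (pointCounts T ω)).toNNReal ω) μ :=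
    fun u => M.driver.aemeasurable_comp (((measurable_clockOf D σ u).comp
      (measurable_pointCounts M.shock.measurable_count)).real_toNNReal.aemeasurable)
  exact continuous_abs.measurable.comp_aemeasurable ((key _).sub (key _))

/-- With the clock frozen, the moment of a Brownian increment is a function `ψ` of the elapsed time
alone; the first and second moments are the cases used. -/
theorem lintegral_absReturn [IsProbabilityMeasure μ] (M : IsPriceModel W T τ D σ r μ)
    (ht : 0 ≤ t) (hh : 0 < h) {φ : ℝ → ℝ≥0∞} (hφ : Measurable φ) {ψ : ℝ → ℝ≥0∞}
    (hψ : ∀ r s : ℝ≥0, r ≤ s → ∫⁻ ω, φ |W s ω - W r ω| ∂μ = ψ ((s : ℝ) - r)) :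
    ∫⁻ ω, φ (absReturn (logPrice W D σ τ) t h ω) ∂μ
      = ∫⁻ ω, ψ (clockInc D σ τ t h ω) ∂μ := by
  have hB := measurable_pointCounts M.shock.measurable_count
  have key := M.driver.lintegral_freeze_single hB M.indep
    (measurable_clockOf D σ t).real_toNNReal (measurable_clockOf D σ (t + h)).real_toNNReal
    (φ := fun x => φ |x|) (hφ.comp continuous_abs.measurable)
  rw [lintegral_congr_ae ((M.absReturn_eq t h).mono fun ω hω => congrArg φ hω), key]
  refine lintegral_congr_ae ?_
  filter_upwards [M.clock_coe, M.clockInc_pos ht] with ω h1 h2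
  rw [hψ]
  · rw [h1 t ht, h1 (t + h) (by linarith)]; rfl
  · rw [← NNReal.coe_le_coe, h1 t ht, h1 (t + h) (by linarith)]
    have := h2 h hh
    rw [clockInc] at this
    linarith

theorem lintegral_absReturn_sq [IsProbabilityMeasure μ] (M : IsPriceModel W T τ D σ r μ)
    (ht : 0 ≤ t) (hh : 0 < h) :
    ∫⁻ ω, ENNReal.ofReal (absReturn (logPrice W D σ τ) t h ω ^ 2) ∂μ
      = ∫⁻ ω, ENNReal.ofReal (clockInc D σ τ t h ω) ∂μ :=
  M.lintegral_absReturn ht hh (φ := fun x => ENNReal.ofReal (x ^ 2)) (by fun_prop)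
    fun r s hrs => by simpa using M.driver.lintegral_sq hrs

theorem memLp_absReturn [IsProbabilityMeasure μ] (M : IsPriceModel W T τ D σ r μ)
    (ht : 0 ≤ t) (hh : 0 < h) : MemLp (absReturn (logPrice W D σ τ) t h) 2 μ := by
  refine memLp_two_of_lintegral (M.aemeasurable_absReturn t h) ?_
  rw [M.lintegral_absReturn_sq ht hh]
  exact M.clockInc_asymptotics ht |>.1 h hh

theorem integral_absReturn [IsProbabilityMeasure μ] (M : IsPriceModel W T τ D σ r μ)
    (ht : 0 ≤ t) (hh : 0 < h) : ∫ ω, absReturn (logPrice W D σ τ) t h ω ∂μ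
      = √(2 / Real.pi) * ∫ ω, √(clockInc D σ τ t h ω) ∂μ := by
  rw [← integral_const_mul, integral_eq_lintegral_of_nonneg_ae
    (f := absReturn (logPrice W D σ τ) t h) (ae_of_all _ fun ω => abs_nonneg _)
    (M.aemeasurable_absReturn t h).aestronglyMeasurable,
    integral_eq_lintegral_of_nonneg_ae (ae_of_all _ fun ω => by positivity)
    ((M.memLp_sqrt ht hh).aestronglyMeasurable.const_mul _)]
  congr 1
  exact M.lintegral_absReturn ht hh (φ := fun x => ENNReal.ofReal x)
    (ψ := fun x => ENNReal.ofReal (√(2 / Real.pi) * √x)) (by fun_prop)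
    fun r s hrs => M.driver.lintegral_abs hrs

theorem integral_absReturn_sq [IsProbabilityMeasure μ] (M : IsPriceModel W T τ D σ r μ)
    (ht : 0 ≤ t) (hh : 0 < h) : ∫ ω, absReturn (logPrice W D σ τ) t h ω ^ 2 ∂μ
      = ∫ ω, √(clockInc D σ τ t h ω) * √(clockInc D σ τ t h ω) ∂μ := by
  have hm := M.aemeasurable_clockInc t h
  rw [integral_eq_lintegral_of_nonneg_ae (ae_of_all _ fun ω => sq_nonneg _)
    ((M.aemeasurable_absReturn t h).pow_const 2).aestronglyMeasurable,
    integral_eq_lintegral_of_nonneg_ae (ae_of_all _ fun ω => by positivity)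
    (by fun_prop), M.lintegral_absReturn_sq ht hh]
  congr 1
  refine lintegral_congr_ae ?_
  filter_upwards [M.clockInc_pos ht] with ω h1
  rw [Real.mul_self_sqrt (h1 h hh).le]

theorem variance_absReturn [IsProbabilityMeasure μ] (M : IsPriceModel W T τ D σ r μ)
    (ht : 0 ≤ t) (hh : 0 < h) : Var[absReturn (logPrice W D σ τ) t h; μ]
      = ∫ ω, √(clockInc D σ τ t h ω) * √(clockInc D σ τ t h ω) ∂μ
        - 2 / Real.pi * (∫ ω, √(clockInc D σ τ t h ω) ∂μ) ^ 2 := by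
  rw [variance_eq_sub (M.memLp_absReturn ht hh), M.integral_absReturn ht hh, mul_pow,
    Real.sq_sqrt (by positivity), ← M.integral_absReturn_sq ht hh]
  rfl

end IsPriceModel

/-- The variance of the product of a positive variable with an independent folded normal one. -/
theorem foldedVar_pos [IsProbabilityMeasure μ] {f : Ω → ℝ} (hf : MemLp f 2 μ)
    (hf0 : ∀ᵐ ω ∂μ, 0 < f ω) :
    0 < ∫ ω, f ω * f ω ∂μ - 2 / Real.pi * (∫ ω, f ω ∂μ) ^ 2 := by
  -- The strict inequality 2/π < 1, with nonnegative variance and positive mean of `f`, gives strict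
  -- positivity.
  have hpi : 2 / Real.pi < 1 := (div_lt_one Real.pi_pos).2 (by linarith [Real.pi_gt_three])
  have hv := variance_nonneg f μ
  rw [variance_eq_sub hf] at hv
  have e : ∫ ω, (f ^ 2) ω ∂μ = ∫ ω, f ω * f ω ∂μ :=
    integral_congr_ae (ae_of_all _ fun ω => by simp [sq])
  rw [e] at hv
  have hpos : 0 < ∫ ω, f ω ∂μ := by
    rw [integral_pos_iff_support_of_nonneg_ae (hf0.mono fun ω h => h.le) (hf.integrable one_le_two)]
    have : μ (Function.support f) = 1 := by
      rw [← measure_univ (μ := μ)]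
      refine measure_congr ?_
      filter_upwards [hf0] with ω h
      exact propext ⟨fun _ => trivial, fun _ => h.ne'⟩
    simp [this]
  have := mul_pos hpos hpos
  nlinarith

namespace IsPriceModel

theorem variance_absReturn_pos [IsProbabilityMeasure μ] (M : IsPriceModel W T τ D σ r μ)
    (ht : 0 ≤ t) (hh : 0 < h) : 0 < Var[absReturn (logPrice W D σ τ) t h; μ] := by
  rw [M.variance_absReturn ht hh]
  refine foldedVar_pos (M.memLp_sqrt ht hh) ?_
  filter_upwards [M.clockInc_pos ht] with ω h1
  exact Real.sqrt_pos.2 (h1 h hh)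

theorem memLp_limitVol [IsProbabilityMeasure μ] (M : IsPriceModel W T τ D σ r μ) (ht : 0 ≤ t) :
    MemLp (limitVol D σ τ t) 2 μ := (M.memLp_age ht).const_mul _

theorem memLp_sqrt_div [IsProbabilityMeasure μ] (M : IsPriceModel W T τ D σ r μ) (ht : 0 ≤ t) :
    ∀ᶠ h in 𝓝[>] (0 : ℝ), MemLp (fun ω => √(clockInc D σ τ t h ω / h)) 2 μ := by
  filter_upwards [self_mem_nhdsWithin] with h hh
  simp_rw [Real.sqrt_div' _ (le_of_lt (show (0 : ℝ) < h from hh)), div_eq_mul_inv]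
  exact (M.memLp_sqrt ht hh).mul_const _

theorem tendsto_integral_sqrt [IsProbabilityMeasure μ] (M : IsPriceModel W T τ D σ r μ)
    (ht : 0 ≤ t) : Tendsto (fun h => ∫ ω, √(clockInc D σ τ t h ω / h) ∂μ) (𝓝[>] 0)
      (𝓝 (∫ ω, limitVol D σ τ t ω ∂μ)) := by
  -- The product limit with the constant 1 as second factor.
  have := tendsto_integral_mul_of_eLpNorm (g := fun _ _ => 1) (g₀ := fun _ => 1)
    (M.memLp_sqrt_div ht) (Eventually.of_forall fun _ => memLp_const 1) (M.memLp_limitVol ht)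
    (memLp_const 1) (M.clockInc_asymptotics ht).2 (by simp)
  simpa using this

theorem tendsto_variance_absReturn [IsProbabilityMeasure μ] (M : IsPriceModel W T τ D σ r μ)
    (ht : 0 ≤ t) :
    Tendsto (fun h => Var[absReturn (logPrice W D σ τ) t h; μ] / h) (𝓝[>] 0)
      (𝓝 (∫ ω, limitVol D σ τ t ω * limitVol D σ τ t ω ∂μ
        - 2 / Real.pi * (∫ ω, limitVol D σ τ t ω ∂μ) ^ 2)) := by
  have h1 := tendsto_integral_mul_of_eLpNorm (M.memLp_sqrt_div ht) (M.memLp_sqrt_div ht)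
    (M.memLp_limitVol ht) (M.memLp_limitVol ht) (M.clockInc_asymptotics ht).2
    (M.clockInc_asymptotics ht).2
  have h2 := (((M.tendsto_integral_sqrt ht).pow 2).const_mul (2 / Real.pi))
  refine (h1.sub h2).congr' ?_
  filter_upwards [self_mem_nhdsWithin] with h hh
  have hh' : (0 : ℝ) < h := hh
  rw [M.variance_absReturn ht hh]
  simp_rw [Real.sqrt_div' _ hh'.le, div_mul_div_comm, Real.mul_self_sqrt hh'.le]
  rw [integral_div, integral_div, div_pow, Real.sq_sqrt hh'.le]
  ring

end IsPriceModel

end Price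

/-! ### Covariance and correlation of the returns of two prices. -/

section PairOfPrices

variable {Ω : Type*} [MeasurableSpace Ω] {μ : Measure Ω}
variable {W₁ W₂ : ℝ≥0 → Ω → ℝ} {TX TY : Ω → Set ℝ} {τX τY : ℤ → Ω → ℝ}
  {DX DY σX σY rX rY t h : ℝ}

/-- The increments `(0, s]` of the first driver are independent of those of the second one over
later intervals, or over all intervals if `p` holds. -/
def IndepLater (p : Prop) (W₁ W₂ : ℝ≥0 → Ω → ℝ) (μ : Measure Ω) : Prop :=
  ∀ s r' s' : ℝ≥0, (p ∨ s ≤ r') → r' ≤ s' →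
    IndepFun (fun ω => W₁ s ω - W₁ 0 ω) (fun ω => W₂ s' ω - W₂ r' ω) μ

/-- The event on which the first clock has overtaken the start of the second interval. -/
def overtakeEvent (p : Prop) (DX σX DY σY : ℝ) (τX τY : ℤ → Ω → ℝ) (t h : ℝ) : Set Ω :=
  {ω | timeChange DY σY (fun n => τY n ω) t < timeChange DX σX (fun n => τX n ω) h} ∩ {_ω | ¬p}

theorem nullMeasurableSet_overtakeEvent (p : Prop) (hX : IsShockProcess TX τX rX μ)
    (hY : IsShockProcess TY τY rY μ) (DX σX DY σY t h : ℝ) :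
    NullMeasurableSet (overtakeEvent p DX σX DY σY τX τY t h) μ :=
  (nullMeasurableSet_lt (hY.aemeasurable_timeChange DY σY t)
    (hX.aemeasurable_timeChange DX σX h)).inter (MeasurableSet.const _).nullMeasurableSet

/-- Before the first X-shock the X-clock at `h` is at most σX² h^(2DX), which tends to 0, whereas
the Y-clock at t > 0 is positive. -/
theorem eventually_notMem_overtakeEvent {p : Prop} (M₁ : IsPriceModel W₁ TX τX DX σX rX μ)
    (M₂ : IsPriceModel W₂ TY τY DY σY rY μ) (hpt : p ∨ 0 < t) :
    ∀ᵐ ω ∂μ, ∀ᶠ h in 𝓝[>] (0 : ℝ), ω ∉ overtakeEvent p DX σX DY σY τX τY t h := by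
  rcases hpt with hp | ht
  · exact ae_of_all _ fun ω => Eventually.of_forall fun h hω => hω.2 hp
  filter_upwards [M₁.shock.labelling, M₁.shock.ae_finite, M₂.clockInc_pos le_rfl]
    with ω h1 h2 h3
  have hY : 0 < timeChange DY σY (fun n => τY n ω) t := by
    have := h3 t ht
    rwa [clockInc, zero_add, timeChange_zero, sub_zero] at this
  have hlim : Tendsto (fun h : ℝ => σX ^ 2 * (1 * h ^ (2 * DX))) (𝓝[>] 0) (𝓝 0) := by
    have h1 : Tendsto (fun h : ℝ => h ^ (2 * DX)) (𝓝[>] 0) (𝓝 0) := by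
      have hD := M₁.D_pos
      have := (Real.continuousAt_rpow_const 0 (2 * DX) (Or.inr (by linarith))).tendsto
      rw [Real.zero_rpow (by linarith)] at this
      exact this.mono_left nhdsWithin_le_nhds
    simpa using (h1.const_mul 1).const_mul (σX ^ 2)
  have hsmall : ∀ᶠ h in 𝓝[>] (0 : ℝ), TX ω ∩ Ioc 0 (0 + h) = ∅ := by
    have hpos : (0 : ℝ) < τX 1 ω := h1.pos
    filter_upwards [Ioo_mem_nhdsGT hpos] with h hh
    rw [Set.eq_empty_iff_forall_notMem]
    rintro x ⟨hx, hx1, hx2⟩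
    rw [← h1.range_eq] at hx
    obtain ⟨n, rfl⟩ := hx
    have l1 : 0 < n := h1.strictMono.lt_iff_lt.1 (h1.neg.trans hx1)
    have l2 : n < 1 := h1.strictMono.lt_iff_lt.1 (lt_of_le_of_lt hx2 (by linarith [hh.2]))
    omega
  filter_upwards [hsmall, hlim.eventually_lt_const hY, self_mem_nhdsWithin] with h e1 e2 hh hω
  have e3 := (timeChange_sub_bounds M₁.D_pos M₁.D_le M₁.σ_pos h1 h2 le_rfl hh (n := 0)
    (by rw [e1]; simp)).2
  rw [timeChange_zero, zero_add, sub_zero, Nat.cast_zero, zero_add] at e3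
  exact absurd hω.1 (not_lt.2 (e3.trans e2.le))

/-- Covariance of absolute returns, up to the event on which they may be dependent. -/
theorem covariance_absReturn_bound [IsProbabilityMeasure μ] {p : Prop}
    (M₁ : IsPriceModel W₁ TX τX DX σX rX μ) (M₂ : IsPriceModel W₂ TY τY DY σY rY μ)
    (hi : IndepFun (fun ω => ((fun s => W₁ s ω), (fun s => W₂ s ω)))
      (fun ω => (pointCounts TX ω, pointCounts TY ω)) μ)
    (hind : IndepLater p W₁ W₂ μ) (ht : 0 ≤ t) (hh : 0 < h) :
    |cov[absReturn (logPrice W₁ DX σX τX) 0 h, absReturn (logPrice W₂ DY σY τY) t h; μ]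
      - 2 / Real.pi * (∫ ω, √(clockInc DX σX τX 0 h ω) * √(clockInc DY σY τY t h ω) ∂μ
        - (∫ ω, √(clockInc DX σX τX 0 h ω) ∂μ) * ∫ ω, √(clockInc DY σY τY t h ω) ∂μ)|
    ≤ ∫ ω, (overtakeEvent p DX σX DY σY τX τY t h).indicator
        (fun ω => √(clockInc DX σX τX 0 h ω)) ω * √(clockInc DY σY τY t h ω) ∂μ := by
  have hth : 0 ≤ t + h := by linarith
  have h0h : 0 ≤ 0 + h := by linarith
  let B : Ω → CountSpace × CountSpace := fun ω => (pointCounts TX ω, pointCounts TY ω)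
  have hB : Measurable B := (measurable_pointCounts M₁.shock.measurable_count).prodMk
    (measurable_pointCounts M₂.shock.measurable_count)
  let cX : ℝ → CountSpace × CountSpace → ℝ≥0 := fun u b => (clockOf DX σX u b.1).toNNReal
  let cY : ℝ → CountSpace × CountSpace → ℝ≥0 := fun u b => (clockOf DY σY u b.2).toNNReal
  have hcX : ∀ u, Measurable (cX u) := fun u =>
    ((measurable_clockOf DX σX u).comp measurable_fst).real_toNNReal
  have hcY : ∀ u, Measurable (cY u) := fun u =>
    ((measurable_clockOf DY σY u).comp measurable_snd).real_toNNReal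
  have eX : ∀ᵐ ω ∂μ, ((cX (0 + h) (B ω) : ℝ) - cX 0 (B ω)) = clockInc DX σX τX 0 h ω := by
    filter_upwards [M₁.clock_coe] with ω h1
    simp only [cX, B]
    rw [h1 0 le_rfl, h1 (0 + h) h0h]; rfl
  have eY : ∀ᵐ ω ∂μ, ((cY (t + h) (B ω) : ℝ) - cY t (B ω)) = clockInc DY σY τY t h ω := by
    filter_upwards [M₂.clock_coe] with ω h1
    simp only [cY, B]
    rw [h1 t ht, h1 (t + h) hth]; rfl
  -- Off the event, either `p` holds or the frozen X-interval, which starts at clock time 0, ends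
  -- before the Y-interval starts.
  have hgood : ∀ᵐ ω' ∂μ, ω' ∉ overtakeEvent p DX σX DY σY τX τY t h →
      IndepFun (fun ω => W₁ (cX (0 + h) (B ω')) ω - W₁ (cX 0 (B ω')) ω)
        (fun ω => W₂ (cY (t + h) (B ω')) ω - W₂ (cY t (B ω')) ω) μ := by
    filter_upwards [M₁.clock_coe, M₂.clock_coe, eY, M₂.clockInc_pos ht] with ω' h1 h2 h3 h4 hb
    have z : cX 0 (B ω') = 0 := by
      have := h1 0 le_rfl
      rw [timeChange_zero] at this
      exact_mod_cast this
    rw [z]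
    refine hind _ _ _ ?_ ?_
    · by_cases hp : p
      · exact Or.inl hp
      · refine Or.inr ?_
        rw [← NNReal.coe_le_coe]
        simp only [cX, cY, B]
        rw [h1 _ h0h, h2 _ ht, zero_add]
        by_contra hlt
        exact hb ⟨not_le.1 hlt, hp⟩
    · rw [← NNReal.coe_le_coe]
      have := h4 h hh
      linarith
  have hRSX : ∀ᵐ ω ∂μ, cX 0 (B ω) ≤ cX (0 + h) (B ω) := by
    filter_upwards [eX, M₁.clockInc_pos le_rfl] with ω h1 h2
    rw [← NNReal.coe_le_coe]
    have := h2 h hh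
    linarith
  have hRSY : ∀ᵐ ω ∂μ, cY t (B ω) ≤ cY (t + h) (B ω) := by
    filter_upwards [eY, M₂.clockInc_pos ht] with ω h1 h2
    rw [← NNReal.coe_le_coe]
    have := h2 h hh
    linarith
  have eprod : (fun ω => √((cX (0 + h) (B ω) : ℝ) - cX 0 (B ω))
      * √((cY (t + h) (B ω) : ℝ) - cY t (B ω)))
      =ᵐ[μ] fun ω => √(clockInc DX σX τX 0 h ω) * √(clockInc DY σY τY t h ω) := by
    filter_upwards [eX, eY] with ω h1 h2
    rw [h1, h2]
  have hint : Integrable (fun ω => √(clockInc DX σX τX 0 h ω) * √(clockInc DY σY τY t h ω)) μ :=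
    (M₁.memLp_sqrt le_rfl hh).integrable_mul (M₂.memLp_sqrt ht hh)
  have key := M₁.driver.integral_mul_abs_bound M₂.driver hB hi (hcX 0) (hcX (0 + h)) (hcY t)
    (hcY (t + h)) hRSX hRSY
    (nullMeasurableSet_overtakeEvent p M₁.shock M₂.shock DX σX DY σY t h) hgood
    (hint.congr eprod.symm)
  rw [covariance_eq_sub (M₁.memLp_absReturn le_rfl hh) (M₂.memLp_absReturn ht hh),
    M₁.integral_absReturn le_rfl hh, M₂.integral_absReturn ht hh]
  have e1 : ∫ ω, (absReturn (logPrice W₁ DX σX τX) 0 h * absReturn (logPrice W₂ DY σY τY) t h) ω ∂μ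
      = ∫ ω, |W₁ (cX (0 + h) (B ω)) ω - W₁ (cX 0 (B ω)) ω|
        * |W₂ (cY (t + h) (B ω)) ω - W₂ (cY t (B ω)) ω| ∂μ := by
    refine integral_congr_ae ?_
    filter_upwards [M₁.absReturn_eq 0 h, M₂.absReturn_eq t h] with ω h1 h2
    rw [Pi.mul_apply, h1, h2]
  rw [e1]
  rw [integral_congr_ae eprod] at key
  have e2 : ∫ ω, (overtakeEvent p DX σX DY σY τX τY t h).indicator
        (fun ω => √((cX (0 + h) (B ω) : ℝ) - cX 0 (B ω))
          * √((cY (t + h) (B ω) : ℝ) - cY t (B ω))) ω ∂μ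
      = ∫ ω, (overtakeEvent p DX σX DY σY τX τY t h).indicator
        (fun ω => √(clockInc DX σX τX 0 h ω)) ω * √(clockInc DY σY τY t h ω) ∂μ := by
    refine integral_congr_ae ?_
    filter_upwards [eprod] with ω h1
    by_cases hω : ω ∈ overtakeEvent p DX σX DY σY τX τY t h
    · simpa [hω] using h1
    · simp [hω]
  rw [e2] at key
  have hs := Real.mul_self_sqrt (show (0 : ℝ) ≤ 2 / Real.pi by positivity)
  refine le_trans (le_of_eq ?_) key
  congr 1
  linear_combination -(∫ ω, √(clockInc DX σX τX 0 h ω) ∂μ) *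
    (∫ ω, √(clockInc DY σY τY t h ω) ∂μ) * hs

theorem tendsto_covariance_absReturn [IsProbabilityMeasure μ] {p : Prop}
    (M₁ : IsPriceModel W₁ TX τX DX σX rX μ) (M₂ : IsPriceModel W₂ TY τY DY σY rY μ)
    (hi : IndepFun (fun ω => ((fun s => W₁ s ω), (fun s => W₂ s ω)))
      (fun ω => (pointCounts TX ω, pointCounts TY ω)) μ)
    (hind : IndepLater p W₁ W₂ μ) (ht : 0 ≤ t) (hpt : p ∨ 0 < t) :
    Tendsto (fun h => cov[absReturn (logPrice W₁ DX σX τX) 0 h,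
        absReturn (logPrice W₂ DY σY τY) t h; μ] / h) (𝓝[>] 0)
      (𝓝 (2 / Real.pi * cov[limitVol DX σX τX 0, limitVol DY σY τY t; μ])) := by
  have hmX := M₁.memLp_sqrt_div le_rfl
  have hmY := M₂.memLp_sqrt_div ht
  have h1 := tendsto_integral_mul_of_eLpNorm hmX hmY (M₁.memLp_limitVol le_rfl)
    (M₂.memLp_limitVol ht) (M₁.clockInc_asymptotics le_rfl).2 (M₂.clockInc_asymptotics ht).2
  have h2 := (M₁.tendsto_integral_sqrt le_rfl).mul (M₂.tendsto_integral_sqrt ht)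
  have h3 := (h1.sub h2).const_mul (2 / Real.pi)
  have hbad := nullMeasurableSet_overtakeEvent p M₁.shock M₂.shock DX σX DY σY t
  -- The error over `h` is an L² product whose first factor is restricted to vanishing events, so it
  -- tends to 0.
  have h4 := tendsto_integral_mul_of_eLpNorm
    (f := fun h => (overtakeEvent p DX σX DY σY τX τY t h).indicator
      fun ω => √(clockInc DX σX τX 0 h ω / h)) (f₀ := fun _ => 0)
    (g := fun h ω => √(clockInc DY σY τY t h ω / h)) (μ := μ) (l := 𝓝[>] (0 : ℝ))
    (hmX.mono fun h hh => ⟨hh.aestronglyMeasurable.indicator₀ (hbad h),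
      (eLpNorm_indicator_le _).trans_lt hh.2⟩) hmY
    (memLp_const 0) (M₂.memLp_limitVol ht)
    (by
      have := tendsto_eLpNorm_indicator hbad hmX (M₁.memLp_limitVol le_rfl)
        (M₁.clockInc_asymptotics le_rfl).2 (eventually_notMem_overtakeEvent M₁ M₂ hpt)
      simpa using this)
    (M₂.clockInc_asymptotics ht).2
  simp only [zero_mul, integral_zero] at h4
  rw [covariance_eq_sub (M₁.memLp_limitVol le_rfl) (M₂.memLp_limitVol ht)]
  refine (tendsto_iff_of_dist ?_).2 h3
  refine squeeze_zero' (Eventually.of_forall fun _ => dist_nonneg) ?_ h4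
  filter_upwards [self_mem_nhdsWithin] with h hh
  have hh' : (0 : ℝ) < h := hh
  have key := covariance_absReturn_bound M₁ M₂ hi hind ht hh'
  rw [Real.dist_eq]
  have hne : √h ≠ 0 := (Real.sqrt_pos.2 hh').ne'
  have eind : ∀ ω, (overtakeEvent p DX σX DY σY τX τY t h).indicator
      (fun ω => √(clockInc DX σX τX 0 h ω) / √h) ω
      = (overtakeEvent p DX σX DY σY τX τY t h).indicator
        (fun ω => √(clockInc DX σX τX 0 h ω)) ω / √h := by
    intro ω
    by_cases hω : ω ∈ overtakeEvent p DX σX DY σY τX τY t h <;> simp [hω]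
  simp_rw [Real.sqrt_div' _ hh'.le, eind, div_mul_div_comm, Real.mul_self_sqrt hh'.le]
  simp only [integral_div]
  rw [div_mul_div_comm, Real.mul_self_sqrt hh'.le, ← sub_div, ← mul_div_assoc, ← sub_div, abs_div,
    abs_of_pos hh']
  gcongr

/-- The limit of the correlations of absolute returns. -/
theorem tendsto_corrCoeff_absReturn [IsProbabilityMeasure μ] {p : Prop}
    (M₁ : IsPriceModel W₁ TX τX DX σX rX μ) (M₂ : IsPriceModel W₂ TY τY DY σY rY μ)
    (hi : IndepFun (fun ω => ((fun s => W₁ s ω), (fun s => W₂ s ω)))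
      (fun ω => (pointCounts TX ω, pointCounts TY ω)) μ)
    (hind : IndepLater p W₁ W₂ μ) (ht : 0 ≤ t) (hpt : p ∨ 0 < t) :
    Tendsto (fun h => corrCoeff (absReturn (logPrice W₁ DX σX τX) 0 h)
        (absReturn (logPrice W₂ DY σY τY) t h) μ) (𝓝[>] 0)
      (𝓝 (2 / Real.pi * cov[limitVol DX σX τX 0, limitVol DY σY τY t; μ] /
        √((∫ ω, limitVol DX σX τX 0 ω * limitVol DX σX τX 0 ω ∂μ
            - 2 / Real.pi * (∫ ω, limitVol DX σX τX 0 ω ∂μ) ^ 2) *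
          (∫ ω, limitVol DY σY τY t ω * limitVol DY σY τY t ω ∂μ
            - 2 / Real.pi * (∫ ω, limitVol DY σY τY t ω ∂μ) ^ 2)))) := by
  -- Positivity of the limiting variances keeps the denominator away from zero.
  have hpos : ∀ {W : ℝ≥0 → Ω → ℝ} {T : Ω → Set ℝ} {τ : ℤ → Ω → ℝ} {D σ r : ℝ}
      (_ : IsPriceModel W T τ D σ r μ) {t : ℝ} (_ : 0 ≤ t),
      0 < ∫ ω, limitVol D σ τ t ω * limitVol D σ τ t ω ∂μ
            - 2 / Real.pi * (∫ ω, limitVol D σ τ t ω ∂μ) ^ 2 := by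
    intro W T τ D σ r M t ht
    refine foldedVar_pos (M.memLp_limitVol ht) ?_
    have hσ := M.σ_pos
    have hD := M.D_pos
    filter_upwards [hasLaw_exp_pos M.rate_pos (M.shock.hasLaw_age M.rate_pos ht)] with ω h1
    rw [limitVol]
    positivity
  have hc := tendsto_covariance_absReturn M₁ M₂ hi hind ht hpt
  have hv := ((M₁.tendsto_variance_absReturn le_rfl).mul (M₂.tendsto_variance_absReturn ht)).sqrt
  refine (hc.div hv (Real.sqrt_pos.2 (mul_pos (hpos M₁ le_rfl) (hpos M₂ ht))).ne').congr' ?_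
  filter_upwards [self_mem_nhdsWithin] with h hh
  have hh' : (0 : ℝ) < h := hh
  rw [corrCoeff, Pi.div_apply, div_mul_div_comm, Real.sqrt_div' _ (by positivity),
    Real.sqrt_mul_self hh'.le]
  field_simp

end PairOfPrices

/-! ### Brownian motions as drivers, and independence of their increments. -/

section Drivers

variable {Ω : Type*} [MeasurableSpace Ω] {μ : Measure Ω}

theorem isDriver_of_isBrownianReal {W : ℝ≥0 → Ω → ℝ} (hm : ∀ s, Measurable (W s))
    (hW : IsBrownianReal W μ) : IsDriver W μ where
  measurable := hm
  cont := hW.cont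
  incr r s hrs := by
    have h := hW.toIsPreBrownianReal.hasLaw_sub s r
    have e : nndist s.1 r.1 = s - r := by
      ext
      rw [coe_nndist, Real.dist_eq, NNReal.coe_sub hrs]
      exact abs_of_nonneg (sub_nonneg.2 (by exact_mod_cast hrs))
    rw [e] at h
    exact h

/-- The two independent Gaussian parts have variances in the proportions ρ² and 1 - ρ², which add up
to 1. -/
theorem isDriver_correlatedProcess {W W' : ℝ≥0 → Ω → ℝ} {ρ : ℝ} (hρ : -1 ≤ ρ) (hρ' : ρ ≤ 1)
    (hW : IsDriver W μ) (hW' : IsDriver W' μ)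
    (hi : IndepFun (fun ω s => W s ω) (fun ω s => W' s ω) μ) :
    IsDriver (correlatedProcess ρ W W') μ where
  measurable s := ((hW.measurable s).const_mul ρ).add ((hW'.measurable s).const_mul _)
  cont := by
    filter_upwards [hW.cont, hW'.cont] with ω h1 h2
    exact (h1.const_mul ρ).add (h2.const_mul _)
  incr r s hrs := by
    have m1 := hW.measurable
    have m2 := hW'.measurable
    have hρ2 : 0 ≤ 1 - ρ ^ 2 := by nlinarith
    have h1 := gaussianReal_const_mul (hW.incr r s hrs) ρ
    have h2 := gaussianReal_const_mul (hW'.incr r s hrs) (√(1 - ρ ^ 2))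
    have hi' : IndepFun (fun ω => ρ * (W s ω - W r ω))
        (fun ω => √(1 - ρ ^ 2) * (W' s ω - W' r ω)) μ :=
      hi.comp (φ := fun w : ℝ≥0 → ℝ => ρ * (w s - w r))
        (ψ := fun w : ℝ≥0 → ℝ => √(1 - ρ ^ 2) * (w s - w r))
        (by fun_prop) (by fun_prop)
    have h3 := gaussianReal_add_gaussianReal_of_indepFun hi' h1.map_eq h2.map_eq
    refine ⟨by unfold correlatedProcess; fun_prop, ?_⟩
    have e1 : (fun ω => correlatedProcess ρ W W' s ω - correlatedProcess ρ W W' r ω)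
        = (fun ω => ρ * (W s ω - W r ω)) + fun ω => √(1 - ρ ^ 2) * (W' s ω - W' r ω) := by
      ext ω
      simp only [correlatedProcess, Pi.add_apply]
      ring
    rw [e1, h3]
    congr 1
    · simp
    · ext
      simp only [NNReal.coe_add, NNReal.coe_mul, NNReal.coe_mk, Real.sq_sqrt hρ2]
      ring

theorem indepFun_increments_of_le [IsProbabilityMeasure μ] {W : ℝ≥0 → Ω → ℝ}
    (hW : IsBrownianReal W μ) {s r' s' : ℝ≥0} (h : s ≤ r') (h' : r' ≤ s') :
    IndepFun (fun ω => W s ω - W 0 ω) (fun ω => W s' ω - W r' ω) μ := by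
  -- The partition 0 ≤ s ≤ r' ≤ s' has three increments; the middle one is discarded.
  have hmono : Monotone ![0, s, r', s'] := by
    rw [Fin.monotone_iff_le_succ]
    intro i
    fin_cases i
    · exact zero_le
    · exact h
    · exact h'
  have := (hW.toIsPreBrownianReal.hasIndepIncrements 3 ![0, s, r', s'] hmono).indepFun
    (show (0 : Fin 3) ≠ 2 by decide)
  exact this

theorem indepLater_self [IsProbabilityMeasure μ] {W : ℝ≥0 → Ω → ℝ} (hW : IsBrownianReal W μ) :
    IndepLater False W W μ := fun _ _ _ h h' =>
  indepFun_increments_of_le hW (h.resolve_left id) h'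

theorem indepFun_prodMk_right [IsProbabilityMeasure μ] {A B C : Ω → ℝ} (hA : Measurable A)
    (hB : Measurable B) (hC : Measurable C) (hAB : IndepFun A B μ)
    (hABC : IndepFun (fun ω => (A ω, B ω)) C μ) : IndepFun A (fun ω => (B ω, C ω)) μ := by
  have hBC : IndepFun B C μ := hABC.comp (φ := Prod.snd) (ψ := id) measurable_snd measurable_id
  rw [indepFun_iff_map_prod_eq_prod_map_map (by fun_prop) (by fun_prop)] at hAB hABC hBC ⊢
  have := Measure.isProbabilityMeasure_map hA.aemeasurable (μ := μ)
  have := Measure.isProbabilityMeasure_map hB.aemeasurable (μ := μ)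
  have := Measure.isProbabilityMeasure_map hC.aemeasurable (μ := μ)
  rw [hBC, ← Measure.prodAssoc_prod, ← hAB, ← hABC, Measure.map_map (by fun_prop) (by fun_prop)]
  rfl

/-- For ρ = 0 the second driver is `W'`, independent of `W` altogether. Otherwise the early
increment of `W` is independent of the pair formed by the later increments of `W` and `W'`. -/
theorem indepLater_correlatedProcess [IsProbabilityMeasure μ] {W W' : ℝ≥0 → Ω → ℝ} {ρ : ℝ}
    (hm : ∀ s, Measurable (W s)) (hm' : ∀ s, Measurable (W' s)) (hW : IsBrownianReal W μ)
    (hi : IndepFun (fun ω s => W s ω) (fun ω s => W' s ω) μ) :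
    IndepLater (ρ = 0) W (correlatedProcess ρ W W') μ := by
  intro s r' s' h h'
  by_cases hρ : ρ = 0
  · have := hi.comp (φ := fun w : ℝ≥0 → ℝ => w s - w 0) (ψ := fun w : ℝ≥0 → ℝ => w s' - w r') (by fun_prop)
      (by fun_prop)
    convert this using 2
    all_goals simp [correlatedProcess, hρ]
  · have hs := h.resolve_left hρ
    have h1 := indepFun_increments_of_le hW hs h'
    have h2 : IndepFun (fun ω => (W s ω - W 0 ω, W s' ω - W r' ω))
        (fun ω => W' s' ω - W' r' ω) μ :=
      hi.comp (φ := fun w : ℝ≥0 → ℝ => (w s - w 0, w s' - w r')) (ψ := fun w : ℝ≥0 → ℝ => w s' - w r') (by fun_prop)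
        (by fun_prop)
    have h3 := indepFun_prodMk_right (by fun_prop) (by fun_prop) (by fun_prop) h1 h2
    have h4 := h3.comp (φ := id) (ψ := fun p : ℝ × ℝ => ρ * p.1 + √(1 - ρ ^ 2) * p.2)
      measurable_id (by fun_prop)
    convert h4 using 2
    · rfl
    · simp only [correlatedProcess, Function.comp]
      ring

end Drivers

/-! ### The exponential and Gaussian variables of the limit. -/

section LimitVariables

variable {Ω : Type*} [MeasurableSpace Ω] {ν : Measure Ω}

theorem memLp_rpow_of_hasLaw {S : Ω → ℝ} {r D : ℝ} (hr : 0 < r) (hD : 0 < D)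
    (hS : HasLaw S (expMeasure r) ν) : MemLp (fun ω => S ω ^ (D - 1 / 2)) 2 ν := by
  have := memLp_two_rpow_expMeasure hr hD
  rw [← hS.map_eq, memLp_map_measure_iff (by fun_prop) hS.aemeasurable] at this
  exact this

/-- The exponent is nonpositive because D ≤ 1/2, so adding u ≥ 0 only decreases the power. -/
theorem memLp_add_rpow_of_hasLaw {S : Ω → ℝ} {r D u : ℝ} (hr : 0 < r) (hD : 0 < D)
    (hD' : D ≤ 1 / 2) (hS : HasLaw S (expMeasure r) ν) (hu : 0 ≤ u) :
    MemLp (fun ω => (u + S ω) ^ (D - 1 / 2)) 2 ν := by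
  have hm := hS.aemeasurable
  refine (memLp_rpow_of_hasLaw hr hD hS).mono
    ((hm.const_add u).pow_const _).aestronglyMeasurable ?_
  filter_upwards [hasLaw_exp_pos hr hS] with ω h
  rw [Real.norm_of_nonneg (by positivity), Real.norm_of_nonneg (by positivity)]
  exact Real.rpow_le_rpow_of_nonpos h (by linarith) (by linarith)

theorem exponential_pair_tail {E F : Ω → ℝ≥0∞} {l l' : ℝ} (hE : IsExponential E l ν)
    (hF : IsExponential F l' ν) (hi : IndepFun E F ν) {x y : ℝ} (hx : 0 ≤ x) (hy : 0 ≤ y) :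
    ν {ω | ENNReal.ofReal x < E ω ∧ ENNReal.ofReal y < F ω}
      = ENNReal.ofReal (Real.exp (-(l * x + l' * y))) := by
  have := hi.measure_inter_preimage_eq_mul (Ioi (ENNReal.ofReal x)) (Ioi (ENNReal.ofReal y))
    measurableSet_Ioi measurableSet_Ioi
  have e1 := hE.tail x hx
  have e2 := hF.tail y hy
  change ν (E ⁻¹' Ioi (ENNReal.ofReal x)) = _ at e1
  change ν (F ⁻¹' Ioi (ENNReal.ofReal y)) = _ at e2
  rw [e1, e2] at this
  refine Eq.trans ?_ (this.trans ?_)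
  · rfl
  · rw [← ENNReal.ofReal_mul (Real.exp_nonneg _), ← Real.exp_add]
    congr 2; ring

variable [IsProbabilityMeasure ν]

theorem hasLaw_div_exp {S : Ω → ℝ} {r : ℝ} (hr : 0 < r) (hS : HasLaw S (expMeasure 1) ν) :
    HasLaw (fun ω => S ω / r) (expMeasure r) ν := by
  refine hasLaw_exp_of_tails (hS.aemeasurable.div_const r) hr fun x hx => ?_
  have := expMeasure_Ioi one_pos (mul_nonneg hr.le hx)
  rw [one_mul, ← hS.map_eq, Measure.map_apply_of_aemeasurable hS.aemeasurable measurableSet_Ioi]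
    at this
  rw [← this]
  congr 1
  ext ω
  simp only [mem_ofPred_eq, mem_preimage, mem_Ioi]
  rw [lt_div_iff₀ hr, mul_comm]

/-- Independence factors the moments, with E|N| = √(2/π) and E N² = 1. This matches the variance
formula for returns. -/
theorem memLp_abs_mul {S N f : Ω → ℝ} (hN : HasLaw N (gaussianReal 0 1) ν) {p : ℝ}
    (hf : f = fun ω => S ω ^ p) (hfm : MemLp f 2 ν) (hi : IndepFun S N ν) :
    MemLp (fun ω => |N ω| * f ω) 2 ν ∧
    Var[fun ω => |N ω| * f ω; ν] = ∫ ω, f ω * f ω ∂ν - 2 / Real.pi * (∫ ω, f ω ∂ν) ^ 2 := by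
  have hNm := hN.aemeasurable
  have hfa := hfm.aestronglyMeasurable.aemeasurable
  have hN2 : Integrable (fun ω => N ω ^ 2) ν := by
    have : Integrable (fun x : ℝ => x ^ 2) (ν.map N) := by
      rw [hN.map_eq]; exact (memLp_id_gaussianReal 2).integrable_sq
    exact this.comp_aemeasurable hNm
  have i1 : IndepFun (fun ω => |N ω|) f ν := by
    rw [hf]
    exact (hi.comp (φ := fun x => x ^ p) (ψ := fun x => |x|) (by fun_prop) (by fun_prop)).symm
  have i2 : IndepFun (fun ω => N ω ^ 2) (fun ω => f ω ^ 2) ν := by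
    have := i1.comp (φ := fun x => x ^ 2) (ψ := fun x => x ^ 2) (by fun_prop) (by fun_prop)
    simpa [Function.comp_def] using this
  have e1 : ∫ ω, |N ω| ∂ν = √(2 / Real.pi) := by
    rw [← integral_abs_gaussianReal_std, ← hN.integral_comp (f := fun x => |x|) (by fun_prop)]; rfl
  have e2 : ∫ ω, N ω ^ 2 ∂ν = 1 := by
    have h := integral_sq_gaussianReal 1
    rw [← hN.integral_comp (f := fun x => x ^ 2) (by fun_prop)] at h
    exact_mod_cast h
  have hmem : MemLp (fun ω => |N ω| * f ω) 2 ν := by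
    rw [memLp_two_iff_integrable_sq (by fun_prop)]
    have := i2.integrable_mul hN2 hfm.integrable_sq
    refine this.congr (ae_of_all _ fun ω => ?_)
    simp [mul_pow]
  refine ⟨hmem, ?_⟩
  rw [variance_eq_sub hmem]
  have e3 := i1.integral_fun_mul_eq_mul_integral (by fun_prop) (by fun_prop)
  have e4 := i2.integral_fun_mul_eq_mul_integral (by fun_prop) (by fun_prop)
  have e5 : ∫ ω, ((fun ω => |N ω| * f ω) ^ 2) ω ∂ν = ∫ ω, N ω ^ 2 * f ω ^ 2 ∂ν :=
    integral_congr_ae (ae_of_all _ fun ω => by simp [mul_pow])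
  rw [e5, e4, e3, e1, e2, one_mul, mul_pow, Real.sq_sqrt (by positivity)]
  simp_rw [sq]

theorem ofReal_lt_min_iff {r x : ℝ} (hr : 0 < r) {e f : ℝ≥0∞} :
    ENNReal.ofReal (r * x) < min (ENNReal.ofReal r * e) f
      ↔ ENNReal.ofReal x < e ∧ ENNReal.ofReal (r * x) < f := by
  rw [lt_min_iff, ENNReal.ofReal_mul hr.le,
    ENNReal.mul_lt_mul_iff_right (by simpa using hr) ENNReal.ofReal_ne_top]

section Min

variable {E F : Ω → ℝ≥0∞} {l l' : ℝ}

/-- Either variable may be infinite when its rate is 0, but the rates are not both 0. This matters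
because `toReal` sends `∞` to 0. -/
theorem exponential_min_ne_top (hr : 0 < l + l') (hE : IsExponential E l ν)
    (hF : IsExponential F (l' / (l + l')) ν) (hi : IndepFun E F ν) :
    ∀ᵐ ω ∂ν, min (ENNReal.ofReal (l + l') * E ω) (F ω) ≠ ∞ := by
  rw [ae_iff]
  have hle : ∀ n : ℕ, ν {ω | ¬ min (ENNReal.ofReal (l + l') * E ω) (F ω) ≠ ∞}
      ≤ ENNReal.ofReal (Real.exp (-((l + l') * n))) := by
    intro n
    have h := exponential_pair_tail hE hF hi (Nat.cast_nonneg n)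
      (mul_nonneg hr.le (Nat.cast_nonneg n))
    rw [show l * (n : ℝ) + l' / (l + l') * ((l + l') * n) = (l + l') * n by field_simp] at h
    rw [← h]
    refine measure_mono fun ω hω => ?_
    have hω' : min (ENNReal.ofReal (l + l') * E ω) (F ω) = ∞ := by simpa using hω
    exact (ofReal_lt_min_iff hr).1 (by rw [hω']; exact ENNReal.ofReal_lt_top)
  have hlim : Tendsto (fun n : ℕ => ENNReal.ofReal (Real.exp (-((l + l') * n)))) atTop (𝓝 0) := by
    have h1 : Tendsto (fun n : ℕ => (l + l') * (n : ℝ)) atTop atTop :=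
      tendsto_natCast_atTop_atTop.const_mul_atTop hr
    have := ENNReal.tendsto_ofReal ((Real.tendsto_exp_neg_atTop_nhds_zero).comp h1)
    simpa using this
  exact le_antisymm (ge_of_tendsto' hlim hle) zero_le

theorem lt_min_toReal_iff (hr : 0 < l + l') (hE : IsExponential E l ν)
    (hF : IsExponential F (l' / (l + l')) ν) (hi : IndepFun E F ν) {S : Ω → ℝ}
    (hS : ∀ ω, S ω = (min (ENNReal.ofReal (l + l') * E ω) (F ω)).toReal) :
    ∀ᵐ ω ∂ν, ∀ x : ℝ, 0 ≤ x → (x < S ω / (l + l') ↔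
      (ENNReal.ofReal x < E ω ∧ ENNReal.ofReal ((l + l') * x) < F ω)) := by
  filter_upwards [exponential_min_ne_top hr hE hF hi] with ω h x hx
  rw [lt_div_iff₀ hr, mul_comm, hS, ← ENNReal.ofReal_lt_iff_lt_toReal (by positivity) h,
    ofReal_lt_min_iff hr]

theorem hasLaw_min (hr : 0 < l + l') (hE : IsExponential E l ν)
    (hF : IsExponential F (l' / (l + l')) ν) (hi : IndepFun E F ν) {S : Ω → ℝ}
    (hS : ∀ ω, S ω = (min (ENNReal.ofReal (l + l') * E ω) (F ω)).toReal) :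
    HasLaw S (expMeasure 1) ν := by
  have hm : Measurable S := by
    have h1 := hE.measurable
    have h2 := hF.measurable
    rw [funext hS]
    fun_prop
  refine hasLaw_exp_of_tails hm.aemeasurable one_pos fun x hx => ?_
  have hx' : 0 ≤ x / (l + l') := by positivity
  have h := exponential_pair_tail hE hF hi hx' (mul_nonneg hr.le hx')
  rw [show l * (x / (l + l')) + l' / (l + l') * ((l + l') * (x / (l + l'))) = 1 * x by
    field_simp] at h
  rw [← h]
  refine measure_congr ?_
  filter_upwards [lt_min_toReal_iff hr hE hF hi hS] with ω h1
  have := h1 _ hx'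
  rw [div_lt_div_iff_of_pos_right hr] at this
  exact propext this

end Min

end LimitVariables

/-! ### Expressing the limit by standard exponential variables. -/

section FinalLimit

variable {Ω : Type*} [MeasurableSpace Ω] {μ : Measure Ω} [IsProbabilityMeasure μ]
  {Ω' : Type*} [MeasurableSpace Ω'] {ν : Measure Ω'} [IsProbabilityMeasure ν]

/-- The constant relating the limiting volatility to the standardised age. -/
noncomputable def volScale (D σ r : ℝ) : ℝ := σ * √(2 * D) * r⁻¹ ^ (D - 1 / 2)

theorem IsPriceModel.limitVol_moments {W : ℝ≥0 → Ω → ℝ} {T : Ω → Set ℝ} {τ : ℤ → Ω → ℝ}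
    {D σ r t : ℝ} (M : IsPriceModel W T τ D σ r μ) (ht : 0 ≤ t) {S N : Ω' → ℝ}
    (hS : HasLaw S (expMeasure 1) ν) (hN : HasLaw N (gaussianReal 0 1) ν) (hi : IndepFun S N ν) :
    ∫ ω, limitVol D σ τ t ω * limitVol D σ τ t ω ∂μ
        - 2 / Real.pi * (∫ ω, limitVol D σ τ t ω ∂μ) ^ 2
      = volScale D σ r ^ 2 * Var[fun ω => |N ω| * S ω ^ (D - 1 / 2); ν] := by
  have hage := M.shock.hasLaw_age M.rate_pos ht
  have hdiv := hasLaw_div_exp M.rate_pos hS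
  have hr := M.rate_pos
  have key : ∀ φ : ℝ → ℝ, Measurable φ →
      ∫ ω, φ (age (fun n => τ n ω) t) ∂μ = ∫ ω, φ (S ω / r) ∂ν := fun φ hφ =>
    (hage.integral_comp hφ.aestronglyMeasurable).trans
      (hdiv.integral_comp hφ.aestronglyMeasurable).symm
  have hpow : ∀ᵐ ω ∂ν, (S ω / r) ^ (D - 1 / 2) = r⁻¹ ^ (D - 1 / 2) * S ω ^ (D - 1 / 2) := by
    filter_upwards [hasLaw_exp_pos one_pos hS] with ω h
    rw [div_eq_inv_mul, Real.mul_rpow (by positivity) h.le]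
  have e1 : ∫ ω, limitVol D σ τ t ω ∂μ = volScale D σ r * ∫ ω, S ω ^ (D - 1 / 2) ∂ν := by
    have := key (fun x => σ * √(2 * D) * x ^ (D - 1 / 2)) (by fun_prop)
    simp only [limitVol]
    rw [this, ← integral_const_mul]
    refine integral_congr_ae ?_
    filter_upwards [hpow] with ω h
    rw [h, volScale]; ring
  have e2 : ∫ ω, limitVol D σ τ t ω * limitVol D σ τ t ω ∂μ
      = volScale D σ r ^ 2 * ∫ ω, S ω ^ (D - 1 / 2) * S ω ^ (D - 1 / 2) ∂ν := by
    have := key (fun x => (σ * √(2 * D) * x ^ (D - 1 / 2)) * (σ * √(2 * D) * x ^ (D - 1 / 2)))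
      (by fun_prop)
    simp only [limitVol]
    rw [this, ← integral_const_mul]
    refine integral_congr_ae ?_
    filter_upwards [hpow] with ω h
    rw [h, volScale]; ring
  rw [e1, e2, (memLp_abs_mul hN rfl (memLp_rpow_of_hasLaw one_pos M.D_pos hS) hi).2]
  ring

theorem IsPriceModel.covariance_limitVol {W₁ W₂ : ℝ≥0 → Ω → ℝ} {TX TY : Ω → Set ℝ}
    {τX τY : ℤ → Ω → ℝ} {DX DY σX σY rX rY a b c t : ℝ}
    (M₁ : IsPriceModel W₁ TX τX DX σX rX μ) (M₂ : IsPriceModel W₂ TY τY DY σY rY μ)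
    (hv : HasPairVoid TX TY a b c μ) (hac : rY = a + c) (ht : 0 ≤ t) {S₁ S₂ : Ω' → ℝ}
    (hS₁ : HasLaw S₁ (expMeasure 1) ν) (hS₂ : HasLaw S₂ (expMeasure 1) ν)
    (htail : ∀ x y : ℝ, 0 ≤ x → 0 ≤ y → ν {ω | x < S₁ ω / rX ∧ y < S₂ ω / rY}
      = ENNReal.ofReal (Real.exp (-(a * max x y + b * x + c * y)))) :
    cov[limitVol DX σX τX 0, limitVol DY σY τY t; μ] = volScale DX σX rX * volScale DY σY rY *
      cov[fun ω => S₁ ω ^ (DX - 1 / 2), fun ω => (rY * t + S₂ ω) ^ (DY - 1 / 2); ν]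
        * Real.exp (-(rY * t)) := by
  have hrX := M₁.rate_pos
  have hrY := M₂.rate_pos
  have hX := M₁.shock.aemeasurable_age 0
  have hY := M₂.shock.aemeasurable_age 0
  -- The ages at time 0 and the rescaled limit variables have equal joint tails, hence the same law.
  have hmap : μ.map (fun ω => (age (fun n => τX n ω) 0, age (fun n => τY n ω) 0))
      = ν.map (fun ω => (S₁ ω / rX, S₂ ω / rY)) := by
    have hm := (hS₁.aemeasurable.div_const rX).prodMk (hS₂.aemeasurable.div_const rY)
    have h1 := Measure.isProbabilityMeasure_map (μ := μ) (hX.prodMk hY)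
    have h2 := Measure.isProbabilityMeasure_map (μ := ν) hm
    have hμ : ∀ x y : ℝ, 0 ≤ x → 0 ≤ y → _ := fun x y hx hy =>
      measure_age_pair M₁.shock M₂.shock hv le_rfl hx hy
    refine measure_prod_ext_of_tails ?_ fun x y hx hy => ?_
    · rw [hμ 0 0 le_rfl le_rfl]; simp
    · rw [hμ x y hx hy, if_neg (not_lt.2 hy), zero_add, sub_zero, ← htail x y hx hy,
        Measure.map_apply_of_aemeasurable hm (measurableSet_Ioi.prod measurableSet_Ioi)]
      rfl
  have hcov : cov[fun ω => age (fun n => τX n ω) 0 ^ (DX - 1 / 2),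
        fun ω => (t + age (fun n => τY n ω) 0) ^ (DY - 1 / 2); μ]
      = cov[fun ω => (S₁ ω / rX) ^ (DX - 1 / 2), fun ω => (t + S₂ ω / rY) ^ (DY - 1 / 2); ν] := by
    have m1 : Measurable fun q : ℝ × ℝ => q.1 ^ (DX - 1 / 2) := by fun_prop
    have m2 : Measurable fun q : ℝ × ℝ => (t + q.2) ^ (DY - 1 / 2) := by fun_prop
    rw [← covariance_map_fun (X := fun q : ℝ × ℝ => q.1 ^ (DX - 1 / 2))
      (Y := fun q : ℝ × ℝ => (t + q.2) ^ (DY - 1 / 2)) m1.aestronglyMeasurable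
      m2.aestronglyMeasurable (hX.prodMk hY), hmap,
      covariance_map_fun m1.aestronglyMeasurable m2.aestronglyMeasurable
        ((hS₁.aemeasurable.div_const rX).prodMk (hS₂.aemeasurable.div_const rY))]
  -- Pulling the rates out of the powers leaves standard exponential variables.
  have hscale : cov[fun ω => (S₁ ω / rX) ^ (DX - 1 / 2),
        fun ω => (t + S₂ ω / rY) ^ (DY - 1 / 2); ν]
      = rX⁻¹ ^ (DX - 1 / 2) * (rY⁻¹ ^ (DY - 1 / 2) *
        cov[fun ω => S₁ ω ^ (DX - 1 / 2), fun ω => (rY * t + S₂ ω) ^ (DY - 1 / 2); ν]) := by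
    rw [← covariance_const_mul_right, ← covariance_const_mul_left]
    have c1 : (fun ω => (S₁ ω / rX) ^ (DX - 1 / 2))
        =ᵐ[ν] fun ω => rX⁻¹ ^ (DX - 1 / 2) * S₁ ω ^ (DX - 1 / 2) := by
      filter_upwards [hasLaw_exp_pos one_pos hS₁] with ω h
      rw [div_eq_inv_mul, Real.mul_rpow (by positivity) h.le]
    have c2 : (fun ω => (t + S₂ ω / rY) ^ (DY - 1 / 2))
        =ᵐ[ν] fun ω => rY⁻¹ ^ (DY - 1 / 2) * (rY * t + S₂ ω) ^ (DY - 1 / 2) := by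
      filter_upwards [hasLaw_exp_pos one_pos hS₂] with ω h
      rw [← Real.mul_rpow (by positivity) (by positivity)]
      congr 1
      field_simp
    rw [covariance, covariance, integral_congr_ae c1, integral_congr_ae c2]
    refine integral_congr_ae ?_
    filter_upwards [c1, c2] with ω h1 h2
    rw [h1, h2]
  have hage := covariance_age_pair M₁.shock M₂.shock hv hrX hrY hac ht
    (measurable_rpow_const_real (DX - 1 / 2)) (measurable_rpow_const_real (DY - 1 / 2))
    (memLp_two_rpow_expMeasure hrX M₁.D_pos) (memLp_two_rpow_expMeasure hrY M₂.D_pos)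
    (memLp_add_rpow_of_hasLaw hrY M₂.D_pos M₂.D_le (M₂.shock.hasLaw_age hrY le_rfl) ht)
  have hlim : cov[limitVol DX σX τX 0, limitVol DY σY τY t; μ]
      = (σX * √(2 * DX)) * ((σY * √(2 * DY)) * cov[fun ω => age (fun n => τX n ω) 0 ^ (DX - 1 / 2),
        fun ω => age (fun n => τY n ω) t ^ (DY - 1 / 2); μ]) := by
    rw [← covariance_const_mul_right, ← covariance_const_mul_left]
    rfl
  rw [hlim, hage, hcov, hscale, volScale, volScale]
  ring

/-- The limit of the correlations, in terms of standard exponential variables. -/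
theorem IsPriceModel.tendsto_corrCoeff {W₁ W₂ : ℝ≥0 → Ω → ℝ} {TX TY : Ω → Set ℝ}
    {τX τY : ℤ → Ω → ℝ} {DX DY σX σY rX rY a b c t : ℝ} {p : Prop}
    (M₁ : IsPriceModel W₁ TX τX DX σX rX μ) (M₂ : IsPriceModel W₂ TY τY DY σY rY μ)
    (hi : IndepFun (fun ω => ((fun s => W₁ s ω), (fun s => W₂ s ω)))
      (fun ω => (pointCounts TX ω, pointCounts TY ω)) μ)
    (hind : IndepLater p W₁ W₂ μ) (hpt : p ∨ 0 < t)
    (hv : HasPairVoid TX TY a b c μ) (hac : rY = a + c) (ht : 0 ≤ t) {S₁ S₂ : Ω' → ℝ}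
    (hS₁ : HasLaw S₁ (expMeasure 1) ν) (hS₂ : HasLaw S₂ (expMeasure 1) ν)
    (htail : ∀ x y : ℝ, 0 ≤ x → 0 ≤ y → ν {ω | x < S₁ ω / rX ∧ y < S₂ ω / rY}
      = ENNReal.ofReal (Real.exp (-(a * max x y + b * x + c * y))))
    {S N : Ω' → ℝ} (hS : HasLaw S (expMeasure 1) ν) (hN : HasLaw N (gaussianReal 0 1) ν)
    (hSN : IndepFun S N ν) :
    Tendsto (fun h : ℝ => corrCoeff (absReturn (logPrice W₁ DX σX τX) 0 h)
        (absReturn (logPrice W₂ DY σY τY) t h) μ) (𝓝[>] 0)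
      (𝓝 (2 / Real.pi *
        (cov[fun ω => S₁ ω ^ (DX - 1 / 2), fun ω => (rY * t + S₂ ω) ^ (DY - 1 / 2); ν] /
          √(Var[fun ω => |N ω| * S ω ^ (DX - 1 / 2); ν] *
            Var[fun ω => |N ω| * S ω ^ (DY - 1 / 2); ν])) *
        Real.exp (-(rY * t)))) := by
  have h := tendsto_corrCoeff_absReturn M₁ M₂ hi hind ht hpt
  rw [M₁.limitVol_moments le_rfl hS hN hSN, M₂.limitVol_moments ht hS hN hSN,
    M₁.covariance_limitVol M₂ hv hac ht hS₁ hS₂ htail] at h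
  have hσX := M₁.σ_pos
  have hσY := M₂.σ_pos
  have hDX := M₁.D_pos
  have hDY := M₂.D_pos
  have hrX := M₁.rate_pos
  have hrY := M₂.rate_pos
  have kX : 0 < volScale DX σX rX := by rw [volScale]; positivity
  have kY : 0 < volScale DY σY rY := by rw [volScale]; positivity
  -- The volatility scales leave the root as the same product that stands in the numerator, and
  -- cancel.
  have e : ∀ kX kY vX vY : ℝ, 0 < kX → 0 < kY →
      √((kX ^ 2 * vX) * (kY ^ 2 * vY)) = (kX * kY) * √(vX * vY) := by
    intro kX kY vX vY hX hY
    rw [show (kX ^ 2 * vX) * (kY ^ 2 * vY) = (kX * kY) ^ 2 * (vX * vY) by ring,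
      Real.sqrt_mul (by positivity), Real.sqrt_sq (by positivity)]
  rw [e _ _ _ _ kX kY] at h
  convert h using 2
  field_simp

theorem foldedVar_exp {S N : Ω' → ℝ} {D : ℝ} (hD : 0 < D) (hS : HasLaw S (expMeasure 1) ν)
    (hN : HasLaw N (gaussianReal 0 1) ν) (hSN : IndepFun S N ν) :
    MemLp (fun ω => |N ω| * S ω ^ (D - 1 / 2)) 2 ν ∧
      0 < Var[fun ω => |N ω| * S ω ^ (D - 1 / 2); ν] := by
  have hm := memLp_rpow_of_hasLaw one_pos hD hS
  have h := memLp_abs_mul hN rfl hm hSN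
  refine ⟨h.1, ?_⟩
  rw [h.2]
  refine foldedVar_pos hm ?_
  filter_upwards [hasLaw_exp_pos one_pos hS] with ω h0
  positivity

end FinalLimit

/-! ### The univariate pair, the law of the minima and the conclusion. -/

/-- All points are common, so the private rates are 0. -/
theorem hasPairVoid_self {Ω : Type*} [MeasurableSpace Ω] {μ : Measure Ω} {T : Ω → Set ℝ}
    {τ : ℤ → Ω → ℝ} {r : ℝ} (hT : IsShockProcess T τ r μ) : HasPairVoid T T r 0 0 μ := by
  intro A B hA hA' hB hB'
  have h := hT.void (A ∪ B) (hA.union hB) (measure_union_lt_top hA'.lt_top hB'.lt_top).ne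
  simp only [zero_mul, add_zero]
  rw [← h]
  congr 1
  ext ω
  simp [inter_union_distrib_left]

/-- The event bounds `E₁` from below by `max x y`, and `S₂`, `S₃` by the rescaled `x`, `y`; the
rescaling restores the rates `l₂` and `l₃`. -/
theorem exponential_min_pair_tail {Ω' : Type*} [MeasurableSpace Ω'] {ν : Measure Ω'}
    [IsProbabilityMeasure ν] {l₁ l₂ l₃ : ℝ} (hlX : 0 < l₁ + l₂) (hlY : 0 < l₁ + l₃)
    {E₁ S₂ S₃ : Ω' → ℝ≥0∞} (hE₁ : IsExponential E₁ l₁ ν)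
    (hS₂ : IsExponential S₂ (l₂ / (l₁ + l₂)) ν) (hS₃ : IsExponential S₃ (l₃ / (l₁ + l₃)) ν)
    (hS : iIndepFun ![E₁, S₂, S₃] ν) {SX SY : Ω' → ℝ}
    (hSX : ∀ ω, SX ω = (min (ENNReal.ofReal (l₁ + l₂) * E₁ ω) (S₂ ω)).toReal)
    (hSY : ∀ ω, SY ω = (min (ENNReal.ofReal (l₁ + l₃) * E₁ ω) (S₃ ω)).toReal) {x y : ℝ}
    (hx : 0 ≤ x) (hy : 0 ≤ y) : ν {ω | x < SX ω / (l₁ + l₂) ∧ y < SY ω / (l₁ + l₃)}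
      = ENNReal.ofReal (Real.exp (-(l₁ * max x y + l₂ * x + l₃ * y))) := by
  have i12 : IndepFun E₁ S₂ ν := hS.indepFun (show (0 : Fin 3) ≠ 1 by decide)
  have i13 : IndepFun E₁ S₃ ν := hS.indepFun (show (0 : Fin 3) ≠ 2 by decide)
  have key := hS.measure_inter_preimage_eq_mul Finset.univ
    (sets := ![Ioi (ENNReal.ofReal (max x y)), Ioi (ENNReal.ofReal ((l₁ + l₂) * x)),
      Ioi (ENNReal.ofReal ((l₁ + l₃) * y))]) (by
      intro i _
      fin_cases i <;> exact measurableSet_Ioi)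
  rw [Fin.prod_univ_three] at key
  have t1 := hE₁.tail (max x y) (le_max_of_le_left hx)
  have t2 := hS₂.tail ((l₁ + l₂) * x) (by positivity)
  have t3 := hS₃.tail ((l₁ + l₃) * y) (by positivity)
  change ν (E₁ ⁻¹' Ioi (ENNReal.ofReal (max x y))) = _ at t1
  change ν (S₂ ⁻¹' Ioi (ENNReal.ofReal ((l₁ + l₂) * x))) = _ at t2
  change ν (S₃ ⁻¹' Ioi (ENNReal.ofReal ((l₁ + l₃) * y))) = _ at t3
  simp only [Matrix.cons_val_zero, Matrix.cons_val_one, Matrix.cons_val_two, Matrix.head_cons,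
    Matrix.tail_cons] at key
  rw [t1, t2, t3, ← ENNReal.ofReal_mul (Real.exp_nonneg _), ← ENNReal.ofReal_mul (by positivity),
    ← Real.exp_add, ← Real.exp_add] at key
  refine Eq.trans (measure_congr ?_) (key.trans ?_)
  · filter_upwards [lt_min_toReal_iff hlX hE₁ hS₂ i12 hSX, lt_min_toReal_iff hlY hE₁ hS₃ i13 hSY]
      with ω h1 h2
    apply propext
    change (x < SX ω / (l₁ + l₂) ∧ y < SY ω / (l₁ + l₃)) ↔ ω ∈ ⋂ i ∈ Finset.univ, _
    rw [h1 x hx, h2 y hy]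
    simp only [mem_iInter, Finset.mem_univ, true_imp_iff, Fin.forall_fin_succ]
    have hmax : ENNReal.ofReal (max x y) < E₁ ω ↔
        ENNReal.ofReal x < E₁ ω ∧ ENNReal.ofReal y < E₁ ω := by
      rw [ENNReal.ofReal_max, max_lt_iff]
    simp
    tauto
  · congr 2
    field_simp
    ring

theorem corollary3p4
    {Ω : Type*} [MeasurableSpace Ω] (μ : Measure Ω) [IsProbabilityMeasure μ]
    -- the parameters
    (DX DY σX σY l₁ l₂ l₃ ρ : ℝ)
    (hDX : 0 < DX) (hDX' : DX ≤ 1 / 2) (hDY : 0 < DY) (hDY' : DY ≤ 1 / 2)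
    (hσX : 0 < σX) (hσY : 0 < σY)
    (hl₁ : 0 ≤ l₁) (hl₂ : 0 ≤ l₂) (hl₃ : 0 ≤ l₃) (hlX : 0 < l₁ + l₂) (hlY : 0 < l₁ + l₃)
    (hρ : -1 ≤ ρ) (hρ' : ρ ≤ 1)
    -- the Brownian motions
    (WX W' : ℝ≥0 → Ω → ℝ)
    (hWXm : ∀ s, Measurable (WX s)) (hWm' : ∀ s, Measurable (W' s))
    (hWX : IsBrownianReal WX μ) (hW' : IsBrownianReal W' μ)
    (hWW' : IndepFun (fun ω s => WX s ω) (fun ω s => W' s ω) μ)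
    -- the shock processes
    (T₁ T₂ T₃ : Ω → Set ℝ)
    (hT₁ : IsPoissonPointProcess T₁ l₁ μ) (hT₂ : IsPoissonPointProcess T₂ l₂ μ)
    (hT₃ : IsPoissonPointProcess T₃ l₃ μ)
    (hT : iIndepFun ![pointCounts T₁, pointCounts T₂, pointCounts T₃] μ)
    -- the two-dimensional Brownian motion is independent of the two-dimensional shock process
    (hWT : IndepFun
      (fun ω => ((fun s => WX s ω), (fun s => correlatedProcess ρ WX W' s ω)))
      (fun ω => (pointCounts (fun ω => T₁ ω ∪ T₂ ω) ω, pointCounts (fun ω => T₁ ω ∪ T₃ ω) ω)) μ)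
    (τX τY : ℤ → Ω → ℝ)
    (hτX : ∀ᵐ ω ∂μ, IsLabelling (fun n => τX n ω) (T₁ ω ∪ T₂ ω))
    (hτY : ∀ᵐ ω ∂μ, IsLabelling (fun n => τY n ω) (T₁ ω ∪ T₃ ω))
    -- the two log-prices
    (X Y : ℝ → Ω → ℝ)
    (hX : X = logPrice WX DX σX τX)
    (hY : Y = logPrice (correlatedProcess ρ WX W') DY σY τY)
    -- the variables in the limit
    {Ω' : Type*} [MeasurableSpace Ω'] (ν : Measure Ω') [IsProbabilityMeasure ν]
    (E₁ S₂ S₃ : Ω' → ℝ≥0∞)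
    (hE₁ : IsExponential E₁ l₁ ν)
    (hS₂ : IsExponential S₂ (l₂ / (l₁ + l₂)) ν)
    (hS₃ : IsExponential S₃ (l₃ / (l₁ + l₃)) ν)
    (hS : iIndepFun ![E₁, S₂, S₃] ν)
    (SX SY : Ω' → ℝ)
    (hSX : ∀ ω, SX ω = (min (ENNReal.ofReal (l₁ + l₂) * E₁ ω) (S₂ ω)).toReal)
    (hSY : ∀ ω, SY ω = (min (ENNReal.ofReal (l₁ + l₃) * E₁ ω) (S₃ ω)).toReal)
    (S N : Ω' → ℝ)
    (hSlaw : HasLaw S (expMeasure 1) ν) (hNlaw : HasLaw N (gaussianReal 0 1) ν)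
    (hSN : IndepFun S N ν)
    -- the lag; at lag zero the two Brownian motions have to be independent
    (t : ℝ) (ht : 0 < t ∨ (t = 0 ∧ ρ = 0)) :
    -- the correlation coefficients are well defined
    (∀ h : ℝ, 0 < h →
      MemLp (absReturn X 0 h) 2 μ ∧ MemLp (absReturn X t h) 2 μ ∧ MemLp (absReturn Y t h) 2 μ ∧
      0 < Var[absReturn X 0 h; μ] ∧ 0 < Var[absReturn X t h; μ] ∧
      0 < Var[absReturn Y t h; μ]) ∧
    -- and so is the limit
    HasLaw SX (expMeasure 1) ν ∧ HasLaw SY (expMeasure 1) ν ∧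
    MemLp (fun ω => SX ω ^ (DX - 1 / 2)) 2 ν ∧
    MemLp (fun ω => ((l₁ + l₃) * t + SY ω) ^ (DY - 1 / 2)) 2 ν ∧
    MemLp (fun ω => S ω ^ (DX - 1 / 2)) 2 ν ∧
    MemLp (fun ω => ((l₁ + l₂) * t + S ω) ^ (DX - 1 / 2)) 2 ν ∧
    MemLp (fun ω => |N ω| * S ω ^ (DX - 1 / 2)) 2 ν ∧
    MemLp (fun ω => |N ω| * S ω ^ (DY - 1 / 2)) 2 ν ∧
    0 < Var[fun ω => |N ω| * S ω ^ (DX - 1 / 2); ν] ∧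
    0 < Var[fun ω => |N ω| * S ω ^ (DY - 1 / 2); ν] ∧
    -- the cross-correlation
    Tendsto (fun h : ℝ => corrCoeff (absReturn X 0 h) (absReturn Y t h) μ) (𝓝[>] 0)
      (𝓝 (2 / Real.pi *
        (cov[fun ω => SX ω ^ (DX - 1 / 2), fun ω => ((l₁ + l₃) * t + SY ω) ^ (DY - 1 / 2); ν] /
          √(Var[fun ω => |N ω| * S ω ^ (DX - 1 / 2); ν] *
            Var[fun ω => |N ω| * S ω ^ (DY - 1 / 2); ν])) *
        Real.exp (-((l₁ + l₃) * t)))) ∧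
    -- the univariate autocorrelation, for a model with shocks of rate `l₁ + l₂`
    (0 < t →
      Tendsto (fun h : ℝ => corrCoeff (absReturn X 0 h) (absReturn X t h) μ) (𝓝[>] 0)
        (𝓝 (2 / Real.pi *
          (cov[fun ω => S ω ^ (DX - 1 / 2), fun ω => ((l₁ + l₂) * t + S ω) ^ (DX - 1 / 2); ν] /
            Var[fun ω => |N ω| * S ω ^ (DX - 1 / 2); ν]) *
          Real.exp (-((l₁ + l₂) * t))))) := by
  subst hX hY
  have ht0 : 0 ≤ t := ht.elim le_of_lt fun h => h.1.ge
  have hvoid : HasPairVoid (fun ω => T₁ ω ∪ T₂ ω) (fun ω => T₁ ω ∪ T₃ ω) l₁ l₂ l₃ μ :=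
    fun _ _ => union_void_pair hT₁ hT₂ hT₃ hT
  have hTX : IsShockProcess (fun ω => T₁ ω ∪ T₂ ω) τX (l₁ + l₂) μ := by
    refine isShockProcess_union hl₁ hl₂ hT₁ hT₂ (fun B hB hB' => ?_) hτX
    -- An empty second set turns the joint void probability into the marginal one.
    have := hvoid B ∅ hB hB' MeasurableSet.empty (by simp)
    simpa [add_mul] using this
  have hTY : IsShockProcess (fun ω => T₁ ω ∪ T₃ ω) τY (l₁ + l₃) μ := by
    refine isShockProcess_union hl₁ hl₃ hT₁ hT₃ (fun B hB hB' => ?_) hτY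
    have := hvoid ∅ B MeasurableSet.empty (by simp) hB hB'
    simpa [add_mul] using this
  have dX := isDriver_of_isBrownianReal hWXm hWX
  have dY := isDriver_correlatedProcess hρ hρ' dX (isDriver_of_isBrownianReal hWm' hW') hWW'
  have MX : IsPriceModel WX (fun ω => T₁ ω ∪ T₂ ω) τX DX σX (l₁ + l₂) μ :=
    ⟨dX, hTX, hWT.comp measurable_fst measurable_fst, hlX, hDX, hDX', hσX⟩
  have MY : IsPriceModel (correlatedProcess ρ WX W') (fun ω => T₁ ω ∪ T₃ ω) τY DY σY (l₁ + l₃) μ :=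
    ⟨dY, hTY, hWT.comp measurable_snd measurable_snd, hlY, hDY, hDY', hσY⟩
  have i12 : IndepFun E₁ S₂ ν := hS.indepFun (show (0 : Fin 3) ≠ 1 by decide)
  have i13 : IndepFun E₁ S₃ ν := hS.indepFun (show (0 : Fin 3) ≠ 2 by decide)
  have lSX := hasLaw_min hlX hE₁ hS₂ i12 hSX
  have lSY := hasLaw_min hlY hE₁ hS₃ i13 hSY
  have fX := foldedVar_exp hDX hSlaw hNlaw hSN
  have fY := foldedVar_exp hDY hSlaw hNlaw hSN
  refine ⟨fun h hh => ⟨MX.memLp_absReturn le_rfl hh, MX.memLp_absReturn ht0 hh,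
    MY.memLp_absReturn ht0 hh, MX.variance_absReturn_pos le_rfl hh,
    MX.variance_absReturn_pos ht0 hh, MY.variance_absReturn_pos ht0 hh⟩, lSX, lSY,
    memLp_rpow_of_hasLaw one_pos hDX lSX,
    memLp_add_rpow_of_hasLaw one_pos hDY hDY' lSY (mul_nonneg hlY.le ht0),
    memLp_rpow_of_hasLaw one_pos hDX hSlaw,
    memLp_add_rpow_of_hasLaw one_pos hDX hDX' hSlaw (mul_nonneg hlX.le ht0),
    fX.1, fY.1, fX.2, fY.2, ?_, fun htpos => ?_⟩
  · exact MX.tendsto_corrCoeff MY hWT (indepLater_correlatedProcess hWXm hWm' hWX hWW')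
      (ht.elim Or.inr fun h => Or.inl h.2) hvoid rfl ht0 lSX lSY
      (fun x y hx hy => exponential_min_pair_tail hlX hlY hE₁ hS₂ hS₃ hS hSX hSY hx hy)
      hSlaw hNlaw hSN
  · have hi : IndepFun (fun ω => ((fun s => WX s ω), (fun s => WX s ω)))
        (fun ω => (pointCounts (fun ω => T₁ ω ∪ T₂ ω) ω, pointCounts (fun ω => T₁ ω ∪ T₂ ω) ω)) μ :=
      hWT.comp (φ := fun q => (q.1, q.1)) (ψ := fun q => (q.1, q.1)) (by fun_prop) (by fun_prop)
    -- The same model twice, with common rate `l₁ + l₂`, private rates 0 and the single variable `S`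
    -- in both places. The Brownian motion is now shared, so a positive lag is needed.
    have h := MX.tendsto_corrCoeff MX hi (indepLater_self hWX) (Or.inr htpos)
      (hasPairVoid_self hTX) (add_zero _).symm ht0 hSlaw hSlaw (fun x y hx hy => by
        have hl := hasLaw_div_exp hlX hSlaw
        have e := expMeasure_Ioi hlX (le_max_of_le_left (b := x) (c := y) hx)
        rw [← hl.map_eq, Measure.map_apply_of_aemeasurable hl.aemeasurable measurableSet_Ioi] at e
        simp only [zero_mul, add_zero]
        rw [← e]
        congr 1
        ext ω
        simp) hSlaw hNlaw hSN
    rwa [Real.sqrt_mul_self fX.2.le] at h
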